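/- Let $F$ be a field, $k$ a principal ideal domain, $n\ge 2$, and $r\in\{1,2\}$. Let $A_m$ be the quiver $1\to 2\to\cdots\to m$, and let $D_m$ ($m\ge 3$) be the quiver with vertices $1,\dots,m$ and arrows $1\to 3$, $2\to 3$, $3\to 4\to\cdots\to m$. For a quiver $Q$ let $\operatorname{Mod}(Q)$ be the category of finite-dimensional representations of $Q$ over $F$. For a vertex $i$ that is not the last one, let $S_i:\operatorname{Mod}(Q)\to\operatorname{Mod}(Q')$ also denote the orthogonal projection through the simple representation $S_i$ (it contracts the vertex $i$ by composing the maps through $i$, and forgets $i$ if $i$ is a source), and let $S_i^r$ be its right adjoint, a fully faithful functor with essential image $S_i^\perp=\{N:\operatorname{Hom}(S_i,N)=\operatorname{Ext}^1(S_i,N)=0\}$. The vertices that remain are renumbered in increasing order. Let $\mathbf D_n^1$ be the configuration with vertices $D_{n+1},\dots,D_3$ (top row) and $A_n,\dots,A_r$ (bottom row), with each vertex $Q$ standing for $\operatorname{Mod}(Q)$, and with the following arrows, whenever both ends are vertices of the configuration: * at each $D_m$ a loop $t$, the automorphism that exchanges the sources $1$ and $2$; * the projections $S_3,\dots,S_m:D_{m+1}\to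 D_m$ and the sections $S_3^r,\dots,S_{m-1}^r:D_m\to D_{m+1}$; * the projections $S_1,S_2:D_{m+1}\to A_m$; * the projections $S_1,\dots,S_m:A_{m+1}\to A_m$ and the sections $S_1^r,\dots,S_{m-1}^r:A_m\to A_{m+1}$. Let $k\mathbf D_n^1$ be the path algebra over $k$ of this quiver modulo the ideal generated by all differences $p-q$ of parallel paths $p,q$ whose composite functors are isomorphic. (For $r=1$ the bottom row is complete; for $r=2$ the vertex $A_1$ is left out.) Then $k\mathbf D_n^1$ is Morita equivalent, as a $k$-algebra, to the path algebra over $k$ of the quiver with the same vertices and with arrows $d:D_{m+1}\to D_m$ in the top row, $a:A_{m+1}\to A_m$ in the bottom row, $c:D_{m+1}\to A_m$, and a loop $t$ at each $D_m$, modulo the relations $$t^2=e_*,\quad tdt=d,\quad (c-ct)d=a(c-ct),\quad dd=0,\quad aa=0 .$$ Here $e_*$ is the trivial path at $D_m$, paths are composed from right to left, and each relation is imposed between all pairs of vertices, where a path that needs a missing arrow counts as zero (so for $r=1$ the third relation includes $a(c-ct)=0$ from $D_3$ to $A_1$). -/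

import Mathlib

open CategoryTheory

noncomputable section

namespace QuiverConf

universe w

/-- The paths of a quiver (of length `≥ 0`). -/
structure QPath (V : Type*) [Quiver V] where
  src : V
  tgt : V
  path : Quiver.Path src tgt

/-- The path algebra `kV`: the free `k`-module on the paths of `V`. The product `p q` of two paths is
the path `q` followed by `p` if `q` ends where `p` starts, and `0` otherwise. -/
def PathAlgebra (k : Type*) [CommRing k] (V : Type*) [Quiver V] := QPath V →₀ k

namespace PathAlgebra
variable (k : Type*) [CommRing k] {V : Type*} [Quiver V]

instance : AddCommGroup (PathAlgebra k V) := inferInstanceAs (AddCommGroup (QPath V →₀ k))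
instance : Module k (PathAlgebra k V) := inferInstanceAs (Module k (QPath V →₀ k))

/-- A path as a basis element. -/
def ofPath {u v : V} (p : Quiver.Path u v) : PathAlgebra k V := Finsupp.single ⟨u, v, p⟩ 1

/-- The idempotent `e_v` -/
def vertex (v : V) : PathAlgebra k V := ofPath k (Quiver.Path.nil : Quiver.Path v v)

/-- An arrow as an element of the path algebra. -/
def arrow {u v : V} (a : u ⟶ v) : PathAlgebra k V := ofPath k a.toPath

open Classical in
/-- The product of two paths. -/
def mulPath (p q : QPath V) : PathAlgebra k V :=
  if h : q.tgt = p.src then ofPath k (q.path.comp (p.path.cast h.symm rfl)) else 0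

/-- The basis of paths. -/
def basis : Module.Basis (QPath V) k (PathAlgebra k V) := ⟨LinearEquiv.refl k (QPath V →₀ k)⟩

/-- The multiplication as a bilinear map. -/
def mulLin : PathAlgebra k V →ₗ[k] PathAlgebra k V →ₗ[k] PathAlgebra k V :=
  (basis k).constr k fun p => (basis k).constr k fun q => mulPath k p q

theorem basis_apply (p : QPath V) : basis k p = ofPath k p.path := rfl

theorem mulLin_ofPath {u v u' v' : V} (p : Quiver.Path u v) (q : Quiver.Path u' v') :
    mulLin k (ofPath k p) (ofPath k q) = mulPath k ⟨u, v, p⟩ ⟨u', v', q⟩ := by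
  rw [← basis_apply k ⟨u, v, p⟩, ← basis_apply k ⟨u', v', q⟩]
  simp [mulLin, Module.Basis.constr_basis]

theorem mulLin_comp {u v w : V} (q : Quiver.Path u v) (p : Quiver.Path v w) :
    mulLin k (ofPath k p) (ofPath k q) = ofPath k (q.comp p) := by
  simp [mulLin_ofPath, mulPath]

theorem mulLin_ne {u v u' v' : V} (p : Quiver.Path u v) (q : Quiver.Path u' v') (h : v' ≠ u) :
    mulLin k (ofPath k p) (ofPath k q) = 0 := by
  simp [mulLin_ofPath, mulPath, h]

theorem induction {P : PathAlgebra k V → Prop} (x : PathAlgebra k V) (h0 : P 0)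
    (hadd : ∀ x y, P x → P y → P (x + y))
    (hsmul : ∀ (c : k) (u v : V) (p : Quiver.Path u v), P (c • ofPath k p)) : P x := by
  refine Finsupp.induction_linear (motive := P) x h0 hadd fun p c => ?_
  have := hsmul c p.src p.tgt p.path
  rwa [← basis_apply, show c • basis k p = (Finsupp.single p c : QPath V →₀ k) from
    (Finsupp.smul_single c p 1).trans (by simp)] at this

theorem mulLin_assoc (x y z : PathAlgebra k V) :
    mulLin k (mulLin k x y) z = mulLin k x (mulLin k y z) := by
  induction x using induction with
  | h0 => simp
  | hadd x x' hx hx' => simp [hx, hx']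
  | hsmul c u v p =>
  induction y using induction with
  | h0 => simp
  | hadd y y' hy hy' => simp_all
  | hsmul c' u' v' q =>
  induction z using induction with
  | h0 => simp
  | hadd z z' hz hz' => rw [map_add, hz, hz', map_add, map_add]
  | hsmul c'' u'' v'' r =>
  simp only [map_smul, LinearMap.smul_apply]
  congr 3
  by_cases h : v' = u
  · subst h
    by_cases h' : v'' = u'
    · subst h'
      rw [mulLin_comp, mulLin_comp, mulLin_comp, mulLin_comp, Quiver.Path.comp_assoc]
    · rw [mulLin_comp, mulLin_ne k _ r h', mulLin_ne k q r h', map_zero]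
  · rw [mulLin_ne k p q h]
    by_cases h' : v'' = u'
    · subst h'
      rw [mulLin_comp, mulLin_ne k p _ h]; simp
    · rw [mulLin_ne k q r h']; simp

variable [Fintype V]

theorem one_mulLin (x : PathAlgebra k V) : mulLin k (∑ v : V, vertex k v) x = x := by
  induction x using induction with
  | h0 => simp
  | hadd x x' hx hx' => rw [map_add, hx, hx']
  | hsmul c u v p =>
  rw [map_smul, map_sum, LinearMap.sum_apply, Finset.sum_eq_single v, vertex, mulLin_comp]
  · rfl
  · intro w _ hw
    exact mulLin_ne k _ _ hw.symm
  · simp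

theorem mulLin_one (x : PathAlgebra k V) : mulLin k x (∑ v : V, vertex k v) = x := by
  induction x using induction with
  | h0 => simp
  | hadd x x' hx hx' => rw [map_add, LinearMap.add_apply, hx, hx']
  | hsmul c u v p =>
  rw [map_smul, LinearMap.smul_apply, map_sum, Finset.sum_eq_single u, vertex, mulLin_comp,
    Quiver.Path.nil_comp]
  · intro w _ hw
    exact mulLin_ne k _ _ hw
  · simp

instance : Ring (PathAlgebra k V) :=
  { (inferInstance : AddCommGroup (PathAlgebra k V)) with
    mul := fun x y => mulLin k x y
    one := ∑ v : V, vertex k v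
    mul_assoc := mulLin_assoc k
    one_mul := one_mulLin k
    mul_one := mulLin_one k
    left_distrib := fun x y z => map_add (mulLin k x) y z
    right_distrib := fun x y z => LinearMap.map_add₂ (mulLin k) x y z
    zero_mul := fun x => LinearMap.map_zero₂ (mulLin k) x
    mul_zero := fun x => map_zero (mulLin k x) }

instance : Algebra k (PathAlgebra k V) :=
  Algebra.ofModule (fun c x y => LinearMap.map_smul₂ (mulLin k) c x y)
    (fun c x y => map_smul (mulLin k x) c y)

end PathAlgebra
/-- Finite-dimensional representations of a quiver `V` over a field `F` (covariant, so that they are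
the finitely generated left modules over the path algebra of a finite acyclic quiver). -/
abbrev Rep (F : Type w) [Field F] (V : Type) [Quiver.{0} V] := Paths V ⥤ FGModuleCat.{w} F

/-- The simple representation `S_i` at the vertex `i`: `F` at `i`, zero elsewhere, every arrow zero. -/
def simple (F : Type w) [Field F] {V : Type} [Quiver.{0} V] [DecidableEq V] (i : V) : Rep F V :=
  Paths.lift
    { obj := fun v => FGModuleCat.of F (PLift (v = i) → F)
      map := fun _ => 0 }

/-- `E ⊥ N`: `Hom(E, N) = 0` and `Ext¹(E, N) = 0`, the latter as "every extension
`0 → N → X → E → 0` splits". -/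
def Perp {F : Type w} [Field F] {V : Type} [Quiver.{0} V] (E N : Rep F V) : Prop :=
  (∀ f : E ⟶ N, f = 0) ∧
  ∀ (X : Rep F V) (f : N ⟶ X) (g : X ⟶ E) (h : f ≫ g = 0),
    (ShortComplex.mk f g h).ShortExact → ∃ r : X ⟶ N, f ≫ r = 𝟙 N

/-- The orthogonal projection through `E` to a quiver `W`: a fully faithful functor `ι`
from the representations of `W` onto the right orthogonal category `E^⊥`, and its left adjoint `π`. -/
structure OrthProj {F : Type w} [Field F] {V : Type} [Quiver.{0} V] (E : Rep F V) (W : Type)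
    [Quiver.{0} W] where
  π : Rep F V ⥤ Rep F W
  ι : Rep F W ⥤ Rep F V
  adj : π ⊣ ι
  full : ι.Full
  faithful : ι.Faithful
  essImage : ∀ N, ι.essImage N ↔ Perp E N

/-- There is at most one path from one vertex to another. -/
class Thin (V : Type) [Quiver.{0} V] : Prop where
  thin : ∀ x y : V, Subsingleton (Quiver.Path x y)

instance (V : Type) [Quiver.{0} V] [h : Thin V] (x y : Paths V) : Subsingleton (x ⟶ y) := h.thin x y

/-- Combinatorial data for the removal of a vertex `i` from a quiver `V` in which `i` has a unique
outgoing arrow: `W` is the quiver obtained by contracting `i` (arrows of `W` are arrows of `V` or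
composites through `i`; for a source `i` one just forgets `i`), `incl` puts the vertices of `W` back
into `V`, and `retr` sends `i` to its successor and fixes the other vertices. -/
structure Contraction {V : Type} [Quiver.{0} V] (i : V) (W : Type) [Quiver.{0} W] where
  incl : W → V
  retr : V → W
  inclPath : ∀ {x y : W}, (x ⟶ y) → Quiver.Path (incl x) (incl y)
  retrPath : ∀ {x y : V}, (x ⟶ y) → Quiver.Path (retr x) (retr y)
  next : i ⟶ incl (retr i)
  retr_incl : ∀ x, retr (incl x) = x
  incl_retr : ∀ v, v ≠ i → incl (retr v) = v
  incl_ne : ∀ x, incl x ≠ i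

section
variable (F : Type w) [Field F] {V W : Type} [Quiver.{0} V] [Quiver.{0} W]

/-- Pull-back of representations along a functor of path categories. -/
def pull (f : Paths V ⥤ Paths W) : Rep F W ⥤ Rep F V := (Functor.whiskeringLeft _ _ _).obj f

variable [DecidableEq V]

theorem simple_isZero {v i : V} (h : v ≠ i) :
    Limits.IsZero ((simple F i).obj ((Paths.of V).obj v)) := by
  rw [Limits.IsZero.iff_id_eq_zero]
  ext x
  funext ⟨e⟩
  exact absurd e h

theorem simple_hom [Thin V] (i : V) (K : Rep F V)
    (hK : ∀ v, v ≠ i → Limits.IsZero (K.obj ((Paths.of V).obj v)))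
    (h : ∀ f : simple F i ⟶ K, f = 0) : Limits.IsZero K := by
  classical
  rw [Functor.isZero_iff]
  intro v
  by_cases hv : v = i
  swap
  · exact hK v hv
  replace hv := hv.symm
  subst hv
  rw [Limits.IsZero.iff_id_eq_zero]
  let f (x : K.obj ((Paths.of V).obj i)) : simple F i ⟶ K :=
    { app := fun u => if e : u = (Paths.of V).obj i then
          eqToHom (by rw [e]; rfl) ≫ FGModuleCat.ofHom (V := PLift (i = i) → F)
            (LinearMap.toSpanSingleton F (K.obj ((Paths.of V).obj i)) x ∘ₗ
              LinearMap.proj (PLift.up rfl)) ≫ eqToHom (by rw [e])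
        else 0
      naturality := by
        intro a b p
        by_cases hb : b = (Paths.of V).obj i
        · by_cases ha : a = (Paths.of V).obj i
          · subst ha; subst hb
            obtain rfl : p = 𝟙 _ := Subsingleton.elim _ _
            simp
          · exact (simple_isZero F ha).eq_of_src _ _
        · exact (hK b hb).eq_of_tgt _ _ }
  ext x
  have h1 : (f x).app ((Paths.of V).obj i) =
      𝟙 _ ≫ FGModuleCat.ofHom (V := PLift (i = i) → F)
        (LinearMap.toSpanSingleton F (K.obj ((Paths.of V).obj i)) x ∘ₗ
          LinearMap.proj (PLift.up rfl)) ≫ 𝟙 _ := dif_pos rfl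
  rw [h (f x), Category.id_comp, Category.comp_id] at h1
  have h2 := congrArg (fun g => g.hom.hom (fun _ => (1 : F))) h1
  have h3 : (0 : K.obj ((Paths.of V).obj i)) = (1 : F) • x := h2
  rw [one_smul] at h3
  exact h3.symm

end

namespace Contraction
variable {V W : Type} [Quiver.{0} V] [Quiver.{0} W] {i : V} (C : Contraction i W)

/-- The functor of path categories given by `incl`. -/
def inclF : Paths W ⥤ Paths V := Paths.lift { obj := C.incl, map := fun e => C.inclPath e }
/-- The functor of path categories given by `retr`. -/
def retrF : Paths V ⥤ Paths W := Paths.lift { obj := C.retr, map := fun e => C.retrPath e }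

theorem unitPath (v : V) : Nonempty (Quiver.Path v (C.incl (C.retr v))) := by
  by_cases h : v = i
  · subst h; exact ⟨C.next.toPath⟩
  · rw [C.incl_retr v h]; exact ⟨.nil⟩

theorem pull_simple_isZero (F : Type w) [Field F] [DecidableEq V] :
    Limits.IsZero ((pull F C.inclF).obj (simple F i)) := by
  rw [Functor.isZero_iff]
  exact fun x => simple_isZero F (C.incl_ne x)

variable [Thin V] [Thin W]

/-- `retr` is left adjoint to `incl`. -/
def adjF : C.retrF ⊣ C.inclF where
  unit := { app := fun v => (C.unitPath v).some
            naturality := fun _ _ _ => Subsingleton.elim _ _ }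
  counit := { app := fun x => eqToHom (C.retr_incl x)
              naturality := fun _ _ _ => Subsingleton.elim _ _ }
  left_triangle_components := fun _ => Subsingleton.elim _ _
  right_triangle_components := fun _ => Subsingleton.elim _ _

variable (F : Type w) [Field F]

/-- Pull-back along `incl` is left adjoint to pull-back along `retr`. -/
def adj : pull F C.inclF ⊣ pull F C.retrF := C.adjF.whiskerLeft _

instance counitIso (M : Rep F W) : IsIso ((C.adj F).counit.app M) := by
  have : ∀ x, IsIso (((C.adj F).counit.app M).app x) := fun x => by
    have : ((C.adj F).counit.app M).app x = M.map (C.adjF.counit.app x) := by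
      simp [adj]
      rfl
    rw [this]
    have : IsIso (C.adjF.counit.app x) :=
      ⟨eqToHom (show x = C.retrF.obj (C.inclF.obj x) from (C.retr_incl x).symm),
        Subsingleton.elim _ _, Subsingleton.elim _ _⟩
    exact Functor.map_isIso M (C.adjF.counit.app x)
  exact NatIso.isIso_of_isIso_app _

theorem unit_app_isIso (N : Rep F V) (v : V) (h : v ≠ i) :
    IsIso (((C.adj F).unit.app N).app ((Paths.of V).obj v)) := by
  have : ((C.adj F).unit.app N).app ((Paths.of V).obj v)
      = N.map (C.adjF.unit.app ((Paths.of V).obj v)) := by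
    simp [adj]
    rfl
  rw [this]
  have e : C.incl (C.retr v) = v := C.incl_retr v h
  have : IsIso (C.adjF.unit.app ((Paths.of V).obj v)) :=
    ⟨eqToHom e, Subsingleton.elim _ _, Subsingleton.elim _ _⟩
  exact Functor.map_isIso N (C.adjF.unit.app ((Paths.of V).obj v))

instance full : (pull F C.retrF).Full := (C.adj F).full_R_of_isSplitMono_counit_app
instance faithful : (pull F C.retrF).Faithful := (C.adj F).faithful_R_of_epi_counit_app

variable [DecidableEq V]

theorem hom_eq_zero (M : Rep F W) (f : simple F i ⟶ (pull F C.retrF).obj M) : f = 0 := by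
  apply ((C.adj F).homEquiv _ _).symm.injective
  exact (C.pull_simple_isZero F).eq_of_src _ _

theorem perp_of_essImage (N : Rep F V) (h : (pull F C.retrF).essImage N) :
    Perp (simple F i) N := by
  have hη : IsIso ((C.adj F).unit.app N) := ((C.adj F).isIso_unit_app_iff_mem_essImage).2 h
  refine ⟨fun f => ?_, fun X f g w hS => ?_⟩
  · rw [← cancel_mono ((C.adj F).unit.app N), Limits.zero_comp]
    exact C.hom_eq_zero F _ _
  · have : IsIso ((pull F C.inclF).map f) := by
      have : ∀ x, IsIso (((pull F C.inclF).map f).app x) := fun x => by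
        have h1 := hS.map_of_exact ((evaluation _ _).obj (C.inclF.obj x))
        exact h1.isIso_f_iff.2 (simple_isZero F (C.incl_ne x))
      exact NatIso.isIso_of_isIso_app _
    refine ⟨(C.adj F).unit.app X ≫ (pull F C.retrF).map (inv ((pull F C.inclF).map f)) ≫
      inv ((C.adj F).unit.app N), ?_⟩
    have h1 : f ≫ (C.adj F).unit.app X =
        (C.adj F).unit.app N ≫ (pull F C.retrF).map ((pull F C.inclF).map f) :=
      (C.adj F).unit.naturality f
    rw [← Category.assoc, h1, Category.assoc, ← Functor.map_comp_assoc, IsIso.hom_inv_id,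
      CategoryTheory.Functor.map_id]
    exact (congrArg _ (Category.id_comp _)).trans (IsIso.hom_inv_id _)

theorem essImage_of_perp (N : Rep F V) (h : Perp (simple F i) N) :
    (pull F C.retrF).essImage N := by
  rw [← (C.adj F).isIso_unit_app_iff_mem_essImage]
  set η := (C.adj F).unit.app N with hηdef
  have hiso : ∀ v, v ≠ i → IsIso (η.app ((Paths.of V).obj v)) := C.unit_app_isIso F N
  have hm : Mono η := by
    apply Preadditive.mono_of_isZero_kernel
    apply simple_hom F i
    · intro v hv
      have := hiso v hv
      have h1 : Mono ((Limits.kernel.ι η).app ((Paths.of V).obj v)) := inferInstance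
      rw [Limits.IsZero.iff_id_eq_zero, ← cancel_mono ((Limits.kernel.ι η).app ((Paths.of V).obj v)),
        ← cancel_mono (η.app ((Paths.of V).obj v))]
      rw [Category.id_comp, Limits.zero_comp, Limits.zero_comp, ← NatTrans.comp_app,
        Limits.kernel.condition]
      rfl
    · intro f
      rw [← cancel_mono (Limits.kernel.ι η), Limits.zero_comp]
      exact h.1 _
  have he : Epi η := by
    apply Preadditive.epi_of_isZero_cokernel
    apply simple_hom F i
    · intro v hv
      have := hiso v hv
      have h1 : Epi ((Limits.cokernel.π η).app ((Paths.of V).obj v)) := inferInstance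
      rw [Limits.IsZero.iff_id_eq_zero,
        ← cancel_epi ((Limits.cokernel.π η).app ((Paths.of V).obj v)),
        ← cancel_epi (η.app ((Paths.of V).obj v))]
      rw [Category.comp_id, Limits.comp_zero, Limits.comp_zero, ← NatTrans.comp_app,
        Limits.cokernel.condition]
      rfl
    · intro f
      let X := Limits.pullback (Limits.cokernel.π η) f
      let a : N ⟶ X := Limits.pullback.lift η 0 (by simp)
      let b : X ⟶ simple F i := Limits.pullback.snd _ _
      have ha : a ≫ Limits.pullback.fst _ _ = η := Limits.pullback.lift_fst _ _ _
      have hab : a ≫ b = 0 := Limits.pullback.lift_snd _ _ _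
      have : Mono a := by
        have : Mono (a ≫ Limits.pullback.fst (Limits.cokernel.π η) f) := by rw [ha]; exact hm
        exact mono_of_mono a (Limits.pullback.fst (Limits.cokernel.π η) f)
      have : Epi b := inferInstanceAs (Epi (Limits.pullback.snd _ _))
      have hex : (ShortComplex.mk a b hab).Exact := by
        apply ShortComplex.exact_of_f_is_kernel
        refine Limits.KernelFork.IsLimit.ofι' _ _ fun {T} g hg => ?_
        have h2 : (g ≫ Limits.pullback.fst (Limits.cokernel.π η) f) ≫ Limits.cokernel.π η = 0 := by
          rw [Category.assoc, Limits.pullback.condition, ← Category.assoc]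
          exact (congrArg (· ≫ f) hg).trans Limits.zero_comp
        refine ⟨Abelian.monoLift η _ h2, ?_⟩
        apply Limits.pullback.hom_ext
        · rw [Category.assoc]
          exact (congrArg _ ha).trans (Abelian.monoLift_comp η _ h2)
        · rw [Category.assoc]
          exact ((congrArg _ hab).trans Limits.comp_zero).trans hg.symm
      have hse : (ShortComplex.mk a b hab).ShortExact := { exact := hex }
      obtain ⟨r, hr⟩ := h.2 X a b hab hse
      let s := ShortComplex.Splitting.ofExactOfRetraction _ hex r hr inferInstance
      have hs : s.s ≫ b = 𝟙 _ := s.s_g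
      calc f = (s.s ≫ b) ≫ f := by rw [hs, Category.id_comp]
        _ = (s.s ≫ Limits.pullback.fst (Limits.cokernel.π η) f) ≫ Limits.cokernel.π η := by
          rw [Category.assoc, Category.assoc, Limits.pullback.condition]
        _ = 0 := by rw [C.hom_eq_zero F _ (s.s ≫ _), Limits.zero_comp]
  exact isIso_of_mono_of_epi η

/-- The orthogonal projection through `S_i`. The projection `π` contracts: it restricts a
representation to the vertices other than `i`, composing the maps through `i`. The section `ι`
inserts, at `i`, a copy of the space at the successor of `i`, with the identity map. -/
def orthProj : OrthProj (simple F i) W where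
  π := pull F C.inclF
  ι := pull F C.retrF
  adj := C.adj F
  full := inferInstance
  faithful := inferInstance
  essImage N := ⟨C.perp_of_essImage F N, C.essImage_of_perp F N⟩

end Contraction

/-- The two families of quivers: the linear quivers `A_m` and the quivers `D_m`. -/
inductive Shape
  | A
  | D

/-- The arrows. Vertices are numbered from `0`: the number `x` stands for the vertex `x + 1`. So
`A_m` is `1 → 2 → ⋯ → m`, and `D_m` has arrows `1 → 3`, `2 → 3`, `3 → 4 → ⋯ → m`. -/
def Shape.IsArrow : Shape → ℕ → ℕ → Prop
  | .A, x, y => y = x + 1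
  | .D, x, y => (x = 0 ∧ y = 2) ∨ (1 ≤ x ∧ y = x + 1)

/-- There is a path from `x` to `y`. -/
def Shape.Reach : Shape → ℕ → ℕ → Prop
  | .A, x, y => x ≤ y
  | .D, x, y => x = y ∨ (x < y ∧ 2 ≤ y)

/-- The vertices of the quiver `A_m` or `D_m`. -/
structure Vert (s : Shape) (m : ℕ) where
  num : ℕ
  lt : num < m
  deriving DecidableEq

instance (s : Shape) (m : ℕ) : Quiver.{0} (Vert s m) where
  Hom x y := PLift (s.IsArrow x.num y.num)

instance {s : Shape} {m : ℕ} (x y : Vert s m) : Subsingleton (x ⟶ y) :=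
  inferInstanceAs (Subsingleton (PLift (s.IsArrow x.num y.num)))

theorem Vert.reach {s : Shape} {m : ℕ} (x y : Vert s m) (h : s.Reach x.num y.num) :
    Nonempty (Quiver.Path x y) := by
  obtain ⟨y, hy⟩ := y
  induction y with
  | zero =>
    have : x = ⟨0, hy⟩ := by
      cases x; cases s <;> simp [Shape.Reach] at h ⊢ <;> omega
    subst this; exact ⟨.nil⟩
  | succ y ih =>
    by_cases hx : x.num = y + 1
    · have : x = ⟨y + 1, hy⟩ := by cases x; simp_all
      subst this; exact ⟨.nil⟩
    · cases s with
      | A =>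
        simp only [Shape.Reach] at h ih
        obtain ⟨p⟩ := ih (by omega) (by omega)
        exact ⟨p.cons ⟨rfl⟩⟩
      | D =>
        simp only [Shape.Reach] at h ih
        by_cases h0 : x.num = 0 ∧ y = 1
        · exact ⟨Quiver.Hom.toPath (⟨Or.inl ⟨h0.1, by simp [h0.2]⟩⟩ : x ⟶ ⟨y + 1, hy⟩)⟩
        · obtain ⟨p⟩ := ih (by omega) (by omega)
          exact ⟨p.cons ⟨Or.inr ⟨by simp; omega, rfl⟩⟩⟩

theorem Vert.path_le {s : Shape} {m : ℕ} {x y : Vert s m} (p : Quiver.Path x y) :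
    x.num + p.length ≤ y.num := by
  induction p with
  | nil => simp
  | cons p e ih =>
    have h := e.down
    rw [Quiver.Path.length_cons]
    cases s <;> simp only [Shape.IsArrow] at h <;> omega

theorem Vert.path_trichotomy {s : Shape} {m : ℕ} {x y z : Vert s m} (p : Quiver.Path x y)
    (q : Quiver.Path x z) :
    (∃ r : Quiver.Path y z, q = p.comp r) ∨ ∃ r : Quiver.Path z y, p = q.comp r := by
  induction p with
  | nil => exact Or.inl ⟨q, by simp⟩
  | @cons b c p e ih =>
    rcases ih with ⟨r, rfl⟩ | ⟨r, rfl⟩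
    · by_cases hl : r.length = 0
      · obtain rfl := Quiver.Path.eq_of_length_zero r hl
        obtain rfl := Quiver.Path.eq_nil_of_length_zero r hl
        exact Or.inr ⟨e.toPath, rfl⟩
      · obtain ⟨d, e', r', -, rfl⟩ := r.eq_toPath_comp_of_length_eq_succ
          (n := r.length - 1) (by omega)
        have : d = c := by
          have h1 := e.down
          have h2 := e'.down
          cases d; cases c
          simp only [Vert.mk.injEq]
          cases s <;> simp only [Shape.IsArrow] at h1 h2 <;> omega
        subst this
        obtain rfl : e = e' := Subsingleton.elim _ _
        exact Or.inl ⟨r', by rw [← Quiver.Path.comp_assoc]; rfl⟩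
    · exact Or.inr ⟨r.cons e, rfl⟩

instance (s : Shape) (m : ℕ) : Thin (Vert s m) where
  thin x y := ⟨fun p q => by
    have key (r : Quiver.Path y y) : r = .nil :=
      Quiver.Path.eq_nil_of_length_zero r (by have := Vert.path_le r; omega)
    rcases Vert.path_trichotomy p q with ⟨r, h⟩ | ⟨r, h⟩ <;> rw [h, key r] <;> rfl⟩

/-- The increasing map from `m` to `m + 1` vertices that skips the number `i`. -/
def Vert.insert {s s' : Shape} {m : ℕ} (i : ℕ) (x : Vert s' m) : Vert s (m + 1) :=
  ⟨if x.num < i then x.num else x.num + 1, by have := x.lt; split <;> omega⟩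

/-- Its left inverse that sends `i` to `j`. -/
def Vert.collapse {s s' : Shape} {m : ℕ} (i j : ℕ) (hi : i < m) (hj : j < m) (x : Vert s (m + 1)) :
    Vert s' m :=
  ⟨if x.num < i then x.num else if x.num = i then j else x.num - 1, by
    have := x.lt; split_ifs <;> omega⟩

/-- The vertex with number `i`, not the last one. -/
def Vert.castSucc {s : Shape} {m : ℕ} (i : ℕ) (hi : i < m) : Vert s (m + 1) := ⟨i, by omega⟩

/-- Contracting a vertex of `A_{m+1}`, not the last one, gives `A_m`. -/
def contractA (m i : ℕ) (hi : i < m) :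
    Contraction (Vert.castSucc i hi : Vert .A (m + 1)) (Vert .A m) where
  incl := Vert.insert i
  retr := Vert.collapse i i hi hi
  inclPath {x y} e := (Vert.reach _ _ (by
    have := e.down; simp only [Shape.IsArrow, Shape.Reach, Vert.insert] at *
    split_ifs <;> omega)).some
  retrPath {x y} e := (Vert.reach _ _ (by
    have := e.down; simp only [Shape.IsArrow, Shape.Reach, Vert.collapse] at *
    split_ifs <;> omega)).some
  next := ⟨by simp [Shape.IsArrow, Vert.insert, Vert.collapse, Vert.castSucc]⟩
  retr_incl x := by
    cases x; simp only [Vert.insert, Vert.collapse, Vert.mk.injEq]; split_ifs <;> omega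
  incl_retr x h := by
    cases x; simp only [Vert.insert, Vert.collapse, Vert.castSucc, Vert.mk.injEq, ne_eq] at *
    split_ifs <;> omega
  incl_ne x h := by
    cases x; simp only [Vert.insert, Vert.castSucc, Vert.mk.injEq] at h
    split_ifs at h <;> omega

/-- Contracting one of the vertices `3, …, m` of `D_{m+1}` gives `D_m`. -/
def contractD (m i : ℕ) (hi : i < m) (h2 : 2 ≤ i) :
    Contraction (Vert.castSucc i hi : Vert .D (m + 1)) (Vert .D m) where
  incl := Vert.insert i
  retr := Vert.collapse i i hi hi
  inclPath {x y} e := (Vert.reach _ _ (by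
    have := e.down; simp only [Shape.IsArrow, Shape.Reach, Vert.insert] at *
    split_ifs <;> omega)).some
  retrPath {x y} e := (Vert.reach _ _ (by
    have := e.down; simp only [Shape.IsArrow, Shape.Reach, Vert.collapse] at *
    split_ifs <;> omega)).some
  next := ⟨by simp [Shape.IsArrow, Vert.insert, Vert.collapse, Vert.castSucc]; omega⟩
  retr_incl x := by
    cases x; simp only [Vert.insert, Vert.collapse, Vert.mk.injEq]; split_ifs <;> omega
  incl_retr x h := by
    cases x; simp only [Vert.insert, Vert.collapse, Vert.castSucc, Vert.mk.injEq, ne_eq] at *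
    split_ifs <;> omega
  incl_ne x h := by
    cases x; simp only [Vert.insert, Vert.castSucc, Vert.mk.injEq] at h
    split_ifs at h <;> omega

/-- Forgetting the source `1` or the source `2` of `D_{m+1}` gives `A_m`. -/
def contractDA (m i : ℕ) (hm : 2 ≤ m) (hi : i ≤ 1) :
    Contraction (Vert.castSucc i (by omega) : Vert .D (m + 1)) (Vert .A m) where
  incl := Vert.insert i
  retr := Vert.collapse i 1 (by omega) (by omega)
  inclPath {x y} e := (Vert.reach _ _ (by
    have := e.down; simp only [Shape.IsArrow, Shape.Reach, Vert.insert] at *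
    split_ifs <;> omega)).some
  retrPath {x y} e := (Vert.reach _ _ (by
    have := e.down; simp only [Shape.IsArrow, Shape.Reach, Vert.collapse] at *
    split_ifs <;> omega)).some
  next := ⟨by
    simp only [Shape.IsArrow, Vert.insert, Vert.collapse, Vert.castSucc]
    split_ifs <;> omega⟩
  retr_incl x := by
    cases x; simp only [Vert.insert, Vert.collapse, Vert.mk.injEq]; split_ifs <;> omega
  incl_retr x h := by
    cases x; simp only [Vert.insert, Vert.collapse, Vert.castSucc, Vert.mk.injEq, ne_eq] at *
    split_ifs <;> omega
  incl_ne x h := by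
    cases x; simp only [Vert.insert, Vert.castSucc, Vert.mk.injEq] at h
    split_ifs at h <;> omega

/-- The vertices of the configuration `𝐃_n^1`: `D_3, …, D_{n+1}` and `A_r, …, A_n`. -/
inductive Node (n r : ℕ)
  | D (m : ℕ) (h : 3 ≤ m ∧ m ≤ n + 1)
  | A (m : ℕ) (h : r ≤ m ∧ m ≤ n)
  deriving DecidableEq

namespace Node
variable {n r : ℕ}

/-- The vertex `D_m` carries a quiver of type `D`, the vertex `A_m` one of type `A`. -/
abbrev shape : Node n r → Shape
  | D _ _ => .D
  | A _ _ => .A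

/-- The number of vertices of the quiver at a vertex of the configuration. -/
abbrev size : Node n r → ℕ
  | D m _ => m
  | A m _ => m

instance : Fintype (Node n r) :=
  Fintype.ofSurjective
    (fun x : Finset.Icc 3 (n + 1) ⊕ Finset.Icc r n => match x with
      | .inl m => D m.1 (Finset.mem_Icc.1 m.2)
      | .inr m => A m.1 (Finset.mem_Icc.1 m.2))
    (fun x => match x with
      | D m h => ⟨.inl ⟨m, Finset.mem_Icc.2 h⟩, rfl⟩
      | A m h => ⟨.inr ⟨m, Finset.mem_Icc.2 h⟩, rfl⟩)

/-- The module category assigned to a vertex of the configuration. -/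
abbrev Mod (F : Type w) [Field F] (u : Node n r) := Rep F (Vert u.shape u.size)

end Node

/-- The automorphism of `D_m` that exchanges the sources `1` and `2`, on vertices. -/
def Vert.swap {m : ℕ} (hm : 3 ≤ m) (x : Vert .D m) : Vert .D m :=
  ⟨if x.num = 0 then 1 else if x.num = 1 then 0 else x.num, by
    have := x.lt; split_ifs <;> omega⟩

/-- The automorphism of `D_m` that exchanges the sources `1` and `2`, on paths. -/
def swapF {m : ℕ} (hm : 3 ≤ m) : Paths (Vert .D m) ⥤ Paths (Vert .D m) :=
  Paths.lift
    { obj := Vert.swap hm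
      map := fun {x y} e => (Vert.reach (Vert.swap hm x) (Vert.swap hm y) (by
        have := e.down; simp only [Shape.IsArrow, Shape.Reach, Vert.swap] at *
        split_ifs <;> omega)).some }

/-- The arrows of the configuration `𝐃_n^1`. Vertex numbers `i` of the quivers `A_m`, `D_m` start
from `0`, so `i` stands for the simple representation `S_{i+1}`. -/
inductive ConfArrow (n r : ℕ) : Node n r → Node n r → Type
  /-- the loop `t` at `D_m` -/
  | t (m : ℕ) (h) : ConfArrow n r (.D m h) (.D m h)
  /-- the projections `S_3, …, S_m` from `D_{m+1}` to `D_m` -/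
  | projD (m : ℕ) (h h') (i : ℕ) (hi : i < m) (h2 : 2 ≤ i) :
      ConfArrow n r (.D (m + 1) h') (.D m h)
  /-- the sections of `S_3, …, S_{m-1}` -/
  | secD (m : ℕ) (h h') (i : ℕ) (hi : i < m) (h2 : 2 ≤ i) (hs : i + 1 < m) :
      ConfArrow n r (.D m h) (.D (m + 1) h')
  /-- the projections `S_1, S_2` from `D_{m+1}` to `A_m` -/
  | projDA (m : ℕ) (h) (h' : 3 ≤ m + 1 ∧ m + 1 ≤ n + 1) (i : ℕ) (hi : i ≤ 1) :
      ConfArrow n r (.D (m + 1) h') (.A m h)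
  /-- the projections `S_1, …, S_m` from `A_{m+1}` to `A_m` -/
  | projA (m : ℕ) (h h') (i : ℕ) (hi : i < m) : ConfArrow n r (.A (m + 1) h') (.A m h)
  /-- the sections of `S_1, …, S_{m-1}` -/
  | secA (m : ℕ) (h h') (i : ℕ) (hi : i < m) (hs : i + 1 < m) :
      ConfArrow n r (.A m h) (.A (m + 1) h')

/-- The underlying quiver of the configuration `𝐃_n^1`. -/
def Conf (n r : ℕ) : Type := Node n r

instance (n r : ℕ) : Fintype (Conf n r) := inferInstanceAs (Fintype (Node n r))

instance (n r : ℕ) : Quiver.{0} (Conf n r) where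
  Hom u v := ConfArrow n r u v

section
variable (F : Type w) [Field F] {n r : ℕ}

/-- The functor between module categories assigned to an arrow of the configuration. -/
def arrowFunctor : {u v : Node n r} → ConfArrow n r u v → (u.Mod F ⥤ v.Mod F)
  | _, _, .t _ h => pull F (swapF h.1)
  | _, _, .projD m _ _ i hi h2 => ((contractD m i hi h2).orthProj F).π
  | _, _, .secD m _ _ i hi h2 _ => ((contractD m i hi h2).orthProj F).ι
  | _, _, .projDA m _ h' i hi => ((contractDA m i (by omega) hi).orthProj F).π
  | _, _, .projA m _ _ i hi => ((contractA m i hi).orthProj F).π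
  | _, _, .secA m _ _ i hi _ => ((contractA m i hi).orthProj F).ι

/-- The injective representation at the last vertex: it has dimension vector `(1, …, 1)` and identity
maps. -/
def lastInj (u : Node n r) : u.Mod F := (Functor.const _).obj (FGModuleCat.of F F)

/-- The functors of the configuration respect these representations, hence the dimension vectors. -/
theorem arrowFunctor_lastInj {u v : Node n r} (e : ConfArrow n r u v) :
    (arrowFunctor F e).obj (lastInj F u) = lastInj F v := by
  cases e <;> rfl

/-- The evaluation of a path: the composite of the functors assigned to its arrows. -/
def evalPath {u : Conf n r} :
    {v : Conf n r} → Quiver.Path u v → (Node.Mod F (n := n) (r := r) u ⥤ Node.Mod F (n := n) (r := r) v)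
  | _, .nil => 𝟭 _
  | _, .cons p e => evalPath p ⋙ arrowFunctor F e

variable (n r) in
/-- The relations of the configuration: `p = q` whenever `p` and `q` are parallel paths that evaluate
to the same (that is, to isomorphic) functors. -/
inductive ConfRel (k : Type*) [CommRing k] :
    PathAlgebra k (Conf n r) → PathAlgebra k (Conf n r) → Prop
  | mk {u v : Conf n r} (p q : Quiver.Path u v) (h : Nonempty (evalPath F p ≅ evalPath F q)) :
      ConfRel k (PathAlgebra.ofPath k p) (PathAlgebra.ofPath k q)

variable (n r) in
/-- The algebra `k𝐃_n^1` of the configuration: the path algebra of the underlying quiver modulo the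
ideal generated by the relations. -/
abbrev ConfAlgebra (k : Type*) [CommRing k] : Type _ := RingQuot (ConfRel F n r k)

end

/-- The arrows of the two-row quiver
`D_{n+1} → ⋯ → D_3`, `A_n → ⋯ → A_r`, with arrows `d` in the top row, `a` in the bottom row, vertical
arrows `c` and a loop `t` at every vertex of the top row. -/
inductive LadderArrow (n r : ℕ) : Node n r → Node n r → Type
  | t (m : ℕ) (h) : LadderArrow n r (.D m h) (.D m h)
  | d (m : ℕ) (h h') : LadderArrow n r (.D (m + 1) h') (.D m h)
  | c (m : ℕ) (h h') : LadderArrow n r (.D (m + 1) h') (.A m h)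
  | a (m : ℕ) (h h') : LadderArrow n r (.A (m + 1) h') (.A m h)

/-- The two-row quiver. -/
def Ladder (n r : ℕ) : Type := Node n r

instance (n r : ℕ) : Fintype (Ladder n r) := inferInstanceAs (Fintype (Node n r))

instance (n r : ℕ) : Quiver.{0} (Ladder n r) where
  Hom u v := LadderArrow n r u v

namespace Ladder
variable (k : Type*) [CommRing k] (n r : ℕ)

/-- An arrow of the two-row quiver as an element of its path algebra. -/
def elt {u v : Node n r} (x : LadderArrow n r u v) : PathAlgebra k (Ladder n r) :=
  PathAlgebra.arrow k (V := Ladder n r) (u := u) (v := v) x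

/-- The sum of the idempotents `e_v` over the top row. -/
def eTop : PathAlgebra k (Ladder n r) :=
  ∑ m ∈ Finset.range (n + 2), if h : 3 ≤ m ∧ m ≤ n + 1 then
    PathAlgebra.vertex k (V := Ladder n r) (.D m h) else 0

/-- The sum of all the loops `t`. -/
def t : PathAlgebra k (Ladder n r) :=
  ∑ m ∈ Finset.range (n + 2), if h : 3 ≤ m ∧ m ≤ n + 1 then elt k n r (.t m h) else 0

/-- The sum of all the arrows `d`. -/
def d : PathAlgebra k (Ladder n r) :=
  ∑ m ∈ Finset.range (n + 2), if h : (3 ≤ m ∧ m ≤ n + 1) ∧ (3 ≤ m + 1 ∧ m + 1 ≤ n + 1) then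
    elt k n r (.d m h.1 h.2) else 0

/-- The sum of all the arrows `c`. -/
def c : PathAlgebra k (Ladder n r) :=
  ∑ m ∈ Finset.range (n + 2), if h : (r ≤ m ∧ m ≤ n) ∧ (3 ≤ m + 1 ∧ m + 1 ≤ n + 1) then
    elt k n r (.c m h.1 h.2) else 0

/-- The sum of all the arrows `a`. -/
def a : PathAlgebra k (Ladder n r) :=
  ∑ m ∈ Finset.range (n + 2), if h : (r ≤ m ∧ m ≤ n) ∧ (r ≤ m + 1 ∧ m + 1 ≤ n) then
    elt k n r (.a m h.1 h.2) else 0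

/-- The relations `t² = e`, `tdt = d`, `(c - ct)d = a(c - ct)`, `dd = 0`, `aa = 0`. Each letter is the
sum of all arrows of that name, so an equation stands for its components between all pairs of
vertices; in a component, a path that needs a missing arrow counts as zero. -/
inductive Rel : PathAlgebra k (Ladder n r) → PathAlgebra k (Ladder n r) → Prop
  | tt : Rel (t k n r * t k n r) (eTop k n r)
  | tdt : Rel (t k n r * d k n r * t k n r) (d k n r)
  | square : Rel ((c k n r - c k n r * t k n r) * d k n r) (a k n r * (c k n r - c k n r * t k n r))
  | dd : Rel (d k n r * d k n r) 0
  | aa : Rel (a k n r * a k n r) 0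

end Ladder

/-- The path algebra of the two-row quiver with its relations. -/
abbrev LadderAlgebra (k : Type*) [CommRing k] (n r : ℕ) : Type _ := RingQuot (Ladder.Rel k n r)

end QuiverConf

end

/-! Every functor of the configuration is the pull-back along a map of vertices, and two parallel
paths give isomorphic functors exactly when their vertex maps agree (`nonempty_evalPath_iso`,
`vmap_eq_of_iso`). The maps that occur are the admissible ones (`Adm`, `exists_path`): they preserve
reachability, respect the last vertex strictly, and are compatible with the exchange of the two
sources. So the algebra of the configuration is spanned by a finite category of monotone maps. On
the bottom row this is a truncated simplex category, and the theorem is a correspondence of Dold–Kan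
type.

To each vertex `v` of the configuration one attaches a representation `ChainRep k v` of the two-row
quiver. In the bottom row it consists of the normalized chains of the poset of vertices of `v`
without the last one, with `a` the simplicial boundary (for `r = 1` the vertex `A_1` carries the
augmentation, spanned by the empty chain). In the top row, for `v` of type `D`, it consists of
chains of the vertices that are neither sources nor last, together with a chosen source. There `d`
is the boundary of the chain, `t` exchanges the sources, and `c` adds the source to the chain. The
square relation holds because the terms that omit the source cancel in the difference `c - ct`.

Let `T` be the sum of these representations (`ConfRep`) and `L` the algebra of the two-row quiver.
The proof rests on two facts.

`T` is a progenerator of `L`. The complex of a row is a cone whose apex is the largest available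
vertex, so the chains through the apex generate (`eq_top_of_generators_mem`). A dual homomorphism
can be written down for each of them (`exists_dual`), which gives a dual basis of `T`. One generator
at each vertex already recovers all the idempotents, hence `1`.

The algebra of the configuration is the opposite of `End_L(T)` (`confAction_bijective`). An
endomorphism is determined by the coefficients of the images of the generators. A generator `s` of
`v` and a chain `l` of `u` in the same component amount to one admissible map, the step function
that jumps at `s` and takes the values `l` there (`exists_adm`). Thus there are as many coefficients
as admissible maps, and the coefficients of the admissible maps themselves form a unitriangular
matrix (`AdmMap.weight_lt_of_coeff_ne_zero`). Morita theory (`Progenerator.isMoritaEquivalent`) then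
finishes the proof. -/

noncomputable section

namespace QuiverConf

/-! ### Morita equivalence with the endomorphism ring of a progenerator -/

namespace Progenerator

universe u

variable {L T : Type u} [Ring L] [AddCommGroup T] [Module L T]

/-- Precomposition makes `Hom(T, N)` a left module over the opposite of the endomorphism ring. -/
abbrev homModule (N : Type u) [AddCommGroup N] [Module L N] :
    Module (Module.End L T)ᵐᵒᵖ (T →ₗ[L] N) where
  smul s f := f.comp s.unop
  one_smul _ := rfl
  mul_smul _ _ _ := rfl
  smul_zero _ := rfl
  smul_add _ _ _ := rfl
  add_smul _ _ f := LinearMap.ext fun _ => map_add f _ _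
  zero_smul f := LinearMap.ext fun _ => map_zero f

attribute [local instance] homModule

theorem op_smul_apply {N : Type u} [AddCommGroup N] [Module L N] (s : (Module.End L T)ᵐᵒᵖ)
    (f : T →ₗ[L] N) (x : T) : (s • f) x = f (s.unop x) := rfl

/-- Right multiplication by `l` on the dual module. -/
def mulRight (ξ : T →ₗ[L] L) (l : L) : T →ₗ[L] L where
  toFun x := ξ x * l
  map_add' x y := by rw [map_add, add_mul]
  map_smul' c x := by rw [map_smul, smul_eq_mul, mul_assoc]; rfl

/-- The endomorphism `x ↦ ξ x • y`. -/
def dyad {N : Type u} [AddCommGroup N] [Module L N] (ξ : T →ₗ[L] L) (y : N) : T →ₗ[L] N where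
  toFun x := ξ x • y
  map_add' x x' := by rw [map_add, add_smul]
  map_smul' c x := by rw [map_smul, smul_eq_mul, mul_smul]; rfl

theorem dyad_apply {N : Type u} [AddCommGroup N] [Module L N] (ξ : T →ₗ[L] L) (y : N) (x : T) :
    dyad ξ y x = ξ x • y := rfl

/-- Left module structure on the maps from the dual of `T` to a module over `(End T)ᵒᵖ`. -/
abbrev dualModule (M : Type u) [AddCommGroup M] [Module (Module.End L T)ᵐᵒᵖ M] :
    Module L ((T →ₗ[L] L) →ₗ[(Module.End L T)ᵐᵒᵖ] M) where
  smul l f :=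
    { toFun := fun ξ => f (mulRight ξ l)
      map_add' := fun ξ ξ' => by
        rw [← map_add]; congr 1; ext x; exact add_mul _ _ _
      map_smul' := fun s ξ => by
        rw [RingHom.id_apply, ← map_smul]; rfl }
  one_smul f := LinearMap.ext fun ξ => congrArg f (LinearMap.ext fun x => mul_one _)
  mul_smul l l' f := LinearMap.ext fun ξ =>
    congrArg f (LinearMap.ext fun x => (mul_assoc _ _ _).symm)
  smul_zero _ := rfl
  smul_add _ _ _ := rfl
  add_smul l l' f := LinearMap.ext fun ξ =>
    (congrArg f (LinearMap.ext fun x => mul_add _ _ _)).trans (map_add f _ _)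
  zero_smul f := LinearMap.ext fun ξ =>
    (congrArg f (LinearMap.ext fun x => mul_zero _)).trans (map_zero f)

attribute [local instance] dualModule

theorem dual_smul_apply {M : Type u} [AddCommGroup M] [Module (Module.End L T)ᵐᵒᵖ M] (l : L)
    (f : (T →ₗ[L] L) →ₗ[(Module.End L T)ᵐᵒᵖ] M) (ξ : T →ₗ[L] L) :
    (l • f) ξ = f (mulRight ξ l) := rfl

variable (L T) in
/-- The functor `Hom(T, -)`. -/
def homFunctor : ModuleCat.{u} L ⥤ ModuleCat.{u} (Module.End L T)ᵐᵒᵖ where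
  obj N := ModuleCat.of _ (T →ₗ[L] N)
  map {N N'} h := ModuleCat.ofHom
    { toFun := fun f => h.hom.comp f
      map_add' := fun f g => LinearMap.ext fun x => map_add h.hom _ _
      map_smul' := fun _ _ => rfl }

variable {I J : Type*} [Fintype I] [Fintype J]

/-- Each `n` is the sum of the values at `y i` of the maps `dyad (lam i) n`, so a map out of `N` is
determined by its composites with maps from `T`. -/
theorem homFunctor_faithful (y : I → T) (lam : I → (T →ₗ[L] L)) (h1 : ∑ i, lam i (y i) = 1) :
    (homFunctor L T).Faithful where
  map_injective {N N'} h h' hh := by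
    ext n
    have key (g : N ⟶ N') : g.hom n = ∑ i, g.hom.comp (dyad (lam i) n) (y i) := by
      simp_rw [LinearMap.comp_apply, dyad_apply, ← map_sum, ← Finset.sum_smul, h1, one_smul]
    rw [key, key]
    refine Finset.sum_congr rfl fun i _ => congrArg (fun f : T →ₗ[L] N' => f (y i)) ?_
    exact congrArg (fun q => q.hom (dyad (lam i) n)) hh

theorem comp_dyad {N : Type u} [AddCommGroup N] [Module L N] (f : T →ₗ[L] N) (ξ : T →ₗ[L] L)
    (x : T) : (MulOpposite.op (dyad ξ x : Module.End L T)) • f = dyad ξ (f x) :=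
  LinearMap.ext fun z => map_smul f (ξ z) x

theorem homFunctor_full (y : I → T) (lam : I → (T →ₗ[L] L)) (h1 : ∑ i, lam i (y i) = 1) :
    (homFunctor L T).Full where
  map_surjective {N N'} g := by
    let G : (T →ₗ[L] N) →ₗ[(Module.End L T)ᵐᵒᵖ] (T →ₗ[L] N') := g.hom
    have key (f : T →ₗ[L] N) (t : T) : ∑ i, G (dyad (lam i) (f t)) (y i) = G f t := by
      simp_rw [← comp_dyad, map_smul, op_smul_apply, MulOpposite.unop_op, dyad_apply, map_smul,
        ← Finset.sum_smul, h1, one_smul]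
    have dadd (ζ : T →ₗ[L] L) (n n' : N) : dyad ζ (n + n') = dyad ζ n + dyad ζ n' :=
      LinearMap.ext fun _ => smul_add _ _ _
    -- The formula is forced by the decomposition used for faithfulness. On a value `f t` it gives
    -- `G f t`, since `dyad (lam i) (f t)` is `f` after an endomorphism of `T` and `G` commutes with
    -- precomposition by endomorphisms.
    refine ⟨ModuleCat.ofHom
      { toFun := fun n => ∑ i, G (dyad (lam i) n) (y i)
        map_add' := fun n n' => by
          simp_rw [dadd, map_add, LinearMap.add_apply, Finset.sum_add_distrib]
        map_smul' := fun l n => ?_ }, ?_⟩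
    -- For linearity, `l • n` is written as a sum of values of maps from `T`, where `key` applies.
    · have hn : l • n = ∑ i, dyad (lam i) n (l • y i) := by
        simp_rw [dyad_apply, map_smul, ← Finset.sum_smul, ← Finset.smul_sum, h1, smul_eq_mul,
          mul_one]
      have dsum : ∀ i, dyad (lam i) (l • n) = ∑ j, dyad (lam i) (dyad (lam j) n (l • y j)) := by
        intro i
        ext t
        rw [LinearMap.sum_apply]
        simp_rw [dyad_apply (lam i)]
        rw [← Finset.smul_sum, ← hn]
      simp_rw [dsum, map_sum, LinearMap.sum_apply]
      rw [Finset.sum_comm]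
      simp_rw [key, map_smul, RingHom.id_apply, Finset.smul_sum]
    · ext f
      exact LinearMap.ext fun t => key f t

/-- The preimage of `M` consists of the maps from the dual of `T` to `M`, linear over the opposite
endomorphism ring. An element `m` corresponds to `t ↦ (ζ ↦ dyad ζ t • m)`. The dual basis, read as
`∑ dyad (ξ j) (x j) = 1`, inverts this by `f ↦ ∑ f (x j) (ξ j)`. -/
theorem homFunctor_essSurj (x : J → T) (ξ : J → (T →ₗ[L] L))
    (h2 : ∀ t, ∑ j, ξ j t • x j = t) : (homFunctor L T).EssSurj where
  mem_essImage M := by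
    let N : ModuleCat.{u} L := ModuleCat.of L ((T →ₗ[L] L) →ₗ[(Module.End L T)ᵐᵒᵖ] M)
    let s (ζ : T →ₗ[L] L) (t : T) : (Module.End L T)ᵐᵒᵖ := MulOpposite.op (dyad ζ t)
    have sadd (ζ ζ' : T →ₗ[L] L) (t : T) : s (ζ + ζ') t = s ζ t + s ζ' t :=
      congrArg MulOpposite.op (LinearMap.ext fun _ => add_smul _ _ _)
    have sadd' (ζ : T →ₗ[L] L) (t t' : T) : s ζ (t + t') = s ζ t + s ζ t' :=
      congrArg MulOpposite.op (LinearMap.ext fun _ => smul_add _ _ _)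
    have ssmul (ζ : T →ₗ[L] L) (t : T) (l : L) : s ζ (l • t) = s (mulRight ζ l) t :=
      congrArg MulOpposite.op (LinearMap.ext fun z => (mul_smul (ζ z) l t).symm)
    have smul' (a : (Module.End L T)ᵐᵒᵖ) (ζ : T →ₗ[L] L) (t : T) : s (a • ζ) t = a * s ζ t := rfl
    have smul'' (a : (Module.End L T)ᵐᵒᵖ) (ζ : T →ₗ[L] L) (t : T) :
        s ζ (a.unop t) = s ζ t * a :=
      congrArg MulOpposite.op (LinearMap.ext fun z => (map_smul a.unop (ζ z) t).symm)
    let φ (m : M) : T →ₗ[L] ((T →ₗ[L] L) →ₗ[(Module.End L T)ᵐᵒᵖ] M) :=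
      { toFun := fun t =>
          { toFun := fun ζ => s ζ t • m
            map_add' := fun ζ ζ' => by rw [sadd, add_smul]
            map_smul' := fun a ζ => by rw [smul', mul_smul]; rfl }
        map_add' := fun t t' => LinearMap.ext fun ζ => by
          show s ζ (t + t') • m = s ζ t • m + s ζ t' • m
          rw [sadd', add_smul]
        map_smul' := fun l t => LinearMap.ext fun ζ => by
          show s ζ (l • t) • m = s (mulRight ζ l) t • m
          rw [ssmul] }
    have hφ (m : M) (t : T) (ζ : T →ₗ[L] L) : φ m t ζ = s ζ t • m := rfl
    have hone : ∑ j, s (ξ j) (x j) = 1 := by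
      refine MulOpposite.unop_injective (LinearMap.ext fun t => ?_)
      rw [Finset.unop_sum]
      rw [LinearMap.sum_apply]
      exact h2 t
    let Φ : M →ₗ[(Module.End L T)ᵐᵒᵖ] (T →ₗ[L] N) :=
      { toFun := φ
        map_add' := fun m m' => LinearMap.ext fun t => LinearMap.ext fun ζ => smul_add _ _ _
        map_smul' := fun a m => LinearMap.ext fun t => LinearMap.ext fun ζ => by
          show s ζ t • a • m = s ζ (a.unop t) • m
          rw [smul'', mul_smul] }
    have hbij : Function.Bijective Φ := by
      refine ⟨fun m m' h => ?_, fun f => ?_⟩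
      · have key (m : M) : ∑ j, φ m (x j) (ξ j) = m := by
          simp_rw [hφ, ← Finset.sum_smul, hone, one_smul]
        rw [← key m, ← key m']
        exact Finset.sum_congr rfl fun j _ =>
          DFunLike.congr_fun (DFunLike.congr_fun h (x j)) (ξ j)
      · let f' : T →ₗ[L] ((T →ₗ[L] L) →ₗ[(Module.End L T)ᵐᵒᵖ] M) := f
        refine ⟨∑ j, f' (x j) (ξ j), LinearMap.ext fun t => LinearMap.ext fun ζ => ?_⟩
        show s ζ t • ∑ j, f' (x j) (ξ j) = f' t ζ
        rw [Finset.smul_sum]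
        have : ∀ j, s ζ t • f' (x j) (ξ j) = f' (ξ j t • x j) ζ := by
          intro j
          rw [← map_smul (f' (x j)), map_smul f', dual_smul_apply]
          congr 1
          ext z
          exact map_smul (ξ j) (ζ z) t
        simp_rw [this]
        rw [← LinearMap.sum_apply, ← map_sum, h2]
    exact ⟨N, ⟨((LinearEquiv.ofBijective Φ hbij).toModuleIso).symm⟩⟩

open scoped ModuleCat.Algebra in
/-- If `T` is finitely generated projective and a generator, then `L` is Morita equivalent to the
opposite of the endomorphism ring of `T`. -/
theorem isMoritaEquivalent (k : Type*) [CommRing k] [Algebra k L] [Module k T]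
    [IsScalarTower k L T] [SMulCommClass L k T] (y : I → T) (lam : I → (T →ₗ[L] L))
    (x : J → T) (ξ : J → (T →ₗ[L] L)) (h1 : ∑ i, lam i (y i) = 1) (h2 : ∀ t, ∑ j, ξ j t • x j = t) :
    IsMoritaEquivalent k L (Module.End L T)ᵐᵒᵖ := by
  have := homFunctor_faithful y lam h1
  have := homFunctor_full y lam h1
  have := homFunctor_essSurj x ξ h2
  have : (homFunctor L T).IsEquivalence := {}
  refine ⟨⟨⟨(homFunctor L T).asEquivalence, ?_⟩⟩⟩
  refine ⟨fun {N N'} f c => ?_⟩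
  ext (g : T →ₗ[L] N)
  refine LinearMap.ext fun t => ?_
  show algebraMap k L c • f.hom (g t) = f.hom (g (c • t))
  rw [← map_smul, ← map_smul, algebraMap_smul]

end Progenerator

/-! ### Homomorphisms out of a path algebra. -/

namespace PathAlgebra

variable {k : Type*} [CommRing k] {V : Type*} [Quiver V]

theorem ofPath_mul_ofPath [Fintype V] {u v w : V} (q : Quiver.Path u v) (p : Quiver.Path v w) :
    ofPath k p * ofPath k q = ofPath k (q.comp p) := mulLin_comp k q p

theorem ofPath_mul_ofPath_of_ne [Fintype V] {u v u' v' : V} (p : Quiver.Path u v)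
    (q : Quiver.Path u' v') (h : v' ≠ u) : ofPath k p * ofPath k q = 0 := mulLin_ne k p q h

theorem one_eq_sum_vertex [Fintype V] : (1 : PathAlgebra k V) = ∑ v : V, vertex k v := rfl

variable {R : Type*} [Ring R] [Algebra k R]

/-- A map on paths that respects composition defines an algebra homomorphism. -/
def lift [Fintype V] (φ : ∀ {u v : V}, Quiver.Path u v → R)
    (hcomp : ∀ {u v w : V} (q : Quiver.Path u v) (p : Quiver.Path v w),
      φ (q.comp p) = φ p * φ q)
    (hne : ∀ {u v u' v' : V} (p : Quiver.Path u v) (q : Quiver.Path u' v'), v' ≠ u →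
      φ p * φ q = 0)
    (hone : ∑ v : V, φ (Quiver.Path.nil : Quiver.Path v v) = 1) : PathAlgebra k V →ₐ[k] R :=
  AlgHom.ofLinearMap ((basis k).constr k fun p => φ p.path)
    (by
      rw [one_eq_sum_vertex, map_sum, ← hone]
      exact Finset.sum_congr rfl fun v _ => (basis k).constr_basis k _ ⟨v, v, .nil⟩)
    (by
      intro x y
      have hb {u v : V} (p : Quiver.Path u v) :
          (basis k).constr k (fun p => φ p.path) (ofPath k p) = φ p :=
        (basis k).constr_basis k _ ⟨u, v, p⟩
      induction x using induction with
      | h0 => simp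
      | hadd x x' hx hx' => rw [add_mul, map_add, hx, hx', map_add, add_mul]
      | hsmul c u v p =>
      induction y using induction with
      | h0 => simp
      | hadd y y' hy hy' => rw [mul_add, map_add, hy, hy', map_add, mul_add]
      | hsmul c' u' v' q =>
      rw [smul_mul_smul_comm, map_smul, map_smul, map_smul, smul_mul_smul_comm, hb, hb]
      congr 1
      by_cases h : v' = u
      · subst h
        rw [ofPath_mul_ofPath, hb, hcomp]
      · rw [ofPath_mul_ofPath_of_ne p q h, hne p q h, map_zero])

theorem lift_ofPath [Fintype V] (φ : ∀ {u v : V}, Quiver.Path u v → R) (hcomp hne hone) {u v : V}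
    (p : Quiver.Path u v) : lift (k := k) φ hcomp hne hone (ofPath k p) = φ p :=
  (basis k).constr_basis k _ ⟨u, v, p⟩

end PathAlgebra

universe w

/-! ### The vertex maps of the configuration -/

/-- The exchange of `0` and `1`. -/
def swapNum (x : ℕ) : ℕ := if x = 0 then 1 else if x = 1 then 0 else x

/-- The increasing map that skips `i`. -/
def insertNum (i x : ℕ) : ℕ := if x < i then x else x + 1

/-- The weakly increasing map that takes the value `i` twice. -/
def collapseNum (i x : ℕ) : ℕ := if x < i then x else if x = i then i else x - 1

section
variable {n r : ℕ}

/-- The map on vertex numbers along which the functor of an arrow pulls back. -/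
def arrowMap : {u v : Node n r} → ConfArrow n r u v → ℕ → ℕ
  | _, _, .t _ _ => swapNum
  | _, _, .projD _ _ _ i _ _ => insertNum i
  | _, _, .secD _ _ _ i _ _ _ => collapseNum i
  | _, _, .projDA _ _ _ i _ => insertNum i
  | _, _, .projA _ _ _ i _ => insertNum i
  | _, _, .secA _ _ _ i _ _ => collapseNum i

/-- The functor of path categories along which the functor of an arrow pulls back. -/
def arrowF : {u v : Node n r} → ConfArrow n r u v →
    (Paths (Vert v.shape v.size) ⥤ Paths (Vert u.shape u.size))
  | _, _, .t _ h => swapF h.1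
  | _, _, .projD m _ _ i hi h2 => (contractD m i hi h2).inclF
  | _, _, .secD m _ _ i hi h2 _ => (contractD m i hi h2).retrF
  | _, _, .projDA m _ h' i hi => (contractDA m i (by omega) hi).inclF
  | _, _, .projA m _ _ i hi => (contractA m i hi).inclF
  | _, _, .secA m _ _ i hi _ => (contractA m i hi).retrF

theorem arrowFunctor_eq (F : Type w) [Field F] {u v : Node n r} (e : ConfArrow n r u v) :
    arrowFunctor F e = pull F (arrowF e) := by
  cases e <;> rfl

theorem arrowF_obj_num {u v : Node n r} (e : ConfArrow n r u v) (x : Vert v.shape v.size) :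
    Vert.num ((arrowF e).obj x) = arrowMap e x.num := by
  cases e <;> rfl

/-- The map on vertex numbers along which the functor of a path pulls back. -/
def vmap {u : Conf n r} : {v : Conf n r} → Quiver.Path u v → ℕ → ℕ
  | _, .nil => id
  | _, .cons p e => vmap p ∘ arrowMap e

/-- The functor of path categories along which the functor of a path pulls back. -/
def pathF {u : Conf n r} : {v : Conf n r} → Quiver.Path u v →
    (Paths (Vert (Node.shape (n := n) (r := r) v) (Node.size (n := n) (r := r) v)) ⥤
      Paths (Vert (Node.shape (n := n) (r := r) u) (Node.size (n := n) (r := r) u)))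
  | _, .nil => 𝟭 _
  | _, .cons p e => arrowF e ⋙ pathF p

theorem evalPath_eq (F : Type w) [Field F] {u v : Conf n r} (p : Quiver.Path u v) :
    evalPath F p = pull F (pathF p) := by
  induction p with
  | nil => rfl
  | cons p e ih =>
    exact (congrArg (· ⋙ arrowFunctor F e) ih).trans
      (congrArg (pull F (pathF p) ⋙ ·) (arrowFunctor_eq F e))

theorem pathF_obj_num {u v : Conf n r} (p : Quiver.Path u v)
    (x : Vert (Node.shape (n := n) (r := r) v) (Node.size (n := n) (r := r) v)) :
    Vert.num ((pathF p).obj x) = vmap p x.num := by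
  induction p with
  | nil => rfl
  | cons p e ih =>
    exact (ih _).trans (congrArg (vmap p) (arrowF_obj_num e x))

theorem vmap_comp {u v w : Conf n r} (p : Quiver.Path u v) (q : Quiver.Path v w) :
    vmap (p.comp q) = vmap p ∘ vmap q := by
  induction q with
  | nil => rfl
  | cons q e ih => rw [Quiver.Path.comp_cons, vmap, ih]; rfl

theorem Vert.ext_num {s : Shape} {m : ℕ} {x y : Vert s m} (h : x.num = y.num) : x = y := by
  cases x; cases y; simp_all

/-- The path categories are thin, so a functor between them is determined by its values on vertices.
-/
theorem nonempty_evalPath_iso (F : Type w) [Field F] {u v : Conf n r} (p q : Quiver.Path u v)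
    (h : vmap p = vmap q) : Nonempty (evalPath F p ≅ evalPath F q) := by
  have : pathF p = pathF q := by
    refine CategoryTheory.Functor.ext (fun x => ?_) (fun _ _ _ => Subsingleton.elim _ _)
    exact Vert.ext_num (((pathF_obj_num p x).trans (congrFun h _)).trans (pathF_obj_num q x).symm)
  rw [evalPath_eq, evalPath_eq, this]
  exact ⟨Iso.refl _⟩

/-- Evaluate both functors on the simple representation at the image `y` of `x` under `p`. The first
result is nonzero at `x`, the second one only if `q` also sends `x` to `y`. -/
theorem vmap_eq_of_iso (F : Type w) [Field F] {u v : Conf n r} (p q : Quiver.Path u v)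
    (h : Nonempty (evalPath F p ≅ evalPath F q)) (x : ℕ)
    (hx : x < Node.size (n := n) (r := r) v) : vmap p x = vmap q x := by
  rw [evalPath_eq, evalPath_eq] at h
  obtain ⟨e⟩ := h
  let x' : Vert (Node.shape (n := n) (r := r) v) (Node.size (n := n) (r := r) v) := ⟨x, hx⟩
  let y : Vert (Node.shape (n := n) (r := r) u) (Node.size (n := n) (r := r) u) := (pathF p).obj x'
  by_contra hne
  have hy : ((pathF q).obj x' : Vert _ _) ≠ y := by
    intro h
    apply hne
    exact ((pathF_obj_num p x').symm.trans (congrArg Vert.num h).symm).trans (pathF_obj_num q x')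
  have hz : Limits.IsZero ((simple F y).obj ((pathF q).obj x')) := simple_isZero F hy
  have i := (e.app (simple F y)).app x'
  have hz' : Limits.IsZero ((simple F y).obj ((pathF p).obj x')) := hz.of_iso i
  rw [Limits.IsZero.iff_id_eq_zero] at hz'
  have h1 := congrArg (fun g => g.hom.hom (fun _ => (1 : F))) hz'
  have h2 : (fun _ => (1 : F) : PLift (y = y) → F) = 0 := h1
  exact one_ne_zero (congrFun h2 ⟨rfl⟩)

end

/-! ### Admissible maps and their realization by paths -/

theorem swapNum_swapNum (x : ℕ) : swapNum (swapNum x) = x := by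
  obtain _ | _ | x := x <;> rfl

section
variable {n r : ℕ}

/-- The number of the last vertex. -/
abbrev Node.last (u : Node n r) : ℕ := u.size - 1

/-- The maps of vertices that occur in the configuration. -/
structure Adm (v u : Node n r) (f : ℕ → ℕ) : Prop where
  reach : ∀ x y, v.shape.Reach x y → u.shape.Reach (f x) (f y)
  lt : ∀ x < v.last, f x < u.last
  -- For `j = 0` this is the condition on the last vertex. For larger `j` it fixes irrelevant values
  -- by translation, so that functions on `ℕ` agree as soon as they agree on vertices (`Adm.ext`).
  last : ∀ j, f (v.last + j) = u.last + j
  shape : v.shape = .D → u.shape = .D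
  zero : v.shape = .D → f 0 ≤ 1
  one : v.shape = .D → f 1 = swapNum (f 0)
  two : v.shape = .D → ∀ x, 2 ≤ x → 2 ≤ f x

theorem Shape.Reach.le {s : Shape} {x y : ℕ} (h : s.Reach x y) : x ≤ y := by
  cases s <;> simp only [Shape.Reach] at h <;> omega

theorem Adm.id (u : Node n r) : Adm u u id where
  reach _ _ h := h
  lt _ h := h
  last _ := rfl
  shape h := h
  zero _ := Nat.zero_le _
  one _ := rfl
  two _ _ h := h

theorem Adm.comp {u v w : Node n r} {f g : ℕ → ℕ} (hg : Adm v u g) (hf : Adm w v f) :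
    Adm w u (g ∘ f) where
  reach _ _ h := hg.reach _ _ (hf.reach _ _ h)
  lt _ h := hg.lt _ (hf.lt _ h)
  last j := by rw [Function.comp_apply, hf.last, hg.last]
  shape h := hg.shape (hf.shape h)
  zero h := by
    have h0 := hf.zero h
    have h1 := hg.zero (hf.shape h)
    have h2 := hg.one (hf.shape h)
    rw [Function.comp_apply]
    obtain h3 | h3 : f 0 = 0 ∨ f 0 = 1 := by omega
    · rw [h3]; exact h1
    · rw [h3, h2]; unfold swapNum; split_ifs <;> omega
  one h := by
    have h0 := hf.zero h
    have h2 := hg.one (hf.shape h)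
    rw [Function.comp_apply, Function.comp_apply, hf.one h]
    obtain h3 | h3 : f 0 = 0 ∨ f 0 = 1 := by omega
    · rw [h3]; exact h2
    · rw [h3, h2, swapNum_swapNum]; rfl
  two h x hx := hg.two (hf.shape h) _ (hf.two h x hx)

theorem Adm.arrow (hr : 1 ≤ r) {u v : Node n r} (e : ConfArrow n r u v) :
    Adm v u (arrowMap e) := by
  cases e <;> constructor <;> simp only [arrowMap, Shape.Reach, Node.shape, Node.last, Node.size,
    swapNum, insertNum, collapseNum, reduceCtorEq, forall_const, IsEmpty.forall_iff] <;>
    intros <;> (try split_ifs) <;> omega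

/-- The direction is reversed: a path from `u` to `v` pulls back along a map from the vertices of
`v` to those of `u`. -/
theorem Adm.path (hr : 1 ≤ r) {u v : Conf n r} (p : Quiver.Path u v) : Adm v u (vmap p) := by
  induction p with
  | nil => exact Adm.id u
  | cons p e ih => exact ih.comp (Adm.arrow hr e)

end

/-! ### Factorization of monotone maps into faces and degeneracies. -/

/-- Monotone maps from `{0, …, m' - 1}` to `{0, …, m - 1}` that fix the numbers below `b` and
respect the last number strictly. -/
structure StdMap (b m m' : ℕ) (f : ℕ → ℕ) : Prop where
  fix : ∀ x < b, f x = x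
  mono : Monotone f
  ge : ∀ x, b ≤ x → b ≤ f x
  lt : ∀ x, x + 1 < m' → f x + 1 < m
  last : ∀ j, f (m' - 1 + j) = m - 1 + j

/-- A map that misses the value `i` factors through the face map that skips `i`; the other factor
closes the gap. -/
theorem StdMap.insert_comp {b m m' i : ℕ} {f : ℕ → ℕ} (hf : StdMap b (m + 1) m' f) (hb : b ≤ i)
    (hi : i < m) (hne : ∀ x, f x ≠ i) :
    StdMap b m m' (fun x => if f x < i then f x else f x - 1) ∧
      f = insertNum i ∘ fun x => if f x < i then f x else f x - 1 := by
  refine ⟨⟨fun x hx => ?_, fun x y h => ?_, fun x hx => ?_, fun x hx => ?_, fun j => ?_⟩, ?_⟩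
  · have := hf.fix x hx; split_ifs <;> omega
  · have := hf.mono h; have := hne x; have := hne y; split_ifs <;> omega
  · have := hf.ge x hx; have := hne x; split_ifs <;> omega
  · have := hf.lt x hx; have := hne x; split_ifs <;> omega
  · have := hf.last j; split_ifs <;> omega
  · funext x
    have := hne x
    simp only [Function.comp_apply, insertNum]
    split_ifs <;> omega

/-- A map with equal values at `i` and `i + 1` factors through the degeneracy that identifies them.
`insertNum i` is a section of that degeneracy, so it yields the other factor. -/
theorem StdMap.comp_collapse {b m m' i : ℕ} {f : ℕ → ℕ} (hf : StdMap b m (m' + 1) f) (hb : b ≤ i)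
    (hi : i + 1 < m') (he : f i = f (i + 1)) :
    StdMap b m m' (f ∘ insertNum i) ∧ f = (f ∘ insertNum i) ∘ collapseNum i := by
  refine ⟨⟨fun x hx => ?_, fun x y h => ?_, fun x hx => ?_, fun x hx => ?_, fun j => ?_⟩, ?_⟩
  · have := hf.fix x hx
    rw [Function.comp_apply, insertNum, if_pos (by omega), this]
  · refine hf.mono ?_
    unfold insertNum; split_ifs <;> omega
  · exact hf.ge _ (by unfold insertNum; split_ifs <;> omega)
  · exact hf.lt _ (by unfold insertNum; split_ifs <;> omega)
  · rw [Function.comp_apply, ← hf.last j, insertNum, if_neg (by omega)]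
    congr 1; omega
  · funext x
    by_cases hx : x = i
    · subst hx
      simp [insertNum, collapseNum, he]
    · simp only [Function.comp_apply]
      congr 1
      unfold insertNum collapseNum; split_ifs <;> omega

/-- Without repeated values the map is strictly increasing, so `x ≤ f x`. At the first `x` with `x <
f x`, the value `x` would be missed: smaller numbers are fixed and larger ones have larger images.
-/
theorem StdMap.eq_id {b m m' : ℕ} {f : ℕ → ℕ} (hf : StdMap b m m' f) (hm : b + 1 ≤ m)
    (hm' : b + 1 ≤ m') (h1 : ∀ i, b ≤ i → i + 1 < m → ∃ x, f x = i)
    (h2 : ∀ i, b ≤ i → i + 2 < m' → f i ≠ f (i + 1)) : m = m' ∧ f = id := by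
  have key : ∀ x, x + 1 ≤ m' → f x = x := by
    intro x
    induction x using Nat.strong_induction_on with
    | _ x ih =>
      intro hx
      by_cases hxb : x < b
      · exact hf.fix x hxb
      push Not at hxb
      have hge : x ≤ f x := by
        by_cases hb : x = b
        · subst hb; exact hf.ge _ le_rfl
        · have h3 := ih (x - 1) (by omega) (by omega)
          have h4 : f (x - 1) ≤ f x := hf.mono (by omega)
          have h5 : f (x - 1) ≠ f x := by
            by_cases hx' : x + 1 < m'
            · have := h2 (x - 1) (by omega) (by omega)
              rwa [show x - 1 + 1 = x by omega] at this
            · have h6 := hf.lt (x - 1) (by omega)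
              have h7 := hf.last 0
              rw [show m' - 1 + 0 = x by omega] at h7
              omega
          omega
      by_contra hne
      have hlt : x < f x := by omega
      have hfx : f x + 1 ≤ m := by
        have h7 := hf.last 0
        have : f x ≤ f (m' - 1 + 0) := hf.mono (by omega)
        omega
      obtain ⟨y, hy⟩ := h1 x hxb (by omega)
      by_cases hyx : y < x
      · have := ih y hyx (by omega)
        omega
      · have : f x ≤ f y := hf.mono (by omega)
        omega
  have hmm : m = m' := by
    have h7 := hf.last 0
    have := key (m' - 1) (by omega)
    simp only [add_zero] at h7
    omega
  refine ⟨hmm, funext fun x => ?_⟩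
  by_cases hx : x + 1 ≤ m'
  · exact key x hx
  · have := hf.last (x - (m' - 1))
    rw [show m' - 1 + (x - (m' - 1)) = x by omega] at this
    rw [this, id]; omega

/-- Standard maps are composites of increasing maps that skip a number and weakly increasing maps
that repeat one. -/
theorem StdMap.induction {b lo : ℕ} (hlo : lo = b + 1 ∨ lo = b + 2) (P : ℕ → ℕ → (ℕ → ℕ) → Prop)
    (hid : ∀ m, P m m id)
    (hface : ∀ m m' i f, b ≤ i → i < m → lo ≤ m → P m m' f → P (m + 1) m' (insertNum i ∘ f))
    (hdeg : ∀ m m' i f, b ≤ i → i + 1 < m' → lo ≤ m' → P m m' f →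
      P m (m' + 1) (f ∘ collapseNum i))
    {m m' : ℕ} {f : ℕ → ℕ} (hm : lo ≤ m) (hm' : lo ≤ m') (hf : StdMap b m m' f) : P m m' f := by
  induction hN : m + m' using Nat.strong_induction_on generalizing m m' f with
  | _ N ih =>
    by_cases h1 : ∀ i, b ≤ i → i + 1 < m → ∃ x, f x = i
    · by_cases h2 : ∀ i, b ≤ i → i + 2 < m' → f i ≠ f (i + 1)
      · obtain ⟨rfl, rfl⟩ := hf.eq_id (by omega) (by omega) h1 h2
        exact hid m
      · push Not at h2
        obtain ⟨i, hbi, hi, he⟩ := h2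
        obtain ⟨l, rfl⟩ : ∃ l, m' = l + 1 := ⟨m' - 1, by omega⟩
        obtain ⟨h3, h4⟩ := hf.comp_collapse hbi (by omega) he
        rw [h4]
        exact hdeg _ _ _ _ hbi (by omega) (by omega) (ih _ (by omega) hm (by omega) h3 rfl)
    · push Not at h1
      obtain ⟨i, hbi, hi, hne⟩ := h1
      obtain ⟨l, rfl⟩ : ∃ l, m = l + 1 := ⟨m - 1, by omega⟩
      obtain ⟨h3, h4⟩ := hf.insert_comp hbi (by omega) hne
      -- The factorization must not leave the range `lo ≤ m`. For `lo = b + 2`, the missed value `i`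
      -- and the value `f b` are two distinct numbers from `b` to `l - 1`, so `l ≥ b + 2`.
      have hl : lo ≤ l := by
        rcases hlo with h | h
        · omega
        · have h5 := hf.ge b le_rfl
          have h6 := hf.lt b (by omega)
          have h7 := hne b
          omega
      rw [h4]
      exact hface _ _ _ _ hbi (by omega) hl (ih _ (by omega) hl hm' h3 rfl)

section
variable {n r : ℕ}

theorem exists_path_A (hr : r = 1 ∨ r = 2) {m m' : ℕ} {f : ℕ → ℕ} (h h')
    (hf : StdMap 0 m m' f) :
    ∃ p : @Quiver.Path (Conf n r) _ (Node.A m h) (Node.A m' h'), vmap p = f := by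
  refine StdMap.induction (lo := r) (by omega)
    (fun m m' f => ∀ h h', ∃ p : @Quiver.Path (Conf n r) _ (Node.A m h) (Node.A m' h'), vmap p = f)
    (fun m _ _ => ⟨.nil, rfl⟩) ?_ ?_ h.1 h'.1 hf h h'
  · intro m m' i f _ hi hm hP h h'
    obtain ⟨p, rfl⟩ := hP ⟨hm, by omega⟩ h'
    exact ⟨(Quiver.Hom.toPath (V := Conf n r) (ConfArrow.projA m ⟨hm, by omega⟩ h i hi)).comp p,
      vmap_comp _ _⟩
  · intro m m' i f _ hi hm hP h h'
    obtain ⟨p, rfl⟩ := hP h ⟨hm, by omega⟩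
    exact ⟨.cons p (ConfArrow.secA m' ⟨hm, by omega⟩ h' i (by omega) hi), rfl⟩

theorem exists_path_D {m m' : ℕ} {f : ℕ → ℕ} (h h') (hf : StdMap 2 m m' f) :
    ∃ p : @Quiver.Path (Conf n r) _ (Node.D m h) (Node.D m' h'), vmap p = f := by
  refine StdMap.induction (lo := 3) (by omega)
    (fun m m' f => ∀ h h', ∃ p : @Quiver.Path (Conf n r) _ (Node.D m h) (Node.D m' h'), vmap p = f)
    (fun m _ _ => ⟨.nil, rfl⟩) ?_ ?_ h.1 h'.1 hf h h'
  · intro m m' i f hb hi hm hP h h'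
    obtain ⟨p, rfl⟩ := hP ⟨hm, by omega⟩ h'
    exact ⟨(Quiver.Hom.toPath (V := Conf n r) (ConfArrow.projD m ⟨hm, by omega⟩ h i hi hb)).comp p,
      vmap_comp _ _⟩
  · intro m m' i f hb hi hm hP h h'
    obtain ⟨p, rfl⟩ := hP h ⟨hm, by omega⟩
    exact ⟨.cons p (ConfArrow.secD m' ⟨hm, by omega⟩ h' i (by omega) hb hi), rfl⟩

/-- Every admissible map is the vertex map of a path. -/
theorem exists_path (hr : r = 1 ∨ r = 2) {v u : Node n r} {f : ℕ → ℕ} (hf : Adm v u f) :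
    ∃ p : @Quiver.Path (Conf n r) _ u v, vmap p = f := by
  obtain ⟨m', h'⟩ | ⟨m', h'⟩ := v <;> obtain ⟨m, h⟩ | ⟨m, h⟩ := u
  · have key (g : ℕ → ℕ) (hg : Adm (n := n) (r := r) (.D m' h') (.D m h) g) (h0 : g 0 = 0) :
        StdMap 2 m m' g := by
      have h1 := hg.one rfl
      rw [h0] at h1
      simp only [swapNum, if_pos] at h1
      have h2 := hg.two rfl
      have hfix : ∀ x < 2, g x = x := fun x hx => by
        obtain rfl | rfl : x = 0 ∨ x = 1 := by omega
        · exact h0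
        · exact h1
      refine ⟨hfix, fun x y hxy => ?_, h2, fun x hx => ?_, hg.last⟩
      · by_cases hy : y < 2
        · rw [hfix y hy, hfix x (by omega)]; exact hxy
        · refine (hg.reach x y ?_).le
          simp only [Shape.Reach]; omega
      · have := hg.lt x (show x < m' - 1 by omega)
        change g x < m - 1 at this
        omega
    have h0 := hf.zero rfl
    by_cases h00 : f 0 = 0
    · exact exists_path_D h h' (key f hf h00)
    -- Otherwise `f` exchanges the sources. Composing with the loop `t` reduces to the case where
    -- they are fixed, and `t` is its own inverse.
    · have ht : Adm (n := n) (r := r) (.D m h) (.D m h) swapNum :=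
        Adm.arrow (by omega) (ConfArrow.t m h)
      obtain ⟨p, hp⟩ := exists_path_D h h' (key _ (ht.comp hf) (by
        rw [Function.comp_apply, show f 0 = 1 by omega]; rfl))
      refine ⟨(Quiver.Hom.toPath (V := Conf n r) (ConfArrow.t m h)).comp p,
        (vmap_comp _ _).trans ((congrArg (swapNum ∘ ·) hp).trans ?_)⟩
      exact funext fun x => swapNum_swapNum _
  · exact absurd (hf.shape rfl) (by simp [Node.shape])
  · obtain ⟨m, rfl⟩ : ∃ l, m = l + 1 := ⟨m - 1, by omega⟩
    -- The two sources are not connected by a path, while the image of a linear quiver is totally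
    -- ordered by reachability. So one source is missed, and `f` factors through the projection that
    -- forgets it.
    obtain ⟨i, hi, hne⟩ : ∃ i ≤ 1, ∀ x, f x ≠ i := by
      by_cases h0 : ∃ x, f x = 0
      · obtain ⟨x, hx⟩ := h0
        refine ⟨1, le_rfl, fun y hy => ?_⟩
        rcases le_total x y with hxy | hxy <;> have := hf.reach _ _ hxy <;>
          simp only [Shape.Reach] at this <;> omega
      · push Not at h0
        exact ⟨0, by omega, h0⟩
    have hstd : StdMap 0 (m + 1) m' f := by
      refine ⟨by omega, fun x y h => (hf.reach x y h).le, by omega, fun x hx => ?_, hf.last⟩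
      have := hf.lt x (show x < m' - 1 by omega)
      change f x < m + 1 - 1 at this
      omega
    obtain ⟨h3, h4⟩ := hstd.insert_comp (Nat.zero_le i) (by omega) hne
    have hA : r ≤ m ∧ m ≤ n := ⟨by omega, by omega⟩
    obtain ⟨p, hp⟩ := exists_path_A (n := n) (r := r) hr hA h' h3
    let e : @Quiver.Hom (Conf n r) _ (.D (m + 1) h) (.A m hA) := ConfArrow.projDA m hA h i hi
    refine ⟨(Quiver.Hom.toPath e).comp p, (vmap_comp e.toPath p).trans ?_⟩
    rw [hp]
    exact h4.symm
  · refine exists_path_A hr h h'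
      ⟨by omega, fun x y h => (hf.reach x y h).le, by omega, fun x hx => ?_, hf.last⟩
    have := hf.lt x (show x < m' - 1 by omega)
    change f x < m - 1 at this
    omega

theorem Adm.ext {v u : Node n r} {f g : ℕ → ℕ} (hf : Adm v u f)
    (hg : Adm v u g) (h : ∀ x < v.size, f x = g x) : f = g := by
  funext x
  by_cases hx : x < v.size
  · exact h x hx
  · have h1 := hf.last (x - v.last)
    have h2 := hg.last (x - v.last)
    have hl : v.last = v.size - 1 := rfl
    rw [show v.last + (x - v.last) = x by omega] at h1 h2
    rw [h1, h2]

end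

/-! ### Linear combinations of lists -/

/-- The free module on the lists of numbers. -/
abbrev ListMod (k : Type*) [CommRing k] := List ℕ →₀ k

namespace ListMod

variable (k : Type*) [CommRing k]

/-- A list as a basis element. -/
abbrev of (l : List ℕ) : ListMod k := Finsupp.single l 1

variable {k}

section
variable {M : Type*} [AddCommGroup M] [Module k M]

/-- The linear map with prescribed values on lists. -/
def lin (φ : List ℕ → M) : ListMod k →ₗ[k] M := Finsupp.linearCombination k φ

theorem lin_of (φ : List ℕ → M) (l : List ℕ) : lin φ (of k l) = φ l := by
  simp [lin, of]

theorem eq_of_forall_of {φ ψ : ListMod k →ₗ[k] M} (h : ∀ l, φ (of k l) = ψ (of k l))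
    (x : ListMod k) : φ x = ψ x :=
  LinearMap.congr_fun (Finsupp.lhom_ext' fun l => LinearMap.ext_ring (h l)) x

theorem map_mem (φ : ListMod k →ₗ[k] M)
    {S : Set (List ℕ)} {N : Submodule k M} (h : ∀ l ∈ S, φ (of k l) ∈ N) {x : ListMod k}
    (hx : x ∈ Finsupp.supported k k S) : φ x ∈ N := by
  have : Finsupp.supported k k S ≤ N.comap φ := by
    rw [Finsupp.supported_eq_span_single, Submodule.span_le]
    rintro _ ⟨l, hl, rfl⟩
    exact h l hl
  exact this hx

theorem eqOn_supported (φ ψ : ListMod k →ₗ[k] M)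
    {S : Set (List ℕ)} (h : ∀ l ∈ S, φ (of k l) = ψ (of k l)) {x : ListMod k}
    (hx : x ∈ Finsupp.supported k k S) : φ x = ψ x :=
  sub_eq_zero.1 (map_mem (φ - ψ) (N := ⊥) (fun l hl => sub_eq_zero.2 (h l hl)) hx)

theorem of_mem {S : Set (List ℕ)} {l : List ℕ} (h : l ∈ S) :
    of k l ∈ Finsupp.supported k k S := Finsupp.single_mem_supported k 1 h

end

variable (k) in
/-- Putting `x` in front. -/
def pre (x : ℕ) : ListMod k →ₗ[k] ListMod k := lin fun l => of k (x :: l)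

theorem pre_of (x : ℕ) (l : List ℕ) : pre k x (of k l) = of k (x :: l) := lin_of _ _

variable (k) in
/-- Putting `x` at the end. -/
def app (x : ℕ) : ListMod k →ₗ[k] ListMod k := lin fun l => of k (l ++ [x])

theorem app_of (x : ℕ) (l : List ℕ) : app k x (of k l) = of k (l ++ [x]) := lin_of _ _

variable (k) in
/-- The boundary of a list. -/
def bdList : List ℕ → ListMod k
  | [] => 0
  | x :: l => of k l - pre k x (bdList l)

variable (k) in
/-- The boundary. -/
def bd : ListMod k →ₗ[k] ListMod k := lin (bdList k)

theorem bd_nil : bd k (of k []) = 0 := lin_of _ _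

theorem bd_cons (x : ℕ) (l : List ℕ) :
    bd k (of k (x :: l)) = of k l - pre k x (bd k (of k l)) := by
  rw [bd, lin_of, lin_of, bdList]

theorem bd_pre (x : ℕ) (y : ListMod k) : bd k (pre k x y) = y - pre k x (bd k y) :=
  eq_of_forall_of (φ := bd k ∘ₗ pre k x) (ψ := LinearMap.id - pre k x ∘ₗ bd k) (fun l => by
    rw [LinearMap.comp_apply, pre_of, bd_cons]; rfl) y

theorem bd_bd (y : ListMod k) : bd k (bd k y) = 0 := by
  refine eq_of_forall_of (φ := bd k ∘ₗ bd k) (ψ := 0) (fun l => ?_) y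
  show bd k (bd k (of k l)) = 0
  induction l with
  | nil => rw [bd_nil, map_zero]
  | cons x l ih => rw [bd_cons, map_sub, bd_pre, ih, map_zero, sub_zero, sub_self]

theorem pre_app (x y : ℕ) (z : ListMod k) : pre k y (app k x z) = app k x (pre k y z) :=
  eq_of_forall_of (φ := pre k y ∘ₗ app k x) (ψ := app k x ∘ₗ pre k y) (fun l => by
    rw [LinearMap.comp_apply, LinearMap.comp_apply, app_of, pre_of, pre_of, app_of]; rfl) z

theorem bd_app (x : ℕ) (l : List ℕ) :
    bd k (of k (l ++ [x])) = app k x (bd k (of k l)) + (-1 : k) ^ l.length • of k l := by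
  induction l with
  | nil => simp [bd_nil, bd_cons]
  | cons y l ih =>
    rw [List.cons_append, bd_cons, ih, bd_cons, map_add, map_sub, pre_app, app_of, map_smul, pre_of,
      List.length_cons, pow_succ, mul_neg, mul_one, neg_smul]
    abel

theorem bd_mem (l : List ℕ) :
    bd k (of k l) ∈ Finsupp.supported k k {l' | l'.Sublist l ∧ l'.length + 1 = l.length} := by
  induction l with
  | nil => rw [bd_nil]; exact zero_mem _
  | cons x l ih =>
    rw [bd_cons]
    refine sub_mem (of_mem ⟨List.sublist_cons_self _ _, rfl⟩) (map_mem _ (fun l' hl' => ?_) ih)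
    rw [pre_of]
    exact of_mem ⟨hl'.1.cons_cons x, by simp [hl'.2]⟩

/-! ### Degenerate lists and normalized chains. -/

open Classical in
variable (k) in
/-- The part of a combination of lists that is supported on strictly decreasing lists. -/
def strictPart : ListMod k →ₗ[k] ListMod k :=
  lin fun l => if l.Pairwise (fun x y => y < x) then of k l else 0

theorem strictPart_of {l : List ℕ} (h : l.Pairwise (fun x y => y < x)) :
    strictPart k (of k l) = of k l := by
  rw [strictPart, lin_of, if_pos h]

theorem strictPart_of_not {l : List ℕ} (h : ¬ l.Pairwise (fun x y => y < x)) :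
    strictPart k (of k l) = 0 := by
  rw [strictPart, lin_of, if_neg h]

theorem strictPart_pre_strictPart (x : ℕ) (y : ListMod k) :
    strictPart k (pre k x (strictPart k y)) = strictPart k (pre k x y) := by
  refine eq_of_forall_of (φ := strictPart k ∘ₗ pre k x ∘ₗ strictPart k)
    (ψ := strictPart k ∘ₗ pre k x) (fun l => ?_) y
  show strictPart k (pre k x (strictPart k (of k l))) = strictPart k (pre k x (of k l))
  by_cases h : l.Pairwise (fun x y => y < x)
  · rw [strictPart_of h]
  · rw [strictPart_of_not h, map_zero, map_zero, pre_of, strictPart_of_not]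
    exact fun h' => h (List.pairwise_cons.1 h').2

theorem strictPart_bd_of {l : List ℕ} (h : l.Pairwise (fun x y => y < x)) :
    strictPart k (bd k (of k l)) = bd k (of k l) :=
  eqOn_supported (strictPart k) LinearMap.id
    (fun _ hl' => strictPart_of (h.sublist hl'.1)) (bd_mem l)

/-- Weakly decreasing lists with a repetition span a subcomplex, which is why the chains can be
normalized. Outside this case nothing changes, since sublists of strict lists are strict. -/
theorem bd_strictPart {l : List ℕ} (h : l.Pairwise (fun x y => y ≤ x)) :
    bd k (strictPart k (of k l)) = strictPart k (bd k (of k l)) := by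
  by_cases hs : l.Pairwise (fun x y => y < x)
  · rw [strictPart_of hs, strictPart_bd_of hs]
  rw [strictPart_of_not hs, map_zero]
  symm
  induction l with
  | nil => exact absurd List.Pairwise.nil hs
  | cons x l ih =>
    have hl := (List.pairwise_cons.1 h).2
    rw [bd_cons, map_sub, ← strictPart_pre_strictPart]
    by_cases hl' : l.Pairwise (fun x y => y < x)
    · rw [strictPart_bd_of hl']
      cases l with
      | nil => exact absurd (by simp) hs
      | cons y l =>
        -- The tail is strict, so the repetition is between its head and `x`. The two faces that
        -- omit one of these entries cancel, and all other faces still contain both.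
        have hxy : x = y := by
          by_contra hne
          apply hs
          rw [List.pairwise_cons]
          refine ⟨fun z hz => ?_, hl'⟩
          have h1 := (List.pairwise_cons.1 h).1 y (by simp)
          rcases List.mem_cons.1 hz with rfl | hz
          · omega
          · have := (List.pairwise_cons.1 hl').1 z hz
            omega
        subst hxy
        have h0 : strictPart k (pre k x (pre k x (bd k (of k l)))) = 0 :=
          eq_of_forall_of (φ := strictPart k ∘ₗ pre k x ∘ₗ pre k x) (ψ := 0) (fun l => by
            rw [LinearMap.comp_apply, LinearMap.comp_apply, pre_of, pre_of, strictPart_of_not]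
            · rfl
            · simp) _
        rw [bd_cons, map_sub, map_sub, h0, pre_of, sub_zero, sub_self]
    · rw [strictPart_of_not hl', ih hl hl', map_zero, map_zero, sub_zero]

/-- Applying a map to the entries of lists. -/
def mapList (f : ℕ → ℕ) : ListMod k →ₗ[k] ListMod k := lin fun l => of k (l.map f)

theorem mapList_of (f : ℕ → ℕ) (l : List ℕ) : mapList f (of k l) = of k (l.map f) := lin_of _ _

theorem mapList_pre (f : ℕ → ℕ) (x : ℕ) (y : ListMod k) :
    mapList f (pre k x y) = pre k (f x) (mapList f y) :=
  eq_of_forall_of (φ := mapList f ∘ₗ pre k x) (ψ := pre k (f x) ∘ₗ mapList f) (fun l => by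
    rw [LinearMap.comp_apply, LinearMap.comp_apply, pre_of, mapList_of, mapList_of, pre_of,
      List.map_cons]) y

theorem bd_mapList (f : ℕ → ℕ) (l : List ℕ) :
    bd k (of k (l.map f)) = mapList f (bd k (of k l)) := by
  induction l with
  | nil => rw [List.map_nil, bd_nil, map_zero]
  | cons x l ih => rw [List.map_cons, bd_cons, bd_cons, map_sub, mapList_of, ih, mapList_pre]

variable (k) in
/-- The effect of a map of numbers on strictly decreasing lists; lists that do not remain strictly
decreasing are sent to zero. -/
def push (f : ℕ → ℕ) : ListMod k →ₗ[k] ListMod k := strictPart k ∘ₗ mapList f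

theorem push_of (f : ℕ → ℕ) (l : List ℕ) : push k f (of k l) = strictPart k (of k (l.map f)) := by
  rw [push, LinearMap.comp_apply, mapList_of]

theorem bd_push {f : ℕ → ℕ} {l : List ℕ} (hf : (l.map f).Pairwise (fun x y => y ≤ x)) :
    bd k (push k f (of k l)) = push k f (bd k (of k l)) := by
  rw [push_of, bd_strictPart hf, bd_mapList]; rfl

/-! Lists with a marked first entry. -/

variable (k) in
/-- Applying a map to lists with a marked first entry. -/
def headTail (φ : ℕ → ListMod k →ₗ[k] ListMod k) : ListMod k →ₗ[k] ListMod k :=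
  lin fun
    | [] => 0
    | x :: l => φ x (of k l)

theorem headTail_pre (φ : ℕ → ListMod k →ₗ[k] ListMod k) (x : ℕ) (y : ListMod k) :
    headTail k φ (pre k x y) = φ x y :=
  eq_of_forall_of (φ := headTail k φ ∘ₗ pre k x) (ψ := φ x) (fun l => by
    rw [LinearMap.comp_apply, pre_of, headTail, lin_of]) y

variable (k) in
/-- The exchange of `0` and `1` in the first entry. -/
def swapHead : ListMod k →ₗ[k] ListMod k := headTail k fun x => pre k (swapNum x)

theorem swapHead_pre (x : ℕ) (y : ListMod k) : swapHead k (pre k x y) = pre k (swapNum x) y :=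
  headTail_pre _ _ _

variable (k) in
/-- The boundary of the tail. -/
def bdTail : ListMod k →ₗ[k] ListMod k := headTail k fun x => pre k x ∘ₗ bd k

theorem bdTail_pre (x : ℕ) (y : ListMod k) : bdTail k (pre k x y) = pre k x (bd k y) :=
  headTail_pre _ _ _

variable (k) in
/-- Moving the first entry to the end. -/
def rotate : ListMod k →ₗ[k] ListMod k := headTail k (app k)

theorem rotate_pre (x : ℕ) (y : ListMod k) : rotate k (pre k x y) = app k x y :=
  headTail_pre _ _ _

variable (k) in
/-- The variant of `push` for lists with a marked first entry. -/
def pushTail (f : ℕ → ℕ) : ListMod k →ₗ[k] ListMod k :=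
  headTail k fun x => pre k (f x) ∘ₗ push k f

theorem pushTail_pre (f : ℕ → ℕ) (x : ℕ) (y : ListMod k) :
    pushTail k f (pre k x y) = pre k (f x) (push k f y) :=
  headTail_pre _ _ _

end ListMod

/-! ### Representations of path algebras -/

namespace PathAlgebra

variable (k : Type*) [CommRing k] {V : Type*} [Quiver V]

section
variable (M : V → Type*) [∀ v, AddCommGroup (M v)] [∀ v, Module k (M v)]
  (arr : ∀ {u v : V}, (u ⟶ v) → (M u →ₗ[k] M v))

/-- The action of a path on a representation. -/
def repPath {u : V} : {v : V} → Quiver.Path u v → (M u →ₗ[k] M v)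
  | _, .nil => LinearMap.id
  | _, .cons p e => arr e ∘ₗ repPath p

theorem repPath_comp {u v w : V} (q : Quiver.Path u v) (p : Quiver.Path v w) :
    repPath k M arr (q.comp p) = repPath k M arr p ∘ₗ repPath k M arr q := by
  induction p with
  | nil => rfl
  | cons p e ih => rw [Quiver.Path.comp_cons, repPath, ih]; rfl

variable [Fintype V]

open Classical in
/-- The action of the path algebra on the sum of the spaces of a representation. -/
def rep : PathAlgebra k V →ₐ[k] Module.End k (∀ v, M v) :=
  lift (fun {u v} p => LinearMap.single k M v ∘ₗ repPath k M arr p ∘ₗ LinearMap.proj u)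
    (fun {u v w} q p => LinearMap.ext fun y => by
      show Pi.single w (repPath k M arr (q.comp p) (y u)) =
        Pi.single w (repPath k M arr p ((Pi.single v (repPath k M arr q (y u)) : ∀ v, M v) v))
      rw [Pi.single_eq_same, repPath_comp]; rfl)
    (fun {u v u' v'} p q h => LinearMap.ext fun y => by
      show Pi.single v (repPath k M arr p
        ((Pi.single v' (repPath k M arr q (y u')) : ∀ v, M v) u)) = 0
      rw [Pi.single_eq_of_ne h.symm, map_zero, Pi.single_zero])
    (LinearMap.ext fun y => by
      rw [LinearMap.sum_apply]
      exact Finset.univ_sum_single y)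

theorem rep_ofPath [inst : DecidableEq V] {u v : V} (p : Quiver.Path u v) (y : ∀ v, M v) :
    rep k M arr (ofPath k p) y = Pi.single v (repPath k M arr p (y u)) := by
  obtain rfl : inst = fun a b => Classical.propDecidable (a = b) := Subsingleton.elim _ _
  rw [rep, lift_ofPath]; rfl

theorem rep_arrow [DecidableEq V] {u v : V} (e : u ⟶ v) (y : ∀ v, M v) :
    rep k M arr (arrow k e) y = Pi.single v (arr e (y u)) := rep_ofPath k M arr _ y

theorem rep_vertex [DecidableEq V] (u : V) (y : ∀ v, M v) :
    rep k M arr (vertex k u) y = Pi.single u (y u) := rep_ofPath k M arr _ y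

theorem rep_vertex_mul (u : V) (x : PathAlgebra k V) (y : ∀ v, M v) :
    rep k M arr (vertex k u * x) y u = rep k M arr x y u := by
  classical
  rw [map_mul, Module.End.mul_apply, rep_vertex, Pi.single_eq_same]

end

variable {k} [Fintype V]

theorem vertex_mul_arrow {u v : V} (e : u ⟶ v) : vertex k v * arrow k e = arrow k e :=
  ofPath_mul_ofPath _ _

theorem arrow_mul_vertex {u v : V} (e : u ⟶ v) : arrow k e * vertex k u = arrow k e :=
  (ofPath_mul_ofPath _ _).trans (by rw [Quiver.Path.nil_comp]; rfl)

theorem vertex_mul_arrow_of_ne {u v w : V} (e : u ⟶ v) (h : w ≠ v) :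
    vertex k w * arrow k e = 0 :=
  ofPath_mul_ofPath_of_ne _ _ h.symm

theorem arrow_mul_vertex_of_ne {u v w : V} (e : u ⟶ v) (h : w ≠ u) :
    arrow k e * vertex k w = 0 :=
  ofPath_mul_ofPath_of_ne _ _ h

theorem vertex_mul_self (u : V) : vertex k u * vertex k u = vertex k u := ofPath_mul_ofPath _ _

theorem vertex_mul_vertex_of_ne {u v : V} (h : v ≠ u) : vertex k u * vertex k v = 0 :=
  ofPath_mul_ofPath_of_ne _ _ h

theorem ofPath_cons {u v w : V} (p : Quiver.Path u v) (e : v ⟶ w) :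
    ofPath k (p.cons e) = arrow k e * ofPath k p :=
  (ofPath_mul_ofPath p e.toPath).symm

end PathAlgebra

section
variable {R : Type*} [Ring R] {P : ℕ → Prop} [DecidablePred P] (x : ∀ m, P m → R) (e : R) (N : ℕ)

/-- These four lemmas compute the components of a letter, which is a sum over all arrows of that
name: multiplication by the idempotent of a vertex leaves at most one term. -/
theorem mul_sum_dite_eq_single {m₀ : ℕ} (h₀ : P m₀) (hN : m₀ < N)
    (hne : ∀ m h, m ≠ m₀ → e * x m h = 0) :
    e * (∑ m ∈ Finset.range N, if h : P m then x m h else 0) = e * x m₀ h₀ := by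
  rw [Finset.mul_sum, Finset.sum_eq_single m₀, dif_pos h₀]
  · intro m _ hm
    split_ifs with h
    · exact hne m h hm
    · exact mul_zero e
  · exact fun h => absurd (Finset.mem_range.2 hN) h

theorem mul_sum_dite_eq_zero (hne : ∀ m h, e * x m h = 0) :
    e * (∑ m ∈ Finset.range N, if h : P m then x m h else 0) = 0 := by
  rw [Finset.mul_sum]
  refine Finset.sum_eq_zero fun m _ => ?_
  split_ifs with h
  · exact hne m h
  · exact mul_zero e

theorem sum_dite_mul_eq_single {m₀ : ℕ} (h₀ : P m₀) (hN : m₀ < N)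
    (hne : ∀ m h, m ≠ m₀ → x m h * e = 0) :
    (∑ m ∈ Finset.range N, if h : P m then x m h else 0) * e = x m₀ h₀ * e := by
  rw [Finset.sum_mul, Finset.sum_eq_single m₀, dif_pos h₀]
  · intro m _ hm
    split_ifs with h
    · exact hne m h hm
    · exact zero_mul e
  · exact fun h => absurd (Finset.mem_range.2 hN) h

theorem sum_dite_mul_eq_zero (hne : ∀ m h, x m h * e = 0) :
    (∑ m ∈ Finset.range N, if h : P m then x m h else 0) * e = 0 := by
  rw [Finset.sum_mul]
  refine Finset.sum_eq_zero fun m _ => ?_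
  split_ifs with h
  · exact hne m h
  · exact zero_mul e

end

/-! ### The components of the letters `t`, `d`, `c`, `a` -/

instance (n r : ℕ) : DecidableEq (Ladder n r) := inferInstanceAs (DecidableEq (Node n r))

namespace Ladder

open PathAlgebra

variable (k : Type*) [CommRing k] {n r : ℕ}

/-- The idempotent at a vertex of the two-row quiver. -/
abbrev vert (u : Node n r) : PathAlgebra k (Ladder n r) := vertex k (V := Ladder n r) u

variable {k}

theorem vert_mul_elt {u v : Node n r} (e : LadderArrow n r u v) :
    vert k v * elt k n r e = elt k n r e :=
  vertex_mul_arrow (V := Ladder n r) (u := u) (v := v) e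

theorem vert_mul_elt_of_ne {u v w : Node n r} (e : LadderArrow n r u v) (h : w ≠ v) :
    vert k w * elt k n r e = 0 :=
  vertex_mul_arrow_of_ne (V := Ladder n r) (u := u) (v := v) e h

theorem elt_mul_vert {u v : Node n r} (e : LadderArrow n r u v) :
    elt k n r e * vert k u = elt k n r e :=
  arrow_mul_vertex (V := Ladder n r) (u := u) (v := v) e

theorem elt_mul_vert_of_ne {u v w : Node n r} (e : LadderArrow n r u v) (h : w ≠ u) :
    elt k n r e * vert k w = 0 :=
  arrow_mul_vertex_of_ne (V := Ladder n r) (u := u) (v := v) e h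

theorem vert_mul_vert (u : Node n r) : vert k u * vert k u = vert k u :=
  vertex_mul_self (V := Ladder n r) u

theorem vert_mul_vert_of_ne {u v : Node n r} (h : v ≠ u) : vert k u * vert k v = 0 :=
  vertex_mul_vertex_of_ne (V := Ladder n r) h

variable (m : ℕ)

theorem vert_D_mul_t (h) : vert k (.D m h) * t k n r = elt k n r (.t m h) :=
  (mul_sum_dite_eq_single (fun m h => elt k n r (.t m h)) _ _ h (by omega)
    fun _ _ hm => vert_mul_elt_of_ne _ (by simpa using hm.symm)).trans (vert_mul_elt _)

theorem vert_A_mul_t (h) : vert k (.A m h) * t k n r = 0 :=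
  mul_sum_dite_eq_zero _ _ _ fun _ _ => vert_mul_elt_of_ne _ (by simp)

theorem vert_D_mul_d (h) (h') : vert k (.D m h) * d k n r = elt k n r (.d m h h') :=
  (mul_sum_dite_eq_single
    (P := fun m => (3 ≤ m ∧ m ≤ n + 1) ∧ (3 ≤ m + 1 ∧ m + 1 ≤ n + 1))
    (fun m h => elt k n r (.d m h.1 h.2)) _ _ ⟨h, h'⟩ (by omega)
    fun _ _ hm => vert_mul_elt_of_ne _ (by simpa using hm.symm)).trans (vert_mul_elt _)

theorem vert_D_mul_d_of_lt (h) (h' : n + 1 < m + 1) : vert k (.D m h) * d k n r = 0 :=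
  mul_sum_dite_eq_zero _ _ _ fun _ _ => vert_mul_elt_of_ne _ (by
    rw [Ne, Node.D.injEq]; omega)

theorem vert_A_mul_d (h) : vert k (.A m h) * d k n r = 0 :=
  mul_sum_dite_eq_zero _ _ _ fun _ _ => vert_mul_elt_of_ne _ (by simp)

theorem vert_A_mul_c (h) (h') : vert k (.A m h) * c k n r = elt k n r (.c m h h') :=
  (mul_sum_dite_eq_single
    (P := fun m => (r ≤ m ∧ m ≤ n) ∧ (3 ≤ m + 1 ∧ m + 1 ≤ n + 1))
    (fun m h => elt k n r (.c m h.1 h.2)) _ _ ⟨h, h'⟩ (by omega)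
    fun _ _ hm => vert_mul_elt_of_ne _ (by simpa using hm.symm)).trans (vert_mul_elt _)

theorem vert_A_mul_c_of_lt (h) (h' : m + 1 < 3) : vert k (.A m h) * c k n r = 0 :=
  mul_sum_dite_eq_zero _ _ _ fun _ _ => vert_mul_elt_of_ne _ (by
    rw [Ne, Node.A.injEq]; omega)

theorem vert_D_mul_c (h) : vert k (.D m h) * c k n r = 0 :=
  mul_sum_dite_eq_zero _ _ _ fun _ _ => vert_mul_elt_of_ne _ (by simp)

theorem vert_A_mul_a (h) (h') : vert k (.A m h) * a k n r = elt k n r (.a m h h') :=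
  (mul_sum_dite_eq_single
    (P := fun m => (r ≤ m ∧ m ≤ n) ∧ (r ≤ m + 1 ∧ m + 1 ≤ n))
    (fun m h => elt k n r (.a m h.1 h.2)) _ _ ⟨h, h'⟩ (by omega)
    fun _ _ hm => vert_mul_elt_of_ne _ (by simpa using hm.symm)).trans (vert_mul_elt _)

theorem vert_A_mul_a_of_lt (h) (h' : n < m + 1) : vert k (.A m h) * a k n r = 0 :=
  mul_sum_dite_eq_zero _ _ _ fun _ _ => vert_mul_elt_of_ne _ (by
    rw [Ne, Node.A.injEq]; omega)

theorem vert_D_mul_a (h) : vert k (.D m h) * a k n r = 0 :=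
  mul_sum_dite_eq_zero _ _ _ fun _ _ => vert_mul_elt_of_ne _ (by simp)

theorem vert_D_mul_eTop (h) : vert k (.D m h) * eTop k n r = vert k (.D m h) :=
  (mul_sum_dite_eq_single (fun m h => vert k (.D m h)) _ _ h (by omega)
    fun _ _ hm => vert_mul_vert_of_ne (by simpa using hm)).trans (vert_mul_vert _)

theorem vert_A_mul_eTop (h) : vert k (.A m h) * eTop k n r = 0 :=
  mul_sum_dite_eq_zero _ _ _ fun _ _ => vert_mul_vert_of_ne (by simp)

theorem eTop_mul_vert_D (h) : eTop k n r * vert k (.D m h) = vert k (.D m h) :=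
  (sum_dite_mul_eq_single (fun m h => vert k (.D m h)) _ _ h (by omega)
    fun _ _ hm => vert_mul_vert_of_ne (by simpa using hm.symm)).trans (vert_mul_vert _)

theorem d_mul_vert_D_three (h) : d k n r * vert k (.D 3 h) = 0 :=
  sum_dite_mul_eq_zero _ _ _ fun _ _ => elt_mul_vert_of_ne _ (by
    rw [Ne, Node.D.injEq]; omega)

theorem a_mul_vert_A (h) : a k n r * vert k (.A r h) = 0 :=
  sum_dite_mul_eq_zero _ _ _ fun _ _ => elt_mul_vert_of_ne _ (by
    rw [Ne, Node.A.injEq]; omega)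

theorem eTop_mul_d : eTop k n r * d k n r = d k n r := by
  unfold d
  rw [Finset.mul_sum]
  refine Finset.sum_congr rfl fun m _ => ?_
  split_ifs with h
  · rw [← vert_mul_elt, ← mul_assoc, eTop_mul_vert_D]
  · exact mul_zero _

theorem d_mul_eTop : d k n r * eTop k n r = d k n r := by
  unfold d
  rw [Finset.sum_mul]
  refine Finset.sum_congr rfl fun m _ => ?_
  split_ifs with h
  · rw [← elt_mul_vert, mul_assoc, vert_D_mul_eTop]
  · exact zero_mul _

end Ladder

/-! ### The representations of the two-row quiver on chains -/

section
variable {n r : ℕ}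

/-- The number of sources that are exchanged by `t`. -/
def Shape.base : Shape → ℕ
  | .A => 0
  | .D => 2

/-- The chains that do not contain the last vertex or one of the sources exchanged by `t`. -/
def innerChains (v : Node n r) : Set (List ℕ) :=
  {l | l.Pairwise (fun x y => y < x) ∧ ∀ x ∈ l, v.shape.base ≤ x ∧ x < v.last}

/-- The chains of the poset of vertices of `v` without the last one that span the component at `w`
of the representation attached to `v`. For `w` in the bottom row these are all chains with a given
number of elements. For `w` in the top row these are the chains that contain a source, which is put
in front. -/
def chains : Node n r → Node n r → Set (List ℕ)
  | .A m _, v => {l | l.Pairwise (fun x y => y < x ∧ v.shape.Reach y x) ∧ l.length + 1 = m ∧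
      ∀ x ∈ l, x < v.last}
  | .D m _, v => {l | v.shape = .D ∧ ∃ e s, l = e :: s ∧ e ≤ 1 ∧ s ∈ innerChains v ∧
      s.length + 3 = m}

theorem innerChains_sublist {v : Node n r} {l l' : List ℕ} (h : l ∈ innerChains v)
    (hl : l'.Sublist l) : l' ∈ innerChains v :=
  ⟨h.1.sublist hl, fun x hx => h.2 x (hl.subset hx)⟩

theorem two_le_last {v : Node n r} (h : v.shape = .D) : 2 ≤ v.last := by
  cases v with
  | D m hm => show 2 ≤ m - 1; omega
  | A m hm => cases h

theorem append_mem_chains {v : Node n r} (hv : v.shape = .D) {s : List ℕ} (hs : s ∈ innerChains v)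
    {e : ℕ} (he : e ≤ 1) {m : ℕ} (hm : s.length + 2 = m) (h) :
    s ++ [e] ∈ chains (n := n) (r := r) (.A m h) v := by
  have hb : v.shape.base = 2 := by rw [hv]; rfl
  refine ⟨?_, by simp; omega, ?_⟩
  · rw [List.pairwise_append]
    refine ⟨?_, by simp, ?_⟩
    · refine hs.1.imp_of_mem fun {x y} hx hy hxy => ⟨hxy, ?_⟩
      have := hs.2 x hx
      rw [hv]; exact Or.inr ⟨hxy, by omega⟩
    · intro x hx y hy
      have := hs.2 x hx
      obtain rfl : y = e := by simpa using hy
      rw [hv]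
      exact ⟨by omega, Or.inr ⟨by omega, by omega⟩⟩
  · intro x hx
    rcases List.mem_append.1 hx with hx | hx
    · exact (hs.2 x hx).2
    · have := two_le_last hv
      obtain rfl : x = e := by simpa using hx
      omega

theorem innerChains_mem_chains {v : Node n r} {s : List ℕ} (hs : s ∈ innerChains v) {m : ℕ}
    (hm : s.length + 1 = m) (h) : s ∈ chains (n := n) (r := r) (.A m h) v := by
  refine ⟨hs.1.imp_of_mem fun {x y} hx hy hxy => ⟨hxy, ?_⟩, hm, fun x hx => (hs.2 x hx).2⟩
  have := hs.2 x hx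
  cases hv : v.shape with
  | A => exact hxy.le
  | D =>
    rw [hv] at this
    exact Or.inr ⟨hxy, this.1⟩

/-- A chain of a quiver of type `D` contains at most one source, at the end. -/
theorem mem_chains_A_cases {v : Node n r} (hv : v.shape = .D) {l : List ℕ} {m : ℕ} {h}
    (hl : l ∈ chains (n := n) (r := r) (.A m h) v) :
    l ∈ innerChains v ∨ ∃ s ∈ innerChains v, ∃ e ≤ 1, l = s ++ [e] := by
  obtain ⟨h1, -, h3⟩ := hl
  clear h
  have hb : v.shape.base = 2 := by rw [hv]; rfl
  induction l with
  | nil => exact Or.inl ⟨List.Pairwise.nil, by simp⟩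
  | cons x l ih =>
    rw [List.pairwise_cons] at h1
    have hx := h3 x (by simp)
    rcases ih h1.2 (fun y hy => h3 y (by simp [hy])) with hl | ⟨s, hs, e, he, rfl⟩
    · by_cases hx2 : x ≤ 1
      · refine Or.inr ⟨[], ⟨List.Pairwise.nil, by simp⟩, x, hx2, ?_⟩
        cases l with
        | nil => rfl
        | cons y l =>
          have := hl.2 y (by simp)
          have := (h1.1 y (by simp)).1
          omega
      · refine Or.inl ⟨List.pairwise_cons.2 ⟨fun y hy => (h1.1 y hy).1, hl.1⟩, ?_⟩
        intro y hy
        rcases List.mem_cons.1 hy with rfl | hy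
        · omega
        · exact hl.2 y hy
    · refine Or.inr ⟨x :: s, ⟨List.pairwise_cons.2 ⟨fun y hy => (h1.1 y (by simp [hy])).1, hs.1⟩,
        fun y hy => ?_⟩, e, he, rfl⟩
      rcases List.mem_cons.1 hy with rfl | hy
      · have := (h1.1 e (by simp)).2
        have h4 := (h1.1 e (by simp)).1
        rw [hv] at this
        simp only [Shape.Reach] at this
        omega
      · exact hs.2 y hy

theorem mem_innerChains_of_A {v : Node n r} (hv : v.shape = .A) {l : List ℕ} {m : ℕ} {h}
    (hl : l ∈ chains (n := n) (r := r) (.A m h) v) : l ∈ innerChains v :=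
  ⟨hl.1.imp fun h => h.1, fun x hx => ⟨by rw [hv]; exact Nat.zero_le _, hl.2.2 x hx⟩⟩

variable (k : Type*) [CommRing k]

/-- The span of the chains. -/
abbrev chainMod (w v : Node n r) : Submodule k (ListMod k) := Finsupp.supported k k (chains w v)

/-- The representation of the two-row quiver attached to `v`. -/
def ChainRep (v : Node n r) := ∀ w : Node n r, chainMod k w v

instance (v : Node n r) : AddCommGroup (ChainRep k v) :=
  inferInstanceAs (AddCommGroup (∀ w : Node n r, chainMod k w v))

instance (v : Node n r) : Module k (ChainRep k v) :=
  inferInstanceAs (Module k (∀ w : Node n r, chainMod k w v))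

/-- The inclusion of a component. -/
def chainSingle {v : Node n r} (w : Node n r) : chainMod k w v →ₗ[k] ChainRep k v :=
  LinearMap.single k (fun w : Node n r => chainMod k w v) w

open ListMod

/-- The action of the arrows of the two-row quiver on lists. -/
def arrowOp : {w w' : Node n r} → LadderArrow n r w w' → (ListMod k →ₗ[k] ListMod k)
  | _, _, .t _ _ => swapHead k
  | _, _, .d _ _ _ => bdTail k
  | _, _, .c _ _ _ => rotate k
  | _, _, .a _ _ _ => bd k

variable {k}

theorem chainSingle_same {v : Node n r} (w : Node n r) (z : chainMod k w v) :
    chainSingle k w z w = z := Pi.single_eq_same _ _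

theorem chainSingle_of_ne {v w w' : Node n r} (h : w' ≠ w) (z : chainMod k w v) :
    chainSingle k w z w' = 0 := Pi.single_eq_of_ne h _

theorem sum_chainSingle {v : Node n r} (y : ChainRep k v) : ∑ w, chainSingle k w (y w) = y :=
  Finset.univ_sum_single y

theorem arrowOp_mem {w w' : Node n r} (e : LadderArrow n r w w') (v : Node n r) (x : ListMod k)
    (hx : x ∈ chainMod k w v) : arrowOp k e x ∈ chainMod k w' v := by
  refine map_mem _ (fun l hl => ?_) hx
  cases e with
  | t m h =>
    obtain ⟨hv, e, s, rfl, he, hs, hm⟩ := hl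
    rw [arrowOp, ← pre_of, swapHead_pre, pre_of]
    refine of_mem ⟨hv, _, s, rfl, ?_, hs, hm⟩
    unfold swapNum; split_ifs <;> omega
  | d m h h' =>
    obtain ⟨hv, e, s, rfl, he, hs, hm⟩ := hl
    rw [arrowOp, ← pre_of, bdTail_pre]
    refine map_mem _ (fun l hl => ?_) (bd_mem s)
    rw [pre_of]
    refine of_mem ⟨hv, e, l, rfl, he, innerChains_sublist hs hl.1, ?_⟩
    have := hl.2
    omega
  | c m h h' =>
    obtain ⟨hv, e, s, rfl, he, hs, hm⟩ := hl
    rw [arrowOp, ← pre_of, rotate_pre, app_of]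
    exact of_mem (append_mem_chains hv hs he (by omega) h)
  | a m h h' =>
    obtain ⟨h1, h2, h3⟩ := hl
    refine Finsupp.supported_mono ?_ (bd_mem l)
    rintro l' ⟨h4, h5⟩
    exact ⟨h1.sublist h4, by omega, fun x hx => h3 x (h4.subset hx)⟩

variable (k) in
/-- The action of the arrows of the two-row quiver on chains. -/
def chainArrow (v : Node n r) {w w' : Node n r} (e : LadderArrow n r w w') :
    chainMod k w v →ₗ[k] chainMod k w' v :=
  (arrowOp k e).restrict (arrowOp_mem e v)

variable (k) in
/-- The action of the path algebra of the two-row quiver on chains. -/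
def chainAction (v : Node n r) : PathAlgebra k (Ladder n r) →ₐ[k] Module.End k (ChainRep k v) :=
  PathAlgebra.rep k (V := Ladder n r) (fun w : Node n r => chainMod k w v)
    (fun {_ _} e => chainArrow k v e)

open Ladder PathAlgebra

variable (v : Node n r) (y : ChainRep k v)

theorem chainAction_vert_mul (w : Node n r) (x : PathAlgebra k (Ladder n r)) :
    chainAction k v (vert k w * x) y w = chainAction k v x y w :=
  rep_vertex_mul k (V := Ladder n r) _ _ w x y

theorem chainAction_elt {w w' : Node n r} (e : LadderArrow n r w w') :
    chainAction k v (elt k n r e) y = chainSingle k w' (chainArrow k v e (y w)) := by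
  have := rep_arrow k (V := Ladder n r) (fun w : Node n r => chainMod k w v)
    (fun {_ _} e => chainArrow k v e) (u := w) (v := w') e y
  exact this

theorem chainAction_vert (w : Node n r) :
    chainAction k v (vert k w) y = chainSingle k w (y w) := by
  have := rep_vertex k (V := Ladder n r) (fun w : Node n r => chainMod k w v)
    (fun {_ _} e => chainArrow k v e) w y
  exact this

theorem chainAction_of_vert_mul_elt {w w' : Node n r} {x : PathAlgebra k (Ladder n r)}
    {e : LadderArrow n r w w'} (h : vert k w' * x = elt k n r e) :
    (chainAction k v x y w' : ListMod k) = arrowOp k e (y w) := by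
  rw [← chainAction_vert_mul, h, chainAction_elt, chainSingle_same]; rfl

theorem chainAction_of_vert_mul_eq_zero {w : Node n r} {x : PathAlgebra k (Ladder n r)}
    (h : vert k w * x = 0) : (chainAction k v x y w : ListMod k) = 0 := by
  rw [← chainAction_vert_mul, h, map_zero]; rfl

theorem chainAction_mul_apply (x x' : PathAlgebra k (Ladder n r)) :
    chainAction k v (x * x') y = chainAction k v x (chainAction k v x' y) := by
  rw [map_mul]; rfl

/-- Operators on a component of the top row need to be compared only on a source followed by an
inner chain, where the actions of `t`, `d` and `c` are explicit. -/
theorem eq_pre_of_mem_chains_D {m : ℕ} {h} {φ ψ : ListMod k →ₗ[k] ListMod k}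
    (hφ : ∀ e ≤ 1, ∀ s ∈ innerChains v, v.shape = .D → s.length + 3 = m →
      φ (pre k e (of k s)) = ψ (pre k e (of k s)))
    {x : ListMod k} (hx : x ∈ chainMod k (.D m h) v) : φ x = ψ x := by
  refine eqOn_supported _ _ (fun l hl => ?_) hx
  obtain ⟨hv, e, s, rfl, he, hs, hm⟩ := hl
  rw [← pre_of]
  exact hφ e he s hs hv hm

theorem chainAction_tt :
    chainAction k v (t k n r * t k n r) y = chainAction k v (eTop k n r) y := by
  funext w
  refine Subtype.ext ?_
  cases w with
  | D m h =>
    rw [chainAction_mul_apply, chainAction_of_vert_mul_elt v _ (vert_D_mul_t m h),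
      chainAction_of_vert_mul_elt v _ (vert_D_mul_t m h), ← chainAction_vert_mul v y,
      vert_D_mul_eTop, chainAction_vert, chainSingle_same]
    refine eq_pre_of_mem_chains_D v (φ := swapHead k ∘ₗ swapHead k) (ψ := LinearMap.id)
      (fun e he s hs _ _ => ?_) (y (.D m h)).2
    rw [LinearMap.comp_apply, swapHead_pre, swapHead_pre, swapNum_swapNum]; rfl
  | A m h =>
    rw [chainAction_mul_apply, chainAction_of_vert_mul_eq_zero v _ (vert_A_mul_t m h),
      chainAction_of_vert_mul_eq_zero v _ (vert_A_mul_eTop m h)]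

theorem chainAction_tdt :
    chainAction k v (t k n r * d k n r * t k n r) y = chainAction k v (d k n r) y := by
  funext w
  refine Subtype.ext ?_
  cases w with
  | D m h =>
    rw [mul_assoc, chainAction_mul_apply, chainAction_of_vert_mul_elt v _ (vert_D_mul_t m h),
      chainAction_mul_apply]
    by_cases h' : m + 1 ≤ n + 1
    · rw [chainAction_of_vert_mul_elt v _ (vert_D_mul_d m h ⟨by omega, h'⟩),
        chainAction_of_vert_mul_elt v _ (vert_D_mul_d m h ⟨by omega, h'⟩),
        chainAction_of_vert_mul_elt v _ (vert_D_mul_t (m + 1) _)]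
      refine eq_pre_of_mem_chains_D v (φ := swapHead k ∘ₗ bdTail k ∘ₗ swapHead k) (ψ := bdTail k)
        (fun e he s hs _ _ => ?_) (y _).2
      simp only [LinearMap.comp_apply, swapHead_pre, bdTail_pre, swapNum_swapNum]
    · rw [chainAction_of_vert_mul_eq_zero v _ (vert_D_mul_d_of_lt m h (by omega)),
        chainAction_of_vert_mul_eq_zero v _ (vert_D_mul_d_of_lt m h (by omega)), map_zero]
  | A m h =>
    rw [mul_assoc, chainAction_mul_apply, chainAction_of_vert_mul_eq_zero v _ (vert_A_mul_t m h),
      chainAction_of_vert_mul_eq_zero v _ (vert_A_mul_d m h)]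

theorem chainAction_dd : chainAction k v (d k n r * d k n r) y = 0 := by
  funext w
  refine Subtype.ext ?_
  rw [chainAction_mul_apply]
  cases w with
  | D m h =>
    by_cases h' : m + 1 ≤ n + 1
    · rw [chainAction_of_vert_mul_elt v _ (vert_D_mul_d m h ⟨by omega, h'⟩)]
      by_cases h'' : m + 1 + 1 ≤ n + 1
      · rw [chainAction_of_vert_mul_elt v _ (vert_D_mul_d (m + 1) ⟨by omega, h'⟩ ⟨by omega, h''⟩)]
        refine eq_pre_of_mem_chains_D v (φ := bdTail k ∘ₗ bdTail k) (ψ := 0)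
          (fun e he s hs _ _ => ?_) (y _).2
        simp only [LinearMap.comp_apply, bdTail_pre, bd_bd, map_zero, LinearMap.zero_apply]
      · rw [chainAction_of_vert_mul_eq_zero v _ (vert_D_mul_d_of_lt (m + 1) _ (by omega)), map_zero]
        rfl
    · exact chainAction_of_vert_mul_eq_zero v _ (vert_D_mul_d_of_lt m h (by omega))
  | A m h => exact chainAction_of_vert_mul_eq_zero v _ (vert_A_mul_d m h)

theorem chainAction_aa : chainAction k v (a k n r * a k n r) y = 0 := by
  funext w
  refine Subtype.ext ?_
  rw [chainAction_mul_apply]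
  cases w with
  | D m h => exact chainAction_of_vert_mul_eq_zero v _ (vert_D_mul_a m h)
  | A m h =>
    by_cases h' : m + 1 ≤ n
    · have h1 : r ≤ m + 1 ∧ m + 1 ≤ n := ⟨by omega, h'⟩
      rw [chainAction_of_vert_mul_elt v _ (vert_A_mul_a m h h1)]
      by_cases h'' : m + 1 + 1 ≤ n
      · rw [chainAction_of_vert_mul_elt v _ (vert_A_mul_a (m + 1) h1 ⟨by omega, h''⟩)]
        exact bd_bd _
      · rw [chainAction_of_vert_mul_eq_zero v _ (vert_A_mul_a_of_lt (m + 1) h1 (by omega)), map_zero]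
        rfl
    · exact chainAction_of_vert_mul_eq_zero v _ (vert_A_mul_a_of_lt m h (by omega))

theorem chainAction_sub (x x' : PathAlgebra k (Ladder n r)) (w : Node n r) :
    (chainAction k v (x - x') y w : ListMod k) =
      (chainAction k v x y w : ListMod k) - (chainAction k v x' y w : ListMod k) := by
  rw [map_sub]; rfl

theorem chainAction_c_sub_ct_D {m : ℕ} (h) :
    (chainAction k v (c k n r - c k n r * t k n r) y (.D m h) : ListMod k) = 0 := by
  rw [chainAction_sub, chainAction_mul_apply,
    chainAction_of_vert_mul_eq_zero v _ (vert_D_mul_c m h),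
    chainAction_of_vert_mul_eq_zero v _ (vert_D_mul_c m h), sub_zero]

theorem chainAction_c_sub_ct_A {m : ℕ} (h) (h') :
    (chainAction k v (c k n r - c k n r * t k n r) y (.A m h) : ListMod k) =
      rotate k (y (.D (m + 1) h')) - rotate k (swapHead k (y (.D (m + 1) h'))) := by
  rw [chainAction_sub, chainAction_mul_apply,
    chainAction_of_vert_mul_elt v _ (vert_A_mul_c m h h'),
    chainAction_of_vert_mul_elt v _ (vert_A_mul_c m h h'),
    chainAction_of_vert_mul_elt v _ (vert_D_mul_t (m + 1) h')]
  rfl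

theorem chainAction_c_sub_ct_A_of_lt {m : ℕ} (h) (h' : m + 1 < 3) :
    (chainAction k v (c k n r - c k n r * t k n r) y (.A m h) : ListMod k) = 0 := by
  rw [chainAction_sub, chainAction_mul_apply,
    chainAction_of_vert_mul_eq_zero v _ (vert_A_mul_c_of_lt m h h'),
    chainAction_of_vert_mul_eq_zero v _ (vert_A_mul_c_of_lt m h h'), sub_zero]

/-- By `bd_app`, the boundary of `s ++ [e]` is the boundary of `s` with `e` appended, plus a signed
copy of `s`. That copy does not depend on `e` and cancels in `c - ct`. The case distinctions deal
with the ends of the rows. -/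
theorem chainAction_square :
    chainAction k v ((c k n r - c k n r * t k n r) * d k n r) y =
      chainAction k v (a k n r * (c k n r - c k n r * t k n r)) y := by
  funext w
  refine Subtype.ext ?_
  rw [chainAction_mul_apply, chainAction_mul_apply]
  cases w with
  | D m h =>
    rw [chainAction_c_sub_ct_D, chainAction_of_vert_mul_eq_zero v _ (vert_D_mul_a m h)]
  | A m h =>
    by_cases h' : m + 1 ≤ n
    · have h1 : r ≤ m + 1 ∧ m + 1 ≤ n := ⟨by omega, h'⟩
      rw [chainAction_of_vert_mul_elt v _ (vert_A_mul_a m h h1)]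
      by_cases hm : m + 1 < 3
      · rw [chainAction_c_sub_ct_A_of_lt v _ h hm]
        show _ = bd k _
        by_cases hm' : m + 1 + 1 < 3
        · rw [chainAction_c_sub_ct_A_of_lt v _ h1 hm', map_zero]
        · rw [chainAction_c_sub_ct_A v y h1 ⟨by omega, by omega⟩]
          symm
          refine eq_pre_of_mem_chains_D v (φ := bd k ∘ₗ (rotate k - rotate k ∘ₗ swapHead k))
            (ψ := 0) (fun e he s hs _ hsl => ?_) (y _).2
          -- This is the component from `D_3` to `A_1`, where the path through `d` is missing. Both
          -- one-element chains have the empty chain as boundary, so the difference vanishes.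
          obtain rfl : s = [] := List.length_eq_zero_iff.1 (by omega)
          simp [rotate_pre, swapHead_pre, app_of, bd_cons, bd_nil, LinearMap.sub_apply]
      · have h2 : 3 ≤ m + 1 + 1 ∧ m + 1 + 1 ≤ n + 1 := ⟨by omega, by omega⟩
        have h3 : 3 ≤ m + 1 ∧ m + 1 ≤ n + 1 := ⟨by omega, by omega⟩
        rw [chainAction_c_sub_ct_A v _ h h3, chainAction_of_vert_mul_elt v _ (vert_D_mul_d _ h3 h2)]
        show _ = bd k _
        rw [chainAction_c_sub_ct_A v y h1 h2]
        refine eq_pre_of_mem_chains_D v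
          (φ := rotate k ∘ₗ bdTail k - rotate k ∘ₗ swapHead k ∘ₗ bdTail k)
          (ψ := bd k ∘ₗ (rotate k - rotate k ∘ₗ swapHead k)) (fun e he s hs _ hsl => ?_) (y _).2
        simp only [LinearMap.comp_apply, LinearMap.sub_apply, bdTail_pre, swapHead_pre, rotate_pre,
          map_sub, app_of, bd_app]
        abel
    · rw [chainAction_of_vert_mul_eq_zero v _ (vert_A_mul_a_of_lt m h (by omega))]
      by_cases hm : m + 1 < 3
      · exact chainAction_c_sub_ct_A_of_lt v _ h hm
      · have h3 : 3 ≤ m + 1 ∧ m + 1 ≤ n + 1 := ⟨by omega, by omega⟩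
        rw [chainAction_c_sub_ct_A v _ h h3,
          chainAction_of_vert_mul_eq_zero v _ (vert_D_mul_d_of_lt _ h3 (by omega))]
        simp

variable (k) in
/-- The action of the algebra of the two-row quiver on chains. -/
def ladderAction : LadderAlgebra k n r →ₐ[k] Module.End k (ChainRep k v) :=
  RingQuot.liftAlgHom k ⟨chainAction k v, fun _ _ h => by
    refine LinearMap.ext fun y => ?_
    cases h with
    | tt => exact chainAction_tt v y
    | tdt => exact chainAction_tdt v y
    | square => exact chainAction_square v y
    | dd => rw [chainAction_dd, map_zero]; rfl
    | aa => rw [chainAction_aa, map_zero]; rfl⟩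

instance : Module (LadderAlgebra k n r) (ChainRep k v) :=
  Module.compHom _ (ladderAction k v).toRingHom

variable (k n r) in
/-- The quotient map. -/
abbrev ladderMk : PathAlgebra k (Ladder n r) →ₐ[k] LadderAlgebra k n r := RingQuot.mkAlgHom k _

theorem ladderMk_smul (x : PathAlgebra k (Ladder n r)) :
    ladderMk n r k x • y = chainAction k v x y := by
  show ladderAction k v (ladderMk n r k x) y = _
  rw [ladderAction, RingQuot.liftAlgHom_mkAlgHom_apply]

instance : IsScalarTower k (LadderAlgebra k n r) (ChainRep k v) where
  smul_assoc c x y := by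
    show ladderAction k v (c • x) y = c • ladderAction k v x y
    rw [map_smul]; rfl

end

/-! ### Homomorphisms out of the representations on chains -/

namespace Ladder

variable {k : Type*} [CommRing k] {n r : ℕ}

theorem ladderMk_tt : ladderMk n r k (t k n r) * ladderMk n r k (t k n r) =
    ladderMk n r k (eTop k n r) := by
  rw [← map_mul]; exact RingQuot.mkAlgHom_rel k Rel.tt

theorem ladderMk_dd : ladderMk n r k (d k n r) * ladderMk n r k (d k n r) = 0 := by
  rw [← map_mul, ← map_zero (ladderMk n r k)]; exact RingQuot.mkAlgHom_rel k Rel.dd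

theorem ladderMk_aa : ladderMk n r k (a k n r) * ladderMk n r k (a k n r) = 0 := by
  rw [← map_mul, ← map_zero (ladderMk n r k)]; exact RingQuot.mkAlgHom_rel k Rel.aa

/-- Multiplying `tdt = d` on the right by `t` suffices, because `t² = e_*` acts as the identity on
the right of `d`. -/
theorem ladderMk_td : ladderMk n r k (t k n r) * ladderMk n r k (d k n r) =
    ladderMk n r k (d k n r) * ladderMk n r k (t k n r) := by
  have h : ladderMk n r k (t k n r) * ladderMk n r k (d k n r) * ladderMk n r k (t k n r) =
      ladderMk n r k (d k n r) := by
    rw [← map_mul, ← map_mul]; exact RingQuot.mkAlgHom_rel k Rel.tdt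
  nth_rw 1 [← d_mul_eTop]
  rw [map_mul, ← ladderMk_tt, ← mul_assoc, ← mul_assoc, h]

theorem ladderMk_square :
    (ladderMk n r k (c k n r) - ladderMk n r k (c k n r) * ladderMk n r k (t k n r)) *
      ladderMk n r k (d k n r) =
    ladderMk n r k (a k n r) *
      (ladderMk n r k (c k n r) - ladderMk n r k (c k n r) * ladderMk n r k (t k n r)) := by
  rw [← map_mul, ← map_sub, ← map_mul, ← map_mul]; exact RingQuot.mkAlgHom_rel k Rel.square

end Ladder

section
variable {k : Type*} [CommRing k] {n r : ℕ} {v : Node n r}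

open Ladder ListMod

/-- A map that commutes with the vertices and the arrows is linear. -/
def ladderLinear {N : Type*} [AddCommGroup N] [Module k N] [Module (LadderAlgebra k n r) N]
    [IsScalarTower k (LadderAlgebra k n r) N] (ψ : ChainRep k v →ₗ[k] N)
    (h1 : ∀ w y, ψ (ladderMk n r k (vert k w) • y) = ladderMk n r k (vert k w) • ψ y)
    (h2 : ∀ {w w'} (e : LadderArrow n r w w') y,
      ψ (ladderMk n r k (elt k n r e) • y) = ladderMk n r k (elt k n r e) • ψ y) :
    ChainRep k v →ₗ[LadderAlgebra k n r] N where
  toFun := ψ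
  map_add' := map_add ψ
  map_smul' z y := by
    obtain ⟨z, rfl⟩ := RingQuot.mkAlgHom_surjective k _ z
    induction z using PathAlgebra.induction with
    | h0 => rw [map_zero, zero_smul, map_zero, RingHom.id_apply, zero_smul]
    | hadd z z' hz hz' =>
      rw [map_add, add_smul, map_add, hz, hz', RingHom.id_apply, RingHom.id_apply,
        RingHom.id_apply, add_smul]
    | hsmul c u w p =>
      rw [map_smul (ladderMk n r k), smul_assoc, LinearMap.map_smul, RingHom.id_apply, smul_assoc]
      congr 1
      induction p generalizing y with
      | nil => exact h1 _ y
      | cons p e ih =>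
        rw [PathAlgebra.ofPath_cons, map_mul, mul_smul, mul_smul, ← ih]
        exact h2 e _

theorem vert_smul (w : Node n r) (y : ChainRep k v) :
    ladderMk n r k (vert k w) • y = chainSingle k w (y w) := by
  rw [ladderMk_smul, chainAction_vert]

theorem elt_smul {w w' : Node n r} (e : LadderArrow n r w w') (y : ChainRep k v) :
    ladderMk n r k (elt k n r e) • y = chainSingle k w' (chainArrow k v e (y w)) := by
  rw [ladderMk_smul, chainAction_elt]

theorem chains_D_of_A {v : Node n r} (hv : v.shape = .A) (m : ℕ) (h) :
    chains (n := n) (r := r) (.D m h) v = ∅ := by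
  ext l
  simp [chains, hv]

/-- The homomorphism with prescribed components. -/
theorem exists_hom_of_components (ξ : Node n r → (ListMod k →ₗ[k] LadderAlgebra k n r))
    (h : ∀ {w w'} (e : LadderArrow n r w w'), ∀ l ∈ chains w v,
      ladderMk n r k (vert k w') * ξ w' (arrowOp k e (of k l)) =
        ladderMk n r k (elt k n r e) * ξ w (of k l)) :
    ∃ Ξ : ChainRep k v →ₗ[LadderAlgebra k n r] LadderAlgebra k n r,
      ∀ w (z : chainMod k w v), Ξ (chainSingle k w z) = ladderMk n r k (vert k w) * ξ w z := by
  let ψ : ChainRep k v →ₗ[k] LadderAlgebra k n r :=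
    ∑ w, LinearMap.mulLeft k (ladderMk n r k (vert k w)) ∘ₗ ξ w ∘ₗ (chainMod k w v).subtype ∘ₗ
      LinearMap.proj w
  have hψ (y : ChainRep k v) : ψ y = ∑ w, ladderMk n r k (vert k w) * ξ w (y w) := by
    simp only [ψ, LinearMap.sum_apply]; rfl
  have hsingle (w : Node n r) (z : chainMod k w v) :
      ψ (chainSingle k w z) = ladderMk n r k (vert k w) * ξ w z := by
    rw [hψ, Finset.sum_eq_single w]
    · rw [chainSingle_same]
    · intro w' _ hw
      rw [chainSingle_of_ne hw]
      simp
    · simp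
  have hmul (w : Node n r) (y : ChainRep k v) :
      ladderMk n r k (vert k w) * ψ y = ladderMk n r k (vert k w) * ξ w (y w) := by
    rw [hψ, Finset.mul_sum, Finset.sum_eq_single w]
    · rw [← mul_assoc, ← map_mul, vert_mul_vert]
    · intro w' _ hw
      rw [← mul_assoc, ← map_mul, vert_mul_vert_of_ne hw, map_zero, zero_mul]
    · simp
  refine ⟨ladderLinear ψ (fun w y => ?_) (fun {w w'} e y => ?_), hsingle⟩
  · rw [vert_smul, hsingle, smul_eq_mul, hmul]
  · rw [elt_smul, hsingle, smul_eq_mul, ← elt_mul_vert, map_mul, mul_assoc, hmul, ← mul_assoc,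
      ← map_mul, elt_mul_vert]
    exact eqOn_supported (LinearMap.mulLeft k (ladderMk n r k (vert k w')) ∘ₗ ξ w' ∘ₗ arrowOp k e)
      (LinearMap.mulLeft k (ladderMk n r k (elt k n r e)) ∘ₗ ξ w) (h e) (y w).2

variable (k) in
/-- The sum of the arrows within the row of `v`. -/
def rowLetter : Node n r → LadderAlgebra k n r
  | .A _ _ => ladderMk n r k (a k n r)
  | .D _ _ => ladderMk n r k (d k n r)

/-- The chain itself in the bottom row, the chain with the source `0` put in front in the top row. -/
def marked : Node n r → List ℕ → List ℕ
  | .A _ _, s => s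
  | .D _ _, s => 0 :: s

/-- The marked chain `s` belongs to the component at `w`, in the same row as `v`. -/
structure IsMarkedAt (w v : Node n r) (s : List ℕ) : Prop where
  mem : s ∈ innerChains v
  shape : w.shape = v.shape
  size : s.length + 1 + v.shape.base = w.size

theorem IsMarkedAt.mem_chains {w v : Node n r} {s : List ℕ} (h : IsMarkedAt w v s) :
    marked v s ∈ chains w v := by
  obtain ⟨h1, h2, h3⟩ := h
  cases v with
  | A m hm =>
    cases w with
    | A m' hm' => exact innerChains_mem_chains h1 h3 hm'
    | D m' hm' => cases h2
  | D m hm =>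
    cases w with
    | A m' hm' => cases h2
    | D m' hm' => exact ⟨rfl, 0, s, rfl, zero_le_one, h1, h3⟩

theorem exists_hom_A {m : ℕ} {hm} (ξ₀ : ListMod k →ₗ[k] LadderAlgebra k n r)
    (h : ∀ s ∈ innerChains (n := n) (r := r) (.A m hm),
      ξ₀ (bd k (of k s)) = ladderMk n r k (a k n r) * ξ₀ (of k s)) :
    ∃ Ξ : ChainRep k (.A m hm) →ₗ[LadderAlgebra k n r] LadderAlgebra k n r,
      ∀ m' hm' (z : chainMod k (.A m' hm') (.A m hm)),
        Ξ (chainSingle k (.A m' hm') z) = ladderMk n r k (vert k (.A m' hm')) * ξ₀ z := by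
  obtain ⟨Ξ, hΞ⟩ := exists_hom_of_components (v := .A m hm)
    (fun _ => ξ₀) (fun {w w'} e l hl => by
      cases e with
      | t m' h' => rw [chains_D_of_A rfl] at hl; exact hl.elim
      | d m' h' h'' => rw [chains_D_of_A rfl] at hl; exact hl.elim
      | c m' h' h'' => rw [chains_D_of_A rfl] at hl; exact hl.elim
      | a m' h' h'' =>
        rw [← vert_A_mul_a m' h' h'', map_mul, mul_assoc, ← h _ (mem_innerChains_of_A rfl hl)]
        rfl)
  exact ⟨Ξ, fun m' hm' z => hΞ _ z⟩

open Classical in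
/-- The components in the bottom row of the homomorphism that extends `ξ₀`. -/
def bottomPart (ξ₀ : ListMod k →ₗ[k] LadderAlgebra k n r) : ListMod k →ₗ[k] LadderAlgebra k n r :=
  lin fun l =>
    if 0 ∈ l then ladderMk n r k (c k n r) * ξ₀ (of k l.dropLast)
    else if 1 ∈ l then
      ladderMk n r k (c k n r) * (ladderMk n r k (t k n r) * ξ₀ (of k l.dropLast))
    else (-1 : k) ^ l.length • ((ladderMk n r k (a k n r) * ladderMk n r k (c k n r) -
      ladderMk n r k (c k n r) * ladderMk n r k (d k n r)) * ξ₀ (of k l))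

/-- The components in the top row of the homomorphism that extends `ξ₀`. -/
def topPart (ξ₀ : ListMod k →ₗ[k] LadderAlgebra k n r) : ListMod k →ₗ[k] LadderAlgebra k n r :=
  lin fun
    | [] => 0
    | x :: l => if x = 0 then ξ₀ (of k l) else ladderMk n r k (t k n r) * ξ₀ (of k l)

variable (ξ₀ : ListMod k →ₗ[k] LadderAlgebra k n r)

theorem topPart_pre_zero (x : ListMod k) : topPart ξ₀ (pre k 0 x) = ξ₀ x :=
  eq_of_forall_of (φ := topPart ξ₀ ∘ₗ pre k 0) (ψ := ξ₀) (fun l => by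
    rw [LinearMap.comp_apply, pre_of, topPart, lin_of]
    exact if_pos rfl) x

theorem topPart_pre_one (x : ListMod k) :
    topPart ξ₀ (pre k 1 x) = ladderMk n r k (t k n r) * ξ₀ x :=
  eq_of_forall_of (φ := topPart ξ₀ ∘ₗ pre k 1)
    (ψ := LinearMap.mulLeft k (ladderMk n r k (t k n r)) ∘ₗ ξ₀) (fun l => by
    rw [LinearMap.comp_apply, pre_of, topPart, lin_of]
    exact if_neg one_ne_zero) x

theorem two_le_of_mem {v : Node n r} (hv : v.shape = .D) {s : List ℕ} (hs : s ∈ innerChains v)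
    {x : ℕ} (hx : x ∈ s) : 2 ≤ x := by
  have := (hs.2 x hx).1
  rwa [hv] at this

theorem bottomPart_app_zero {v : Node n r} {x : ListMod k}
    (hx : x ∈ Finsupp.supported k k (innerChains v)) :
    bottomPart ξ₀ (app k 0 x) = ladderMk n r k (c k n r) * ξ₀ x :=
  eqOn_supported (bottomPart ξ₀ ∘ₗ app k 0)
    (LinearMap.mulLeft k (ladderMk n r k (c k n r)) ∘ₗ ξ₀) (fun l _ => by
    rw [LinearMap.comp_apply, app_of, bottomPart, lin_of, if_pos (by simp), List.dropLast_concat]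
    rfl) hx

theorem bottomPart_app_one {v : Node n r} (hv : v.shape = .D) {x : ListMod k}
    (hx : x ∈ Finsupp.supported k k (innerChains v)) :
    bottomPart ξ₀ (app k 1 x) =
      ladderMk n r k (c k n r) * (ladderMk n r k (t k n r) * ξ₀ x) :=
  eqOn_supported (bottomPart ξ₀ ∘ₗ app k 1)
    (LinearMap.mulLeft k (ladderMk n r k (c k n r)) ∘ₗ
      LinearMap.mulLeft k (ladderMk n r k (t k n r)) ∘ₗ ξ₀) (fun l hl => by
    have h0 : 0 ∉ l := fun h0 => by have := two_le_of_mem hv hl h0; omega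
    rw [LinearMap.comp_apply, app_of, bottomPart, lin_of, if_neg (by simpa using h0),
      if_pos (by simp), List.dropLast_concat]
    rfl) hx

/-- This value is forced. An inner chain `l` is, up to the sign `(-1) ^ l.length`, the boundary of
`l ++ [0]` minus the boundary of `l` with `0` appended. In terms of the top row this is `ac - cd`
applied to `l` with the source `0`. -/
theorem bottomPart_of {v : Node n r} (hv : v.shape = .D) {l : List ℕ}
    (hl : l ∈ innerChains v) :
    bottomPart ξ₀ (of k l) = (-1 : k) ^ l.length •
      ((ladderMk n r k (a k n r) * ladderMk n r k (c k n r) -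
        ladderMk n r k (c k n r) * ladderMk n r k (d k n r)) * ξ₀ (of k l)) := by
  have h0 : 0 ∉ l := fun h0 => by have := two_le_of_mem hv hl h0; omega
  have h1 : 1 ∉ l := fun h1 => by have := two_le_of_mem hv hl h1; omega
  rw [bottomPart, lin_of, if_neg h0, if_neg h1]

theorem bd_mem_innerChains {v : Node n r} {l : List ℕ} (hl : l ∈ innerChains v) :
    bd k (of k l) ∈ Finsupp.supported k k (innerChains v) :=
  Finsupp.supported_mono (fun _ hl' => innerChains_sublist hl hl'.1) (bd_mem l)

/-- Compatibility with `a` uses every relation of the bottom row. For inner chains both sides reduce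
to a signed `acd`, by `aa = 0` and `dd = 0`. For a chain ending in the source `0` the correction `ac
- cd` fits by construction, and for the source `1` it fits by the square relation. -/
theorem bottomPart_bd {v : Node n r} (hv : v.shape = .D)
    (h : ∀ s ∈ innerChains v, ξ₀ (bd k (of k s)) = ladderMk n r k (d k n r) * ξ₀ (of k s))
    {l : List ℕ} {m : ℕ} {hm} (hl : l ∈ chains (n := n) (r := r) (.A m hm) v) :
    bottomPart ξ₀ (bd k (of k l)) = ladderMk n r k (a k n r) * bottomPart ξ₀ (of k l) := by
  have haa := ladderMk_aa (k := k) (n := n) (r := r)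
  have hdd := ladderMk_dd (k := k) (n := n) (r := r)
  have hsq := ladderMk_square (k := k) (n := n) (r := r)
  have hbo {l : List ℕ} (hl : l ∈ innerChains v) := bottomPart_of ξ₀ hv hl
  have happ0 {x : ListMod k} (hx : x ∈ Finsupp.supported k k (innerChains v)) :=
    bottomPart_app_zero ξ₀ hx
  have happ1 {x : ListMod k} (hx : x ∈ Finsupp.supported k k (innerChains v)) :=
    bottomPart_app_one ξ₀ hv hx
  set A := ladderMk n r k (a k n r)
  set C := ladderMk n r k (c k n r)
  set D := ladderMk n r k (d k n r)
  set T := ladderMk n r k (t k n r)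
  have haa' (x) : A * (A * x) = 0 := by rw [← mul_assoc, haa, zero_mul]
  have hdd' (x) : D * (D * x) = 0 := by rw [← mul_assoc, hdd, zero_mul]
  have hsq' (x) : C * (D * x) - C * (T * (D * x)) = A * (C * x) - A * (C * (T * x)) := by
    have := congrArg (· * x) hsq
    simpa only [sub_mul, mul_sub, mul_assoc] using this
  rcases mem_chains_A_cases hv hl with hl | ⟨s, hs, e, he, rfl⟩
  · have h1 : bottomPart ξ₀ (bd k (of k l)) =
        (-1 : k) ^ (l.length - 1) • ((A * C - C * D) * ξ₀ (bd k (of k l))) := by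
      refine eqOn_supported (bottomPart ξ₀)
        ((-1 : k) ^ (l.length - 1) • (LinearMap.mulLeft k (A * C - C * D) ∘ₗ ξ₀))
        (fun l' hl' => ?_) (bd_mem l)
      rw [hbo (innerChains_sublist hl hl'.1), ← hl'.2]; rfl
    rw [h1, hbo hl, h l hl, mul_smul_comm]
    by_cases h0 : l = []
    · subst h0
      have h2 : D * ξ₀ (of k []) = 0 := by rw [← h [] hl, bd_nil, map_zero]
      simp only [sub_mul, mul_assoc, h2, mul_zero, haa', sub_zero, smul_zero]
    · obtain ⟨j, hj⟩ : ∃ j, l.length = j + 1 :=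
        ⟨l.length - 1, by have := List.length_pos_iff.2 h0; omega⟩
      rw [hj, Nat.add_sub_cancel, pow_succ]
      simp only [sub_mul, mul_sub, mul_assoc, hdd', haa', mul_zero, sub_zero, zero_sub, mul_neg,
        mul_one, neg_smul, smul_neg, neg_neg]
  · have hbs : bd k (of k s) ∈ Finsupp.supported k k (innerChains v) := bd_mem_innerChains hs
    have hsm : of k s ∈ Finsupp.supported k k (innerChains v) := of_mem hs
    have hsign : (-1 : k) ^ s.length • bottomPart ξ₀ (of k s) = (A * C - C * D) * ξ₀ (of k s) := by
      rw [hbo hs, smul_smul, ← mul_pow]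
      simp
    rw [bd_app, map_add, map_smul, hsign, ← app_of]
    obtain rfl | rfl : e = 0 ∨ e = 1 := by omega
    · rw [happ0 hbs, happ0 hsm, h s hs]
      simp only [sub_mul, mul_assoc, A, C, D]
      abel
    · rw [happ1 hbs, happ1 hsm, h s hs]
      have := hsq' (ξ₀ (of k s))
      rw [sub_mul, mul_assoc, mul_assoc]
      rw [sub_eq_sub_iff_add_eq_add] at this
      change C * (T * (D * _)) + _ = A * (C * (T * _))
      rw [add_sub, sub_eq_iff_eq_add, add_comm, ← this, add_comm]

theorem exists_hom_D {m : ℕ} {hm}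
    (h : ∀ s ∈ innerChains (n := n) (r := r) (.D m hm),
      ξ₀ (bd k (of k s)) = ladderMk n r k (d k n r) * ξ₀ (of k s))
    (h' : ∀ s, ladderMk n r k (eTop k n r) * ξ₀ (of k s) = ξ₀ (of k s)) :
    ∃ Ξ : ChainRep (n := n) (r := r) k (.D m hm) →ₗ[LadderAlgebra k n r] LadderAlgebra k n r,
      ∀ m' hm' (z : chainMod k (.D m' hm') (.D m hm)),
        Ξ (chainSingle k (.D m' hm') z) = ladderMk n r k (vert k (.D m' hm')) * topPart ξ₀ z := by
  let ξ : Node n r → (ListMod k →ₗ[k] LadderAlgebra k n r) := fun w => match w with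
    | .A _ _ => bottomPart ξ₀
    | .D _ _ => topPart ξ₀
  have hsh : (Node.D m hm : Node n r).shape = .D := rfl
  obtain ⟨Ξ, hΞ⟩ := exists_hom_of_components (v := .D m hm) ξ
    (fun {w w'} e l hl => by
      cases e with
      | t m' h₁ =>
        obtain ⟨-, e, s, rfl, he, hs, -⟩ := hl
        rw [← vert_D_mul_t m' h₁, map_mul, mul_assoc, ← pre_of]
        congr 1
        show topPart ξ₀ (swapHead k _) = ladderMk n r k (t k n r) * topPart ξ₀ _
        rw [swapHead_pre]
        obtain rfl | rfl : e = 0 ∨ e = 1 := by omega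
        · rw [show swapNum 0 = 1 from rfl, topPart_pre_one, topPart_pre_zero]
        -- Since `t²` is `e_*` and not `1`, the values of `ξ₀` must be fixed by `e_*`; this is the
        -- role of `h'`.
        · rw [show swapNum 1 = 0 from rfl, topPart_pre_one, topPart_pre_zero, ← mul_assoc,
            ladderMk_tt, h']
      | d m' h₁ h₂ =>
        obtain ⟨-, e, s, rfl, he, hs, -⟩ := hl
        rw [← vert_D_mul_d m' h₁ h₂, map_mul, mul_assoc, ← pre_of]
        congr 1
        show topPart ξ₀ (bdTail k _) = ladderMk n r k (d k n r) * topPart ξ₀ _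
        rw [bdTail_pre]
        obtain rfl | rfl : e = 0 ∨ e = 1 := by omega
        · rw [topPart_pre_zero, topPart_pre_zero, h s hs]
        · rw [topPart_pre_one, topPart_pre_one, h s hs, ← mul_assoc, ladderMk_td, mul_assoc]
      | c m' h₁ h₂ =>
        obtain ⟨-, e, s, rfl, he, hs, -⟩ := hl
        rw [← vert_A_mul_c m' h₁ h₂, map_mul, mul_assoc, ← pre_of]
        congr 1
        show bottomPart ξ₀ (rotate k _) = ladderMk n r k (c k n r) * topPart ξ₀ _
        rw [rotate_pre]
        obtain rfl | rfl : e = 0 ∨ e = 1 := by omega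
        · rw [topPart_pre_zero, bottomPart_app_zero (v := .D m hm) ξ₀ (of_mem hs)]
        · rw [topPart_pre_one, bottomPart_app_one ξ₀ hsh (of_mem hs)]
      | a m' h₁ h₂ =>
        rw [← vert_A_mul_a m' h₁ h₂, map_mul, mul_assoc]
        congr 1
        exact bottomPart_bd ξ₀ hsh h hl)
  exact ⟨Ξ, fun m' hm' z => hΞ _ z⟩

/-- A homomorphism out of the representation attached to `v` is determined by a chain map. -/
theorem exists_hom (v : Node n r)
    (h : ∀ s ∈ innerChains v, ξ₀ (bd k (of k s)) = rowLetter k v * ξ₀ (of k s))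
    (h' : v.shape = .D → ∀ s, ladderMk n r k (eTop k n r) * ξ₀ (of k s) = ξ₀ (of k s)) :
    ∃ Ξ : ChainRep k v →ₗ[LadderAlgebra k n r] LadderAlgebra k n r,
      ∀ w s (hs : IsMarkedAt w v s),
        Ξ (chainSingle k w ⟨of k (marked v s), of_mem hs.mem_chains⟩) =
          ladderMk n r k (vert k w) * ξ₀ (of k s) := by
  cases v with
  | A m hm =>
    obtain ⟨Ξ, hΞ⟩ := exists_hom_A ξ₀ h
    refine ⟨Ξ, fun w s hs => ?_⟩
    cases w with
    | A m' hm' => exact hΞ m' hm' _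
    | D m' hm' => cases hs.shape
  | D m hm =>
    obtain ⟨Ξ, hΞ⟩ := exists_hom_D ξ₀ h (h' rfl)
    refine ⟨Ξ, fun w s hs => ?_⟩
    cases w with
    | A m' hm' => cases hs.shape
    | D m' hm' =>
      rw [hΞ m' hm', ← topPart_pre_zero ξ₀ (of k s), pre_of]; rfl

end

/-! ### Generators of the representations on chains -/

theorem length_add_le_of_pairwise {b c : ℕ} (hbc : b ≤ c) {s : List ℕ}
    (hs : s.Pairwise (fun x y => y < x)) (h : ∀ x ∈ s, b ≤ x ∧ x < c) : s.length + b ≤ c := by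
  induction s generalizing c with
  | nil => simpa using hbc
  | cons x s ih =>
    have hx := h x (by simp)
    have := ih hx.1 (List.pairwise_cons.1 hs).2
      (fun y hy => ⟨(h y (by simp [hy])).1, (List.pairwise_cons.1 hs).1 y hy⟩)
    rw [List.length_cons]; omega

theorem finite_pairwise_lt (c : ℕ) :
    {s : List ℕ | s.Pairwise (fun x y => y < x) ∧ ∀ x ∈ s, x < c}.Finite := by
  induction c using Nat.strong_induction_on with
  | _ c ih =>
    refine ((Set.finite_singleton []).union ((Set.finite_Iio c).biUnion fun x hx =>
      (ih x hx).image (List.cons x))).subset ?_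
    rintro s ⟨h1, h2⟩
    cases s with
    | nil => exact Or.inl rfl
    | cons x s =>
      refine Or.inr (Set.mem_biUnion (h2 x (by simp)) ⟨s, ⟨?_, ?_⟩, rfl⟩)
      · exact (List.pairwise_cons.1 h1).2
      · exact (List.pairwise_cons.1 h1).1

section
variable {k : Type*} [CommRing k] {n r : ℕ} {v : Node n r}

open Ladder ListMod

theorem base_le_last (v : Node n r) : v.shape.base ≤ v.last := by
  cases v with
  | A m h => exact Nat.zero_le _
  | D m h => exact two_le_last rfl

theorem length_le_of_mem_innerChains {s : List ℕ} (hs : s ∈ innerChains v) :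
    s.length + v.shape.base ≤ v.last :=
  length_add_le_of_pairwise (base_le_last v) hs.1 hs.2

/-- The chain contains the largest possible vertex. -/
def HasTop (v : Node n r) (s : List ℕ) : Prop :=
  (v.last = v.shape.base ∧ s = []) ∨ ∃ s', s = (v.last - 1) :: s'

/-- The vertex required by the length of `s` must be in the configuration. In the bottom row a
generator is nonempty, so its vertex is at least `A_2`, or else it is the empty chain of `A_1`,
which forces `r = 1`. This explains the bound on `r`. -/
theorem exists_isMarkedAt (hr : r = 1 ∨ r = 2) {s : List ℕ} (hs : s ∈ innerChains v)
    (h : HasTop v s) : ∃ w : Node n r, IsMarkedAt w v s := by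
  have hl := length_le_of_mem_innerChains hs
  cases v with
  | A m hm =>
    change s.length + 0 ≤ m - 1 at hl
    refine ⟨.A (s.length + 1) ⟨?_, by omega⟩, hs, rfl, rfl⟩
    rcases h with ⟨h1, rfl⟩ | ⟨s', rfl⟩
    · change m - 1 = 0 at h1
      rw [List.length_nil]; omega
    · rw [List.length_cons]; omega
  | D m hm =>
    change s.length + 2 ≤ m - 1 at hl
    exact ⟨.D (s.length + 3) ⟨by omega, by omega⟩, hs, rfl, rfl⟩

theorem node_ext {w w' : Node n r} (h : w.shape = w'.shape) (h' : w.size = w'.size) : w = w' := by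
  cases w <;> cases w' <;> simp_all [Node.shape, Node.size]

/-- The chains that generate the representation attached to `v`. -/
structure IsGenerator (w v : Node n r) (s : List ℕ) : Prop extends IsMarkedAt w v s where
  hasTop : HasTop v s

variable (k) in
/-- The vector of a marked chain. -/
def markedVec {w v : Node n r} {s : List ℕ} (h : IsMarkedAt w v s) : ChainRep k v :=
  chainSingle k w ⟨of k (marked v s), of_mem h.mem_chains⟩

theorem rowLetter_mul_self (v : Node n r) : rowLetter k v * rowLetter k v = 0 := by
  cases v with
  | A m h => exact ladderMk_aa
  | D m h => exact ladderMk_dd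

theorem eTop_mul_rowLetter (hv : v.shape = .D) :
    ladderMk n r k (eTop k n r) * rowLetter k v = rowLetter k v := by
  cases v with
  | A m h => cases hv
  | D m h => rw [rowLetter, ← map_mul, eTop_mul_d]

theorem eTop_mul_vert (hv : v.shape = .D) :
    ladderMk n r k (eTop k n r) * ladderMk n r k (vert k v) = ladderMk n r k (vert k v) := by
  cases v with
  | A m h => cases hv
  | D m h => rw [← map_mul, eTop_mul_vert_D]

/-- The hypotheses leave only `A_1` (with `r = 1`) and `D_3`, the ends of the rows, where no arrow
of the row starts. -/
theorem rowLetter_mul_vert_of_nil {w : Node n r} (h : IsMarkedAt w v [])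
    (hv : v.last = v.shape.base) (hr : 1 ≤ r) :
    rowLetter k v * ladderMk n r k (vert k w) = 0 := by
  obtain ⟨-, h2, h3⟩ := h
  cases v with
  | A m hm =>
    cases w with
    | A m' hm' =>
      obtain rfl : r = m' := by
        change m - 1 = 0 at hv
        change 1 = m' at h3
        omega
      rw [rowLetter, ← map_mul, a_mul_vert_A, map_zero]
    | D m' hm' => cases h2
  | D m hm =>
    cases w with
    | A m' hm' => cases h2
    | D m' hm' =>
      obtain rfl : 3 = m' := h3
      rw [rowLetter, ← map_mul, d_mul_vert_D_three, map_zero]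

open Classical in
/-- The homomorphism dual to a generator. -/
theorem exists_dual (hr : 1 ≤ r) {w : Node n r} {s : List ℕ} (h : IsGenerator w v s) :
    ∃ Ξ : ChainRep k v →ₗ[LadderAlgebra k n r] LadderAlgebra k n r,
      ∀ w' s' (h' : IsGenerator w' v s'),
        Ξ (markedVec k h'.toIsMarkedAt) = if s' = s then ladderMk n r k (vert k w) else 0 := by
  suffices ∃ ξ₀ : ListMod k →ₗ[k] LadderAlgebra k n r,
      (∀ s ∈ innerChains v, ξ₀ (bd k (of k s)) = rowLetter k v * ξ₀ (of k s)) ∧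
      (v.shape = .D → ∀ s, ladderMk n r k (eTop k n r) * ξ₀ (of k s) = ξ₀ (of k s)) ∧
      ∀ w' s', IsGenerator w' v s' →
        ξ₀ (of k s') = if s' = s then ladderMk n r k (vert k w) else 0 by
    obtain ⟨ξ₀, h1, h2, h3⟩ := this
    obtain ⟨Ξ, hΞ⟩ := exists_hom ξ₀ v h1 h2
    refine ⟨Ξ, fun w' s' h' => ?_⟩
    rw [markedVec, hΞ w' s' h'.toIsMarkedAt, h3 w' s' h']
    split_ifs with hs
    · subst hs
      obtain rfl : w' = w := node_ext (h'.shape.trans h.shape.symm) (h'.size.symm.trans h.size)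
      rw [← map_mul, vert_mul_vert]
    · exact mul_zero _
  obtain ⟨h0, htop⟩ := h
  rcases htop with ⟨hl, rfl⟩ | ⟨σ, rfl⟩
  -- Here the empty chain is the only inner chain, and its vertex is the end of the row, so the
  -- coefficient of `[]` times `e_w` is a chain map.
  · refine ⟨LinearMap.toSpanSingleton k _ (ladderMk n r k (vert k w)) ∘ₗ Finsupp.lapply [],
      fun s hs => ?_, fun hv s => ?_, fun w' s' h' => ?_⟩
    · obtain rfl : s = [] := by
        have := length_le_of_mem_innerChains hs
        exact List.length_eq_zero_iff.1 (by omega)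
      rw [bd_nil, map_zero, LinearMap.comp_apply, LinearMap.toSpanSingleton_apply, mul_smul_comm,
        rowLetter_mul_vert_of_nil h0 hl hr, smul_zero]
    · rw [LinearMap.comp_apply, LinearMap.toSpanSingleton_apply, mul_smul_comm,
        eTop_mul_vert (h0.shape.trans hv)]
    · rw [LinearMap.comp_apply, LinearMap.toSpanSingleton_apply, Finsupp.lapply_apply,
        Finsupp.single_apply]
      split_ifs <;> simp
  · have hσ : v.last - 1 ∉ σ := fun hm =>
      lt_irrefl _ ((List.pairwise_cons.1 h0.mem.1).1 _ hm)
    -- The generator is the apex followed by `σ`. Reading off the coefficient of `σ` in the boundary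
    -- detects it among the generators; the term with the row letter makes `ξ₀` a chain map, since
    -- boundary and row letter both have square zero.
    let ξ₀ : ListMod k →ₗ[k] LadderAlgebra k n r :=
      LinearMap.toSpanSingleton k _ (rowLetter k v * ladderMk n r k (vert k w)) ∘ₗ
        Finsupp.lapply σ +
      LinearMap.toSpanSingleton k _ (ladderMk n r k (vert k w)) ∘ₗ Finsupp.lapply σ ∘ₗ bd k
    have hξ (x : ListMod k) : ξ₀ x = x σ • (rowLetter k v * ladderMk n r k (vert k w)) +
      bd k x σ • ladderMk n r k (vert k w) := rfl
    refine ⟨ξ₀, fun s hs => ?_, fun hv s => ?_, fun w' s' h' => ?_⟩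
    · rw [hξ, hξ, bd_bd, Finsupp.zero_apply, zero_smul, add_zero, mul_add, mul_smul_comm,
        mul_smul_comm, ← mul_assoc, rowLetter_mul_self, zero_mul, smul_zero, zero_add]
    · rw [hξ, mul_add, mul_smul_comm, mul_smul_comm, ← mul_assoc, eTop_mul_rowLetter hv,
        eTop_mul_vert (h0.shape.trans hv)]
    · have h0' := h0.mem.2 (v.last - 1) (by simp)
      obtain ⟨hl, -⟩ | ⟨σ', rfl⟩ := h'.hasTop
      · omega
      have hne : (v.last - 1) :: σ' ≠ σ := by
        rintro rfl
        simp at hσ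
      -- All faces but the one opposite to the apex contain the apex, and `σ` does not.
      have hbd : pre k (v.last - 1) (bd k (of k σ')) σ = 0 := by
        have hmem : pre k (v.last - 1) (bd k (of k σ')) ∈
            Finsupp.supported k k {l | v.last - 1 ∈ l} :=
          map_mem _ (fun l _ => by rw [pre_of]; exact of_mem (by simp)) (bd_mem σ')
        by_contra hc
        exact hσ (hmem (Finsupp.mem_support_iff.2 hc))
      rw [hξ, bd_cons, Finsupp.sub_apply, hbd, sub_zero, Finsupp.single_apply, if_neg hne,
        zero_smul, zero_add, Finsupp.single_apply]
      by_cases h : σ' = σ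
      · subst h; simp
      · rw [if_neg h, if_neg (by simpa using h), zero_smul]

/-- The lists whose vectors at `w` lie in a submodule. -/
def component (X : Submodule (LadderAlgebra k n r) (ChainRep k v)) (w : Node n r) :
    Submodule k (ListMod k) :=
  ((X.restrictScalars k).comap (chainSingle k w)).map (chainMod k w v).subtype

theorem mem_component {X : Submodule (LadderAlgebra k n r) (ChainRep k v)} {w : Node n r}
    {x : ListMod k} (hx : x ∈ chainMod k w v) :
    x ∈ component X w ↔ chainSingle k w ⟨x, hx⟩ ∈ X := by
  constructor
  · rintro ⟨z, hz, rfl⟩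
    exact hz
  · intro h
    exact ⟨⟨x, hx⟩, h, rfl⟩

theorem arrowOp_mem_component {X : Submodule (LadderAlgebra k n r) (ChainRep k v)}
    {w w' : Node n r} (e : LadderArrow n r w w') {x : ListMod k} (hx : x ∈ component X w) :
    arrowOp k e x ∈ component X w' := by
  obtain ⟨z, hz, rfl⟩ := hx
  refine ⟨chainArrow k v e z, ?_, rfl⟩
  have := X.smul_mem (ladderMk n r k (elt k n r e)) hz
  rw [elt_smul, chainSingle_same] at this
  exact this

theorem marked_mem_component_of_top {X : Submodule (LadderAlgebra k n r) (ChainRep k v)}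
    (hX : ∀ w s (h : IsGenerator w v s), markedVec k h.toIsMarkedAt ∈ X) {w : Node n r}
    {s : List ℕ} (h : IsMarkedAt w v s) (ht : HasTop v s) :
    of k (marked v s) ∈ component X w :=
  (mem_component (of_mem h.mem_chains)).2 (hX w s ⟨h, ht⟩)

/-- The cone argument: if `s` does not contain the apex `p`, then `s` is the boundary of `p :: s`
plus `p` put in front of the boundary of `s`. The first term comes from a generator through an arrow
of the row, the second is a combination of generators. -/
theorem marked_mem_component {X : Submodule (LadderAlgebra k n r) (ChainRep k v)}
    (hr : r = 1 ∨ r = 2)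
    (hX : ∀ w s (h : IsGenerator w v s), markedVec k h.toIsMarkedAt ∈ X) {w : Node n r}
    {s : List ℕ} (h : IsMarkedAt w v s) : of k (marked v s) ∈ component X w := by
  by_cases ht : HasTop v s
  · exact marked_mem_component_of_top hX h ht
  have hbl := base_le_last v
  have hlast : v.shape.base < v.last := by
    refine lt_of_le_of_ne hbl fun h1 => ht (Or.inl ⟨h1.symm, ?_⟩)
    have := length_le_of_mem_innerChains h.mem
    exact List.length_eq_zero_iff.1 (by omega)
  -- The apex is the largest possible entry, so it could occur in `s` only at the front, which `ht`
  -- excludes.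
  have hs' : (v.last - 1) :: s ∈ innerChains v := by
    refine ⟨List.pairwise_cons.2 ⟨fun y hy => ?_, h.mem.1⟩, fun y hy => ?_⟩
    · have hy1 := (h.mem.2 y hy).2
      by_contra hc
      have hy2 : y = v.last - 1 := by omega
      subst hy2
      cases s with
      | nil => simp at hy
      | cons z s =>
        have hz := h.mem.2 z (by simp)
        rcases List.mem_cons.1 hy with h2 | h2
        · exact ht (Or.inr ⟨s, by rw [h2]⟩)
        · have := (List.pairwise_cons.1 h.mem.1).1 _ h2
          omega
    · rcases List.mem_cons.1 hy with rfl | hy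
      · omega
      · exact h.mem.2 y hy
  obtain ⟨w', hw'⟩ := exists_isMarkedAt hr hs' (Or.inr ⟨s, rfl⟩)
  have h1 : of k (marked v ((v.last - 1) :: s)) ∈ component X w' :=
    marked_mem_component_of_top hX hw' (Or.inr ⟨s, rfl⟩)
  have h2 {l : List ℕ} (hl : l ∈ {l' | l'.Sublist s ∧ l'.length + 1 = s.length}) :
      of k (marked v ((v.last - 1) :: l)) ∈ component X w :=
    marked_mem_component_of_top hX
      ⟨innerChains_sublist hs' (hl.1.cons_cons _), h.shape, by
        have := h.size
        have := hl.2
        rw [List.length_cons]; omega⟩ (Or.inr ⟨l, rfl⟩)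
  have hsz : w'.size = w.size + 1 := by
    have := h.size
    have := hw'.size
    rw [List.length_cons] at this
    omega
  have hsh : w'.shape = w.shape := hw'.shape.trans h.shape.symm
  cases v with
  | A m hm =>
    cases w with
    | D m₁ hm₁ => cases h.shape
    | A m₁ hm₁ =>
      cases w' with
      | D m₂ hm₂ => cases hsh
      | A m₂ hm₂ =>
        obtain rfl : m₂ = m₁ + 1 := hsz
        have h3 := arrowOp_mem_component (.a m₁ hm₁ hm₂) h1
        have h4 : pre k (m - 1 - 1) (bd k (of k s)) ∈ component X (.A m₁ hm₁) :=
          map_mem _ (fun l hl => by rw [pre_of]; exact h2 hl) (bd_mem s)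
        have h5 := add_mem h3 h4
        rw [arrowOp, marked, bd_cons, sub_add_cancel] at h5
        exact h5
  | D m hm =>
    cases w with
    | A m₁ hm₁ => cases h.shape
    | D m₁ hm₁ =>
      cases w' with
      | A m₂ hm₂ => cases hsh
      | D m₂ hm₂ =>
        obtain rfl : m₂ = m₁ + 1 := hsz
        have h3 := arrowOp_mem_component (.d m₁ hm₁ hm₂) h1
        have h4 := map_mem (pre k 0 ∘ₗ pre k (m - 1 - 1)) (N := component X (.D m₁ hm₁))
          (fun l (hl : l ∈ {l' | l'.Sublist s ∧ l'.length + 1 = s.length}) => by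
            rw [LinearMap.comp_apply, pre_of, pre_of]; exact h2 hl) (bd_mem s)
        rw [LinearMap.comp_apply] at h4
        have h5 : arrowOp k (.d (n := n) (r := r) m₁ hm₁ hm₂) (of k (0 :: (m - 1 - 1) :: s)) +
            pre k 0 (pre k (m - 1 - 1) (bd k (of k s))) = of k (0 :: s) := by
          rw [← pre_of 0 s, ← pre_of 0 (_ :: s)]
          refine (congrArg (· + _) (bdTail_pre 0 _)).trans ?_
          rw [bd_cons, map_sub, sub_add_cancel]
        exact h5 ▸ add_mem h3 h4

/-- The source `1` is reached by `t`, and chains of the bottom row that contain a source by `c`. The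
inner chains of the bottom row are then recovered from `a` by the formula behind `bottomPart_of`. -/
theorem chains_mem_component {X : Submodule (LadderAlgebra k n r) (ChainRep k v)}
    (hr : r = 1 ∨ r = 2)
    (hX : ∀ w s (h : IsGenerator w v s), markedVec k h.toIsMarkedAt ∈ X) {w : Node n r}
    {l : List ℕ} (hl : l ∈ chains w v) : of k l ∈ component X w := by
  have hD {m : ℕ} {hm} {l : List ℕ} (hl : l ∈ chains (n := n) (r := r) (.D m hm) v) :
      of k l ∈ component X (.D m hm) := by
    obtain ⟨hv, e, s, rfl, he, hs, hm'⟩ := hl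
    have h1 := marked_mem_component (k := k) hr hX
      (w := .D m hm) (s := s) ⟨hs, hv.symm, by rw [hv]; exact hm'⟩
    have h2 : marked v s = 0 :: s := by
      cases v with
      | A _ _ => cases hv
      | D _ _ => rfl
    rw [h2] at h1
    obtain rfl | rfl : e = 0 ∨ e = 1 := by omega
    · exact h1
    · have h3 := arrowOp_mem_component (.t m hm) h1
      rw [arrowOp, ← pre_of, swapHead_pre, pre_of] at h3
      exact h3
  cases w with
  | D m hm => exact hD hl
  | A m hm =>
    cases hv : v.shape with
    | A =>
      have h1 := marked_mem_component (k := k) hr hX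
        (w := .A m hm) (s := l) ⟨mem_innerChains_of_A hv hl, hv.symm, by rw [hv]; exact hl.2.1⟩
      cases v with
      | A _ _ => exact h1
      | D _ _ => cases hv
    | D =>
      have hb : v.shape.base = 2 := by rw [hv]; rfl
      have hsz : v.size ≤ n + 1 := by
        cases v with
        | A _ _ => cases hv
        | D _ h => exact h.2
      have happ {s : List ℕ} (hs : s ∈ innerChains v) {e : ℕ} (he : e ≤ 1) {m : ℕ} {hm}
          (hsm : s.length + 2 = m) : of k (s ++ [e]) ∈ component X (.A m hm) := by
        have h3 : 3 ≤ m + 1 ∧ m + 1 ≤ n + 1 := by omega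
        have h1 := arrowOp_mem_component (.c m hm h3)
          (hD (m := m + 1) (hm := h3) (l := e :: s) ⟨hv, e, s, rfl, he, hs, by omega⟩)
        rw [arrowOp, ← pre_of, rotate_pre, app_of] at h1
        exact h1
      rcases mem_chains_A_cases hv hl with hs | ⟨s, hs, e, he, rfl⟩
      · have h2 := length_le_of_mem_innerChains hs
        have hlm : l.length + 1 = m := hl.2.1
        have hlast : v.last = v.size - 1 := rfl
        -- An inner chain leaves room for a source: `l.length + 2 ≤ v.last ≤ n`, so `A_{m+1}` is in
        -- the configuration.
        have h3 : r ≤ m + 1 ∧ m + 1 ≤ n := by omega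
        have h4 := arrowOp_mem_component (.a m hm h3)
          (happ hs (e := 0) (hm := h3) zero_le_one (by omega))
        have h5 : app k 0 (bd k (of k l)) ∈ component X (.A m hm) :=
          map_mem _ (fun l' hl' => by
            rw [app_of]
            refine happ (innerChains_sublist hs hl'.1) zero_le_one ?_
            have := hl'.2
            omega) (bd_mem l)
        have h6 := (component X (.A m hm)).smul_mem ((-1 : k) ^ l.length) (sub_mem h4 h5)
        rw [arrowOp, bd_app, add_sub_cancel_left, smul_smul, ← mul_pow] at h6
        simpa using h6
      · refine happ hs he ?_
        have := hl.2.1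
        rw [List.length_append, List.length_singleton] at this
        omega

/-- The generators generate. -/
theorem eq_top_of_generators_mem {X : Submodule (LadderAlgebra k n r) (ChainRep k v)}
    (hr : r = 1 ∨ r = 2)
    (hX : ∀ w s (h : IsGenerator w v s), markedVec k h.toIsMarkedAt ∈ X) : X = ⊤ := by
  rw [eq_top_iff]
  intro y _
  rw [← sum_chainSingle y]
  refine sum_mem fun w _ => ?_
  refine (mem_component (y w).2).1 ?_
  exact map_mem LinearMap.id (N := component X w)
    (fun l hl => chains_mem_component hr hX hl) (y w).2

theorem vert_smul_markedVec {w : Node n r} {s : List ℕ} (h : IsMarkedAt w v s) :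
    ladderMk n r k (vert k w) • markedVec k h = markedVec k h := by
  rw [vert_smul, markedVec, chainSingle_same]

variable (v) in
/-- The index type of the generators. -/
abbrev GenIndex : Type := {p : Node n r × List ℕ // IsGenerator p.1 v p.2}

instance : Finite (GenIndex v) := by
  refine Set.Finite.subset (Set.finite_univ.prod (finite_pairwise_lt v.last)) ?_
  rintro ⟨w, s⟩ h
  exact ⟨trivial, h.mem.1, fun x hx => (h.mem.2 x hx).2⟩

end

/-! ### The action of the admissible maps on chains -/

section
variable {k : Type*} [CommRing k] {n r : ℕ} {u v : Node n r} {f g : ℕ → ℕ}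

open Ladder ListMod

theorem Adm.le_of_le (hf : Adm v u f) {x y : ℕ} (hx : v.shape.base ≤ x) (h : x ≤ y) :
    f x ≤ f y := by
  refine (hf.reach x y ?_).le
  cases hv : v.shape with
  | A => exact h
  | D =>
    rw [hv] at hx
    change 2 ≤ x at hx
    change x = y ∨ x < y ∧ 2 ≤ y
    omega

theorem Adm.map_mem_innerChains (hf : Adm v u f) (hv : v.shape = .D) {s : List ℕ}
    (hs : s ∈ innerChains v) (h : (s.map f).Pairwise (fun x y => y < x)) :
    s.map f ∈ innerChains u := by
  refine ⟨h, fun y hy => ?_⟩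
  obtain ⟨x, hx, rfl⟩ := List.mem_map.1 hy
  refine ⟨?_, hf.lt x (hs.2 x hx).2⟩
  rw [hf.shape hv]
  exact hf.two hv x (two_le_of_mem hv hs hx)

theorem Adm.le_one (hf : Adm v u f) (hv : v.shape = .D) {e : ℕ} (he : e ≤ 1) : f e ≤ 1 := by
  have h0 := hf.zero hv
  have h1 := hf.one hv
  obtain rfl | rfl : e = 0 ∨ e = 1 := by omega
  · exact h0
  · rw [h1]; unfold swapNum; split_ifs <;> omega

theorem Adm.swapNum_apply (hf : Adm v u f) (hv : v.shape = .D) {e : ℕ} (he : e ≤ 1) :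
    f (swapNum e) = swapNum (f e) := by
  have h1 := hf.one hv
  obtain rfl | rfl : e = 0 ∨ e = 1 := by omega
  · exact h1
  · rw [h1, swapNum_swapNum]; rfl

theorem Adm.map_mem_chains (hf : Adm v u f) {m : ℕ} {hm} {l : List ℕ}
    (hl : l ∈ chains (n := n) (r := r) (.A m hm) v)
    (h : (l.map f).Pairwise (fun x y => y < x)) :
    l.map f ∈ chains (n := n) (r := r) (.A m hm) u := by
  refine ⟨?_, by rw [List.length_map]; exact hl.2.1, fun y hy => ?_⟩
  · rw [List.pairwise_map] at h ⊢
    exact (h.and hl.1).imp fun h => ⟨h.1, hf.reach _ _ h.2.2⟩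
  · obtain ⟨x, hx, rfl⟩ := List.mem_map.1 hy
    exact hf.lt x (hl.2.2 x hx)

variable (k f) in
/-- The effect of a map of numbers on the lists in the component at a vertex. -/
def nodeOp : Node n r → (ListMod k →ₗ[k] ListMod k)
  | .A _ _ => push k f
  | .D _ _ => pushTail k f

theorem nodeOp_mem (hf : Adm v u f) (w : Node n r) (x : ListMod k) (hx : x ∈ chainMod k w v) :
    nodeOp k f w x ∈ chainMod k w u := by
  refine map_mem _ (fun l hl => ?_) hx
  cases w with
  | A m hm =>
    rw [nodeOp, push_of]
    by_cases h : (l.map f).Pairwise (fun x y => y < x)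
    · rw [strictPart_of h]
      exact of_mem (hf.map_mem_chains hl h)
    · rw [strictPart_of_not h]
      exact zero_mem _
  | D m hm =>
    obtain ⟨hv, e, s, rfl, he, hs, hsm⟩ := hl
    rw [nodeOp, ← pre_of, pushTail_pre, push_of]
    by_cases h : (s.map f).Pairwise (fun x y => y < x)
    · rw [strictPart_of h, pre_of]
      exact of_mem ⟨hf.shape hv, _, _, rfl, hf.le_one hv he, hf.map_mem_innerChains hv hs h,
        by rw [List.length_map]; exact hsm⟩
    · rw [strictPart_of_not h, map_zero]
      exact zero_mem _

theorem Adm.pairwise_map_le (hf : Adm v u f) {s : List ℕ} (hs : s ∈ innerChains v) :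
    (s.map f).Pairwise (fun x y => y ≤ x) := by
  rw [List.pairwise_map]
  exact hs.1.imp_of_mem fun _ hy h => hf.le_of_le (hs.2 _ hy).1 h.le

theorem Adm.pairwise_map_le_of_mem_chains (hf : Adm v u f) {m : ℕ} {hm} {l : List ℕ}
    (hl : l ∈ chains (n := n) (r := r) (.A m hm) v) : (l.map f).Pairwise (fun x y => y ≤ x) := by
  rw [List.pairwise_map]
  exact hl.1.imp fun h => (hf.reach _ _ h.2).le

/-- The inner chain keeps its entries at least `2`, and the source is sent to a source, so appending
it never creates or removes a repetition. -/
theorem push_app_of (hf : Adm v u f) (hv : v.shape = .D) {s : List ℕ} (hs : s ∈ innerChains v)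
    {e : ℕ} (he : e ≤ 1) : push k f (of k (s ++ [e])) = app k (f e) (push k f (of k s)) := by
  rw [push_of, push_of, List.map_append, List.map_singleton]
  by_cases h : (s.map f).Pairwise (fun x y => y < x)
  · rw [strictPart_of h, app_of, strictPart_of]
    refine List.pairwise_append.2 ⟨h, by simp, fun x hx y hy => ?_⟩
    obtain ⟨z, hz, rfl⟩ := List.mem_map.1 hx
    obtain rfl : y = f e := by simpa using hy
    have := hf.two hv z (two_le_of_mem hv hs hz)
    have := hf.le_one hv he
    omega
  · rw [strictPart_of_not h, map_zero, strictPart_of_not]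
    exact fun h' => h (List.pairwise_append.1 h').1

theorem nodeOp_arrowOp (hf : Adm v u f) {w w' : Node n r} (e : LadderArrow n r w w') {l : List ℕ}
    (hl : l ∈ chains w v) :
    nodeOp k f w' (arrowOp k e (of k l)) = arrowOp k e (nodeOp k f w (of k l)) := by
  cases e with
  | t m h =>
    obtain ⟨hv, e, s, rfl, he, hs, -⟩ := hl
    rw [nodeOp, arrowOp, ← pre_of, swapHead_pre, pushTail_pre, pushTail_pre, swapHead_pre,
      hf.swapNum_apply hv he]
  | d m h h' =>
    obtain ⟨hv, e, s, rfl, he, hs, -⟩ := hl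
    rw [nodeOp, nodeOp, arrowOp, ← pre_of, bdTail_pre, pushTail_pre, pushTail_pre, bdTail_pre,
      bd_push (hf.pairwise_map_le hs)]
  | c m h h' =>
    obtain ⟨hv, e, s, rfl, he, hs, -⟩ := hl
    rw [nodeOp, nodeOp, arrowOp, ← pre_of, rotate_pre, pushTail_pre, rotate_pre, app_of,
      push_app_of hf hv hs he]
  | a m h h' =>
    rw [nodeOp, nodeOp, arrowOp, bd_push (hf.pairwise_map_le_of_mem_chains hl)]

variable (k) in
/-- The effect of an admissible map on the component at a vertex. -/
def nodeMap (hf : Adm v u f) (w : Node n r) : chainMod k w v →ₗ[k] chainMod k w u :=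
  (nodeOp k f w).restrict (nodeOp_mem hf w)

variable (k) in
/-- The effect of an admissible map on all components. -/
def nodeMaps (hf : Adm v u f) : ChainRep k v →ₗ[k] ChainRep k u :=
  LinearMap.pi (φ := fun w : Node n r => chainMod k w u) fun w =>
    nodeMap k hf w ∘ₗ LinearMap.proj (φ := fun w : Node n r => chainMod k w v) w

variable (k) in
/-- The homomorphism of representations induced by an admissible map. -/
def pushHom (hf : Adm v u f) : ChainRep k v →ₗ[LadderAlgebra k n r] ChainRep k u :=
  ladderLinear (nodeMaps k hf)
    (fun w y => by
      rw [vert_smul, vert_smul]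
      funext w'
      show nodeMap k hf w' (chainSingle k w (y w) w') =
        chainSingle k w (nodeMap k hf w (y w)) w'
      by_cases h : w' = w
      · subst h; rw [chainSingle_same, chainSingle_same]
      · rw [chainSingle_of_ne h, chainSingle_of_ne h, map_zero])
    (fun {w w'} e y => by
      rw [elt_smul, elt_smul]
      funext w₁
      show nodeMap k hf w₁ (chainSingle k w' (chainArrow k v e (y w)) w₁) =
        chainSingle k w' (chainArrow k u e (nodeMap k hf w (y w))) w₁
      by_cases h : w₁ = w'
      · subst h
        rw [chainSingle_same, chainSingle_same]
        exact Subtype.ext (eqOn_supported (nodeOp k f w₁ ∘ₗ arrowOp k e)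
          (arrowOp k e ∘ₗ nodeOp k f w) (fun l hl => nodeOp_arrowOp hf e hl) (y w).2)
      · rw [chainSingle_of_ne h, chainSingle_of_ne h, map_zero])

theorem pushHom_apply (hf : Adm v u f) (y : ChainRep k v) (w : Node n r) :
    (pushHom k hf y w : ListMod k) = nodeOp k f w (y w) := rfl

theorem push_id_of {l : List ℕ} (h : l.Pairwise (fun x y => y < x)) :
    push k id (of k l) = of k l := by
  rw [push_of, List.map_id, strictPart_of h]

/-- A repetition produced by `f` persists under `g`. Weak monotonicity of the image ensures that
failing to be strict means having a repetition. -/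
theorem push_comp_of {l : List ℕ} (h : (l.map f).Pairwise (fun x y => y ≤ x)) :
    push k (g ∘ f) (of k l) = push k g (push k f (of k l)) := by
  rw [push_of, push_of, ← List.map_map]
  by_cases h1 : (l.map f).Pairwise (fun x y => y < x)
  · rw [strictPart_of h1, push_of]
  · rw [strictPart_of_not h1, map_zero, strictPart_of_not]
    intro h2
    refine h1 ((h.and (List.pairwise_map.1 h2)).imp fun {x y} h => ?_)
    exact lt_of_le_of_ne h.1 fun h' => by rw [h'] at h; exact lt_irrefl _ h.2

theorem pushHom_id (hf : Adm v v id) : pushHom k hf = LinearMap.id := by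
  refine LinearMap.ext fun y => funext fun w => Subtype.ext ?_
  rw [pushHom_apply]
  refine eqOn_supported (nodeOp k id w) LinearMap.id (fun l hl => ?_) (y w).2
  cases w with
  | A m hm => exact push_id_of (hl.1.imp fun h => h.1)
  | D m hm =>
    obtain ⟨hv, e, s, rfl, he, hs, -⟩ := hl
    rw [nodeOp, ← pre_of, pushTail_pre, push_id_of hs.1]; rfl

theorem pushHom_comp {w : Node n r} (hf : Adm w v f) (hg : Adm v u g) (h : Adm w u (g ∘ f))
    (y : ChainRep k w) : pushHom k h y = pushHom k hg (pushHom k hf y) := by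
  refine funext fun w => Subtype.ext ?_
  rw [pushHom_apply, pushHom_apply, pushHom_apply]
  refine eqOn_supported (nodeOp k (g ∘ f) w) (nodeOp k g w ∘ₗ nodeOp k f w)
    (fun l hl => ?_) (y w).2
  cases w with
  | A m hm => exact push_comp_of (hf.pairwise_map_le_of_mem_chains hl)
  | D m hm =>
    obtain ⟨hv, e, s, rfl, he, hs, -⟩ := hl
    rw [LinearMap.comp_apply, nodeOp, ← pre_of, pushTail_pre,
      push_comp_of (hf.pairwise_map_le hs), nodeOp, nodeOp, pushTail_pre, pushTail_pre]; rfl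

variable (k n r) in
/-- The sum of all the representations on chains. -/
abbrev ConfRep : Type _ := ∀ v : Node n r, ChainRep k v

instance : SMulCommClass (LadderAlgebra k n r) k (ConfRep k n r) :=
  IsScalarTower.to_smulCommClass'

variable (k) in
/-- The endomorphism of the sum of all the representations induced by an admissible map. -/
def confEnd (hf : Adm v u f) : Module.End (LadderAlgebra k n r) (ConfRep k n r) :=
  LinearMap.single (LadderAlgebra k n r) (fun v : Node n r => ChainRep k v) u ∘ₗ
    pushHom k hf ∘ₗ LinearMap.proj v

theorem confEnd_apply (hf : Adm v u f) (y : ConfRep k n r) :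
    confEnd k hf y = Pi.single u (pushHom k hf (y v)) := rfl

theorem confEnd_congr (hf : Adm v u f) (hg : Adm v u g) (h : f = g) :
    confEnd k hf = confEnd k hg := by
  subst h; rfl

theorem confEnd_id (hf : Adm v v id) (y : ConfRep k n r) :
    confEnd k hf y = Pi.single v (y v) := by
  rw [confEnd_apply, pushHom_id]; rfl

theorem confEnd_mul {w : Node n r} (hf : Adm w v f) (hg : Adm v u g) (h : Adm w u (g ∘ f)) :
    confEnd k hg * confEnd k hf = confEnd k h := by
  refine LinearMap.ext fun y => ?_
  rw [Module.End.mul_apply, confEnd_apply, confEnd_apply, confEnd_apply, Pi.single_eq_same,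
    pushHom_comp hf hg h]

theorem confEnd_mul_of_ne {u' v' : Node n r} (hf : Adm v' u' f) (hg : Adm v u g) (h : v ≠ u') :
    confEnd k hg * confEnd k hf = 0 := by
  refine LinearMap.ext fun y => ?_
  rw [Module.End.mul_apply, confEnd_apply, confEnd_apply, Pi.single_eq_of_ne h, map_zero]
  exact Pi.single_zero _

variable (k n) in
/-- The action of the path algebra of the configuration. -/
def pathAction (hr : 1 ≤ r) : PathAlgebra k (Conf n r) →ₐ[k]
    (Module.End (LadderAlgebra k n r) (ConfRep k n r))ᵐᵒᵖ :=
  -- Vertex maps compose in the order opposite to paths, which accounts for the opposite ring.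
  PathAlgebra.lift (fun {_ _} p => MulOpposite.op (confEnd k (Adm.path hr p)))
    (fun {_ _ _} q p => congrArg MulOpposite.op
      ((confEnd_congr _ _ (vmap_comp q p)).trans
        (confEnd_mul (Adm.path hr p) (Adm.path hr q) (Adm.comp (Adm.path hr q)
          (Adm.path hr p))).symm))
    (fun {_ _ _ _} p q h => congrArg MulOpposite.op
      (confEnd_mul_of_ne (Adm.path hr p) (Adm.path hr q) h))
    (by
      refine MulOpposite.unop_injective ?_
      rw [Finset.unop_sum]
      refine LinearMap.ext fun y => ?_
      rw [LinearMap.sum_apply]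
      exact Eq.trans (Finset.sum_congr rfl fun v _ => confEnd_id (Adm.id v) y)
        (Finset.univ_sum_single y))

variable (k n) in
/-- The action of the algebra of the configuration. -/
def confAction (F : Type*) [Field F] (hr : 1 ≤ r) : ConfAlgebra F n r k →ₐ[k]
    (Module.End (LadderAlgebra k n r) (ConfRep k n r))ᵐᵒᵖ :=
  RingQuot.liftAlgHom k ⟨pathAction k n hr, fun _ _ h => by
    obtain ⟨p, q, h⟩ := h
    rw [pathAction, PathAlgebra.lift_ofPath, PathAlgebra.lift_ofPath]
    exact congrArg MulOpposite.op (confEnd_congr _ _ ((Adm.path hr p).ext (Adm.path hr q)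
      (vmap_eq_of_iso F p q h)))⟩

theorem confAction_ofPath (F : Type*) [Field F] (hr : 1 ≤ r) {u v : Conf n r}
    (p : Quiver.Path u v) :
    confAction k n F hr (RingQuot.mkAlgHom k (ConfRel F n r k) (PathAlgebra.ofPath k p)) =
      MulOpposite.op (confEnd k (Adm.path hr p)) := by
  rw [confAction, RingQuot.liftAlgHom_mkAlgHom_apply, pathAction, PathAlgebra.lift_ofPath]

end

/-! ### Step functions -/

theorem eq_of_pairwise_lt {l l' : List ℕ} (h : l.Pairwise (fun x y => y < x))
    (h' : l'.Pairwise (fun x y => y < x)) (hm : ∀ x, x ∈ l ↔ x ∈ l') : l = l' := by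
  have hp : l.Perm l' := (List.perm_ext_iff_of_nodup (h.imp fun h => h.ne')
    (h'.imp fun h => h.ne')).2 hm
  exact hp.eq_of_pairwise (fun a b _ _ h1 h2 => absurd h1 h2.asymm) h h'

/-- The step function that takes the values in the second list on the intervals that end at the
numbers in the first list, both in decreasing order, and the value `c` beyond. -/
def stair : List ℕ → List ℕ → ℕ → ℕ → ℕ
  | a :: s, b :: s', c, x => if a < x then c else stair s s' b x
  | _, _, c, _ => c

theorem stair_of_forall_lt {s s' : List ℕ} {c x : ℕ} (h : ∀ y ∈ s, y < x) :
    stair s s' c x = c := by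
  cases s with
  | nil => rfl
  | cons a s =>
    cases s' with
    | nil => rfl
    | cons b s' => exact if_pos (h a (by simp))

theorem stair_mem (s s' : List ℕ) (c x : ℕ) : stair s s' c x ∈ c :: s' := by
  induction s generalizing s' c with
  | nil => exact List.mem_cons_self
  | cons a s ih =>
    cases s' with
    | nil => exact List.mem_cons_self
    | cons b s' =>
      rw [stair]
      split_ifs
      · exact List.mem_cons_self
      · exact List.mem_cons_of_mem _ (ih s' b)

theorem stair_mem_of_le {s s' : List ℕ} (c : ℕ) {x y : ℕ} (hl : s.length = s'.length)
    (hs : s.Pairwise (fun x y => y < x)) (hy : y ∈ s) (hxy : x ≤ y) : stair s s' c x ∈ s' := by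
  cases s with
  | nil => simp at hy
  | cons a s =>
    cases s' with
    | nil => simp at hl
    | cons b s' =>
      have hya : y ≤ a := by
        rcases List.mem_cons.1 hy with rfl | hy
        · exact le_rfl
        · exact ((List.pairwise_cons.1 hs).1 y hy).le
      rw [stair, if_neg (by omega)]
      exact stair_mem s s' b x

theorem stair_rel {R : ℕ → ℕ → Prop} (hR : ∀ x, R x x) {s s' : List ℕ} {c : ℕ}
    (h : (c :: s').Pairwise (fun x y => R y x)) {x y : ℕ} (hxy : x ≤ y) :
    R (stair s s' c x) (stair s s' c y) := by
  induction s generalizing s' c with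
  | nil => exact hR c
  | cons a s ih =>
    cases s' with
    | nil => exact hR c
    | cons b s' =>
      by_cases hy : a < y
      · rw [show stair (a :: s) (b :: s') c y = c from if_pos hy]
        rcases List.mem_cons.1 (stair_mem (a :: s) (b :: s') c x) with h1 | h1
        · rw [h1]; exact hR c
        · exact (List.pairwise_cons.1 h).1 _ h1
      · rw [stair, stair, if_neg hy, if_neg (by omega)]
        exact ih (List.pairwise_cons.1 h).2

theorem map_stair {s s' : List ℕ} (c : ℕ) (hl : s.length = s'.length)
    (hs : s.Pairwise (fun x y => y < x)) : s.map (stair s s' c) = s' := by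
  induction s generalizing s' c with
  | nil => exact (List.length_eq_zero_iff.1 hl.symm).symm
  | cons a s ih =>
    cases s' with
    | nil => simp at hl
    | cons b s' =>
      obtain ⟨h1, h2⟩ := List.pairwise_cons.1 hs
      rw [List.map_cons, stair, if_neg (lt_irrefl a), stair_of_forall_lt h1]
      refine congrArg (b :: ·) (Eq.trans (List.map_congr_left fun y hy => ?_)
        (ih b (by simpa using hl) h2))
      exact if_neg (h1 y hy).asymm

theorem stair_ne_succ_iff {s s' : List ℕ} {c : ℕ} (hl : s.length = s'.length)
    (hs : s.Pairwise (fun x y => y < x)) (h : (c :: s').Pairwise (fun x y => y < x)) (x : ℕ) :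
    stair s s' c x ≠ stair s s' c (x + 1) ↔ x ∈ s := by
  induction s generalizing s' c with
  | nil => simp [stair]
  | cons a s ih =>
    cases s' with
    | nil => simp at hl
    | cons b s' =>
      obtain ⟨h1, h2⟩ := List.pairwise_cons.1 hs
      obtain ⟨h3, h4⟩ := List.pairwise_cons.1 h
      rw [stair, stair, List.mem_cons]
      rcases lt_trichotomy a x with hx | rfl | hx
      · rw [if_pos hx, if_pos (by omega)]
        refine iff_of_false (fun h => h rfl) ?_
        rintro (rfl | h5)
        · exact lt_irrefl _ hx
        · exact lt_asymm hx (h1 x h5)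
      · rw [if_neg (lt_irrefl a), if_pos (Nat.lt_succ_self a), stair_of_forall_lt h1]
        exact iff_of_true (h3 b (by simp)).ne (Or.inl rfl)
      · rw [if_neg (by omega), if_neg (by omega), ih (by simpa using hl) h2 h4]
        exact ⟨Or.inr, fun h => h.resolve_left hx.ne⟩

section
variable {n r : ℕ} {u v w : Node n r}

/-! ### The jumps of admissible maps -/

/-- The numbers at which a map jumps, in decreasing order. -/
def jumps (v : Node n r) (g : ℕ → ℕ) : List ℕ :=
  ((List.range v.last).filter fun x => decide (v.shape.base ≤ x ∧ g x ≠ g (x + 1))).reverse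

theorem mem_jumps {g : ℕ → ℕ} {x : ℕ} :
    x ∈ jumps v g ↔ x < v.last ∧ v.shape.base ≤ x ∧ g x ≠ g (x + 1) := by
  simp [jumps]

theorem jumps_mem_innerChains (g : ℕ → ℕ) : jumps v g ∈ innerChains v := by
  refine ⟨?_, fun x hx => ⟨(mem_jumps.1 hx).2.1, (mem_jumps.1 hx).1⟩⟩
  rw [jumps, List.pairwise_reverse]
  exact List.Pairwise.filter _ List.pairwise_lt_range

theorem hasTop_of_mem {s : List ℕ} (hs : s ∈ innerChains v)
    (h : v.shape.base < v.last → v.last - 1 ∈ s) : HasTop v s := by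
  cases s with
  | nil =>
    refine Or.inl ⟨le_antisymm ?_ (base_le_last v), rfl⟩
    by_contra hc
    simpa using h (by omega)
  | cons a s =>
    have ha := (hs.2 a (by simp))
    refine Or.inr ⟨s, ?_⟩
    rcases List.mem_cons.1 (h (by omega)) with h1 | h1
    · rw [h1]
    · have := (List.pairwise_cons.1 hs.1).1 _ h1
      omega

theorem Adm.last_self {g : ℕ → ℕ} (hg : Adm v u g) : g v.last = u.last := hg.last 0

/-- Numbers below the last one stay below the last one, so there is always a jump just before the
end. Hence the jumps form a generator. -/
theorem Adm.hasTop_jumps {g : ℕ → ℕ} (hg : Adm v u g) : HasTop v (jumps v g) := by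
  refine hasTop_of_mem (jumps_mem_innerChains g) fun h => mem_jumps.2 ⟨by omega, by omega, ?_⟩
  have h1 := hg.lt (v.last - 1) (by omega)
  have h2 := hg.last_self
  rw [show v.last - 1 + 1 = v.last by omega]
  omega

/-- Each jump is followed by a larger value, and `g` is monotone there, so `g` is strictly monotone
on its jumps and does not degenerate its own generator. -/
theorem Adm.pairwise_map_jumps {g : ℕ → ℕ} (hg : Adm v u g) :
    ((jumps v g).map g).Pairwise (fun x y => y < x) := by
  rw [List.pairwise_map]
  refine (jumps_mem_innerChains g).1.imp_of_mem fun {x y} hx hy hxy => ?_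
  obtain ⟨-, h1, h2⟩ := mem_jumps.1 hy
  have h3 := hg.le_of_le h1 (Nat.le_add_right y 1)
  have h4 := hg.le_of_le (x := y + 1) (y := x) (by omega) hxy
  omega

/-- Between its jumps `g` is constant, with the value taken at the right end of the interval. There
`h` agrees with `g`, and `h` is monotone, so `g` is the largest map with these values. This is the
source of triangularity. -/
theorem Adm.le_of_map_marked_eq {g h : ℕ → ℕ} (hg : Adm v u g) (hh : Adm v u h)
    (heq : (marked v (jumps v g)).map h = (marked v (jumps v g)).map g) {x : ℕ}
    (hx : x < v.last) : h x ≤ g x := by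
  rw [List.map_inj_left] at heq
  have key : ∀ j x, v.shape.base ≤ x → x + j = v.last → h x ≤ g x := by
    intro j
    induction j with
    | zero =>
      rintro x - rfl
      rw [hg.last_self, hh.last_self]
    | succ j ih =>
      intro x hb hx
      by_cases hj : x ∈ jumps v g
      · refine (heq x ?_).le
        cases v with
        | A _ _ => exact hj
        | D _ _ => exact List.mem_cons_of_mem _ hj
      · have h1 : g x = g (x + 1) := by
          by_contra hc
          exact hj (mem_jumps.2 ⟨by omega, hb, hc⟩)
        rw [h1]
        exact (hh.le_of_le hb (Nat.le_succ x)).trans (ih (x + 1) (by omega) (by omega))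
  by_cases hb : v.shape.base ≤ x
  · exact key (v.last - x) x hb (by omega)
  · cases v with
    | A _ _ => exact absurd (Nat.zero_le _) hb
    | D m hm =>
      have h0 : h 0 = g 0 := heq 0 List.mem_cons_self
      have h1 : h 1 = g 1 := by rw [hg.one rfl, hh.one rfl, h0]
      change ¬ 2 ≤ x at hb
      obtain rfl | rfl : x = 0 ∨ x = 1 := by omega
      · exact h0.le
      · exact h1.le

/-- The step function that also maps the last number to the last number. -/
def stairMap (v u : Node n r) (s s' : List ℕ) (x : ℕ) : ℕ :=
  if v.last ≤ x then u.last + (x - v.last) else stair s s' u.last x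

theorem stairMap_of_le {s s' : List ℕ} (hs : s ∈ innerChains v) {x : ℕ} (hx : x ≤ v.last) :
    stairMap v u s s' x = stair s s' u.last x := by
  unfold stairMap
  split_ifs with h
  · rw [stair_of_forall_lt fun y hy => (hs.2 y hy).2.trans_le h]; omega
  · rfl

theorem stairMap_last (s s' : List ℕ) (j : ℕ) : stairMap v u s s' (v.last + j) = u.last + j := by
  rw [stairMap, if_pos (by omega)]; omega

/-- Since the generator contains the apex, the value `u.last` is not needed before the last number;
this yields the strictness in `Adm.lt`. -/
theorem stairMap_mem {s s' : List ℕ} (hs : s ∈ innerChains v) (ht : HasTop v s)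
    (hl : s.length = s'.length) {x : ℕ} (hb : v.shape.base ≤ x) (hx : x < v.last) :
    stairMap v u s s' x ∈ s' := by
  rw [stairMap_of_le hs hx.le]
  obtain ⟨h, -⟩ | ⟨σ, rfl⟩ := ht
  · omega
  · exact stair_mem_of_le _ hl hs.1 List.mem_cons_self (by omega)

theorem reach_last {s : List ℕ}
    (hs : s.Pairwise (fun x y => y < x ∧ u.shape.Reach y x)) (hlt : ∀ x ∈ s, x < u.last) :
    (u.last :: s).Pairwise (fun x y => y < x ∧ u.shape.Reach y x) := by
  refine List.pairwise_cons.2 ⟨fun y hy => ⟨hlt y hy, ?_⟩, hs⟩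
  have h1 := hlt y hy
  cases hu : u.shape with
  | A => exact h1.le
  | D => exact Or.inr ⟨h1, two_le_last hu⟩

theorem Shape.reach_refl (s : Shape) (x : ℕ) : s.Reach x x := by
  cases s with
  | A => exact le_rfl
  | D => exact Or.inl rfl

theorem reach_of_last_le {x y : ℕ} (hx : u.last ≤ x) (h : x ≤ y) : u.shape.Reach x y := by
  cases hu : u.shape with
  | A => exact h
  | D =>
    have := two_le_last hu
    change x = y ∨ x < y ∧ 2 ≤ y
    omega

theorem reach_trans {s : Shape} {x y z : ℕ} (h : s.Reach x y) (h' : s.Reach y z) :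
    s.Reach x z := by
  cases s <;> simp only [Shape.Reach] at * <;> omega

theorem stairMap_reach {s s' : List ℕ} (hs : s ∈ innerChains v)
    (hs' : (u.last :: s').Pairwise (fun x y => y < x ∧ u.shape.Reach y x)) {x y : ℕ}
    (hxy : x ≤ y) : u.shape.Reach (stairMap v u s s' x) (stairMap v u s s' y) := by
  have key {x y : ℕ} (hxy : x ≤ y) (hy : y ≤ v.last) :
      u.shape.Reach (stairMap v u s s' x) (stairMap v u s s' y) := by
    rw [stairMap_of_le hs hy, stairMap_of_le hs (hxy.trans hy)]
    exact stair_rel (Shape.reach_refl _) (hs'.imp fun h => h.2) hxy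
  by_cases hy : y ≤ v.last
  · exact key hxy hy
  have h2 : stairMap v u s s' y = u.last + (y - v.last) := if_pos (by omega)
  by_cases hx : x ≤ v.last
  · refine reach_trans (key hx le_rfl) ?_
    rw [h2, show v.last = v.last + 0 from rfl, stairMap_last]
    exact reach_of_last_le le_rfl (by omega)
  · have h1 : stairMap v u s s' x = u.last + (x - v.last) := if_pos (by omega)
    rw [h1, h2]
    exact reach_of_last_le (by omega) (by omega)

theorem stairMap_ne_succ_iff {s s' : List ℕ} (hs : s ∈ innerChains v)
    (hs' : (u.last :: s').Pairwise (fun x y => y < x ∧ u.shape.Reach y x))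
    (hl : s.length = s'.length) {x : ℕ} (hx : x < v.last) :
    stairMap v u s s' x ≠ stairMap v u s s' (x + 1) ↔ x ∈ s := by
  rw [stairMap_of_le hs hx.le, stairMap_of_le hs hx]
  exact stair_ne_succ_iff hl hs.1 (hs'.imp fun h => h.1) x

theorem map_stairMap {s s' : List ℕ} (hs : s ∈ innerChains v) (hl : s.length = s'.length) :
    s.map (stairMap v u s s') = s' :=
  (List.map_congr_left fun x hx => stairMap_of_le hs (hs.2 x hx).2.le).trans
    (map_stair _ hl hs.1)

theorem jumps_eq {s : List ℕ} (hs : s ∈ innerChains v) {g : ℕ → ℕ}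
    (h : ∀ x, v.shape.base ≤ x → x < v.last → (g x ≠ g (x + 1) ↔ x ∈ s)) : jumps v g = s := by
  refine eq_of_pairwise_lt (jumps_mem_innerChains g).1 hs.1 fun x => ?_
  rw [mem_jumps]
  constructor
  · rintro ⟨h1, h2, h3⟩
    exact (h x h2 h1).1 h3
  · intro hx
    obtain ⟨h1, h2⟩ := hs.2 x hx
    exact ⟨h2, h1, (h x h1 h2).2 hx⟩

theorem exists_adm_A {s s' : List ℕ} (hv : v.shape = .A) (hs : s ∈ innerChains v)
    (ht : HasTop v s) (hl : s.length = s'.length)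
    (hs' : s'.Pairwise (fun x y => y < x ∧ u.shape.Reach y x)) (hlt : ∀ x ∈ s', x < u.last) :
    ∃ g, Adm v u g ∧ jumps v g = s ∧ s.map g = s' := by
  have hb : v.shape.base = 0 := by rw [hv]; rfl
  have h1 := reach_last hs' hlt
  have hA : v.shape ≠ .D := by rw [hv]; exact fun h => by cases h
  refine ⟨stairMap v u s s', ⟨fun x y h => stairMap_reach hs h1 h.le, fun x hx => ?_,
    stairMap_last s s', fun h => absurd h hA, fun h => absurd h hA, fun h => absurd h hA,
    fun h => absurd h hA⟩, jumps_eq hs fun x _ hx => stairMap_ne_succ_iff hs h1 hl hx,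
    map_stairMap hs hl⟩
  exact hlt _ (stairMap_mem hs ht hl (by omega) hx)

theorem exists_adm_D {s s' : List ℕ} {e : ℕ} (hv : v.shape = .D) (hu : u.shape = .D)
    (hs : s ∈ innerChains v) (ht : HasTop v s) (hl : s.length = s'.length) (he : e ≤ 1)
    (hs' : s' ∈ innerChains u) :
    ∃ g, Adm v u g ∧ jumps v g = s ∧ g 0 = e ∧ s.map g = s' := by
  have hb : v.shape.base = 2 := by rw [hv]; rfl
  have hlast := two_le_last hu
  have hlast' := two_le_last hv
  have hR {x y : ℕ} : u.shape.Reach x y ↔ x = y ∨ x < y ∧ 2 ≤ y := by rw [hu]; rfl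
  have hR' {x y : ℕ} : v.shape.Reach x y ↔ x = y ∨ x < y ∧ 2 ≤ y := by rw [hv]; rfl
  have h1 : (u.last :: s').Pairwise (fun x y => y < x ∧ u.shape.Reach y x) :=
    reach_last (hs'.1.imp_of_mem fun {x y} hx _ h =>
      ⟨h, hR.2 (Or.inr ⟨h, two_le_of_mem hu hs' hx⟩)⟩)
      fun x hx => (hs'.2 x hx).2
  have hmem {x : ℕ} (hx : 2 ≤ x) (hx' : x < v.last) : stairMap v u s s' x ∈ s' :=
    stairMap_mem hs ht hl (by omega) hx'
  have hge {x : ℕ} (hx : 2 ≤ x) : 2 ≤ stairMap v u s s' x := by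
    by_cases hx' : x < v.last
    · exact two_le_of_mem hu hs' (hmem hx hx')
    · rw [stairMap, if_pos (by omega)]; omega
  -- The image of the source `0` is prescribed by the marked entry `e`, that of `1` follows from
  -- compatibility with the exchange, and the rest is the step function.
  let g (x : ℕ) : ℕ := if x = 0 then e else if x = 1 then swapNum e else stairMap v u s s' x
  have hg {x : ℕ} (hx : 2 ≤ x) : g x = stairMap v u s s' x :=
    (if_neg (by omega)).trans (if_neg (by omega))
  have hg1 {x : ℕ} (hx : x < 2) : g x ≤ 1 := by
    simp only [g, swapNum]; split_ifs <;> omega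
  refine ⟨g, ⟨fun x y h => ?_, fun x hx => ?_, fun j => ?_, fun _ => hu, fun _ => he, fun _ => rfl,
    fun _ x hx => by rw [hg hx]; exact hge hx⟩, jumps_eq hs fun x hx hx' => ?_, rfl, ?_⟩
  · rcases hR'.1 h with rfl | ⟨h2, h3⟩
    · exact Shape.reach_refl _ _
    · by_cases hx : 2 ≤ x
      · rw [hg hx, hg h3]
        exact stairMap_reach hs h1 h2.le
      · have h4 := hg1 (x := x) (by omega)
        have h5 := hge h3
        rw [hR, hg h3]
        omega
  · by_cases hx' : 2 ≤ x
    · rw [hg hx']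
      exact (hs'.2 _ (hmem hx' hx)).2
    · have := hg1 (x := x) (by omega)
      omega
  · rw [hg (by omega), stairMap_last]
  · rw [hg (by omega), hg (by omega)]
    exact stairMap_ne_succ_iff hs h1 hl hx'
  · exact (List.map_congr_left fun x hx => hg (two_le_of_mem hv hs hx)).trans (map_stairMap hs hl)

/-- Every chain is the image of a given generator under an admissible map that jumps at the numbers
in the generator. -/
theorem exists_adm {s l : List ℕ} (h : IsGenerator w v s) (hl : l ∈ chains w u) :
    ∃ g, Adm v u g ∧ jumps v g = s ∧ (marked v s).map g = l := by
  have hsz := h.size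
  have hsh := h.shape
  cases w with
  | A m hm =>
    cases v with
    | D _ _ => cases hsh
    | A m' hm' =>
      change s.length + 1 + 0 = m at hsz
      have h2 : l.length + 1 = m := hl.2.1
      exact exists_adm_A rfl h.mem h.hasTop (by omega) hl.1 hl.2.2
  | D m hm =>
    cases v with
    | A _ _ => cases hsh
    | D m' hm' =>
      obtain ⟨hu, e, s', rfl, he, hs', h2⟩ := hl
      change s.length + 1 + 2 = m at hsz
      obtain ⟨g, h3, h4, h5, h6⟩ := exists_adm_D rfl hu h.mem h.hasTop (by omega) he hs'
      exact ⟨g, h3, h4, by rw [marked, List.map_cons, h5, h6]⟩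

end

/-! ### The endomorphism ring of the sum of the representations on chains -/

/-- Descending induction on `μ`: the image of a basis vector is the corresponding unit vector plus
unit vectors of larger `μ`, which are already in the range. -/
theorem surjective_of_unitriangular {k Q : Type*} [CommRing k] [Finite Q]
    (φ : (Q →₀ k) →ₗ[k] (Q → k)) (μ : Q → ℕ) (h1 : ∀ q, φ (Finsupp.single q 1) q = 1)
    (h2 : ∀ q q', φ (Finsupp.single q 1) q' ≠ 0 → q' ≠ q → μ q < μ q') :
    Function.Surjective φ := by
  classical
  have := Fintype.ofFinite Q
  have hb : ∃ N, ∀ q, μ q ≤ N := ⟨∑ q, μ q, fun q => Finset.single_le_sum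
    (f := μ) (fun _ _ => Nat.zero_le _) (Finset.mem_univ q)⟩
  obtain ⟨N, hN⟩ := hb
  have key : ∀ j q, N - μ q = j → (Pi.single q 1 : Q → k) ∈ LinearMap.range φ := by
    intro j
    induction j using Nat.strong_induction_on with
    | _ j ih =>
      rintro q rfl
      have h3 : (Pi.single q 1 : Q → k) = φ (Finsupp.single q 1) -
          ∑ q' ∈ Finset.univ.erase q, φ (Finsupp.single q 1) q' • (Pi.single q' 1 : Q → k) := by
        rw [eq_sub_iff_add_eq]
        have h4 := pi_eq_sum_univ' (φ (Finsupp.single q 1))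
        rw [← Finset.add_sum_erase _ _ (Finset.mem_univ q), h1, one_smul] at h4
        exact h4.symm
      rw [h3]
      refine sub_mem ⟨_, rfl⟩ (sum_mem fun q' hq' => ?_)
      by_cases h0 : φ (Finsupp.single q 1) q' = 0
      · rw [h0, zero_smul]; exact zero_mem _
      · have := h2 q q' h0 (Finset.ne_of_mem_erase hq')
        have := hN q'
        exact Submodule.smul_mem _ _ (ih (N - μ q') (by omega) q' rfl)
  rw [← LinearMap.range_eq_top, eq_top_iff]
  intro x _
  rw [pi_eq_sum_univ' x]
  exact sum_mem fun q _ => Submodule.smul_mem _ _ (key _ q rfl)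

section
variable {k : Type*} [CommRing k] {n r : ℕ} {u v w : Node n r}

open Ladder ListMod

variable (n r) in
/-- The admissible maps. -/
structure AdmMap where
  src : Node n r
  tgt : Node n r
  map : ℕ → ℕ
  adm : Adm src tgt map

instance : Finite (AdmMap n r) := by
  refine Finite.of_injective (β := Node n r × Node n r × (Fin (n + 2) → Fin (n + 2)))
    -- The minimum only serves to land in a finite type: values at vertices are at most `n`, so
    -- nothing is lost there.
    (fun q => ⟨q.src, q.tgt, fun x => ⟨min (q.map x) (n + 1), by omega⟩⟩) ?_
  rintro ⟨v, u, f, hf⟩ ⟨v', u', g, hg⟩ h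
  simp only [Prod.mk.injEq] at h
  obtain ⟨rfl, rfl, h⟩ := h
  have hsz (w : Node n r) : w.last ≤ n := by
    cases w with
    | A m h => change m - 1 ≤ n; omega
    | D m h => change m - 1 ≤ n; omega
  have hle {f : ℕ → ℕ} (hf : Adm v u f) {x : ℕ} (hx : x < v.size) : f x ≤ n := by
    have h1 := hsz u
    by_cases hx' : x < v.last
    · have := hf.lt x hx'; omega
    · have h2 : v.last = v.size - 1 := rfl
      obtain rfl : x = v.last := by omega
      rw [hf.last_self]; exact h1
  congr 1
  refine hf.ext hg fun x hx => ?_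
  have h1 := hle hf hx
  have h2 := hle hg hx
  have h3 := hsz v
  have h4 : v.last = v.size - 1 := rfl
  have h5 := congrArg Fin.val (congrFun h ⟨x, by omega⟩)
  simp only at h5
  omega

namespace AdmMap

variable (hr : r = 1 ∨ r = 2) (q : AdmMap n r)

theorem exists_node (hr : r = 1 ∨ r = 2) (q : AdmMap n r) :
    ∃ w : Node n r, IsGenerator w q.src (jumps q.src q.map) := by
  obtain ⟨w, h⟩ := exists_isMarkedAt hr (jumps_mem_innerChains q.map) q.adm.hasTop_jumps
  exact ⟨w, h, q.adm.hasTop_jumps⟩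

/-- The vertex of the generator given by the jumps. -/
def node : Node n r := (q.exists_node hr).choose

theorem isGenerator : IsGenerator (q.node hr) q.src (jumps q.src q.map) :=
  (q.exists_node hr).choose_spec

/-- The vertices at which the map jumps, with the source `0` in the top row. -/
abbrev word : List ℕ := marked q.src (jumps q.src q.map)

variable (k) in
/-- The generator given by the jumps. -/
def vec : ConfRep k n r :=
  LinearMap.single (LadderAlgebra k n r) (fun v : Node n r => ChainRep k v) q.src
    (markedVec k (q.isGenerator hr).toIsMarkedAt)

variable (k) in
/-- The matrix coefficient of an endomorphism at an admissible map. -/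
def coeff : Module.End (LadderAlgebra k n r) (ConfRep k n r) →ₗ[k] k where
  toFun Φ := (Φ (q.vec k hr) q.tgt (q.node hr) : ListMod k) (q.word.map q.map)
  map_add' _ _ := rfl
  map_smul' _ _ := rfl

theorem coeff_apply (Φ : Module.End (LadderAlgebra k n r) (ConfRep k n r)) :
    q.coeff k hr Φ = (Φ (q.vec k hr) q.tgt (q.node hr) : ListMod k) (q.word.map q.map) := rfl

end AdmMap

/-- It suffices to test `Φ` on generators. Each coefficient of the image of a generator belongs to a
chain in the same component, and `exists_adm` names this coefficient by an admissible map. -/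
theorem eq_zero_of_coeff_eq_zero (hr : r = 1 ∨ r = 2)
    (Φ : Module.End (LadderAlgebra k n r) (ConfRep k n r))
    (h : ∀ q : AdmMap n r, q.coeff k hr Φ = 0) : Φ = 0 := by
  refine LinearMap.pi_ext' fun v => ?_
  rw [LinearMap.zero_comp, ← LinearMap.ker_eq_top]
  refine eq_top_of_generators_mem hr fun w s hs => ?_
  rw [LinearMap.mem_ker, LinearMap.comp_apply]
  funext u
  funext w'
  refine Subtype.ext ?_
  by_cases hw : w' = w
  · subst hw
    refine Finsupp.ext fun l => ?_
    by_cases hl : l ∈ chains w' u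
    · obtain ⟨g, hg, rfl, rfl⟩ := exists_adm hs hl
      obtain rfl : w' = (AdmMap.mk v u g hg).node hr := by
        have h1 := AdmMap.isGenerator hr (AdmMap.mk v u g hg)
        exact node_ext (hs.shape.trans h1.shape.symm) (hs.size.symm.trans h1.size)
      exact h ⟨v, u, g, hg⟩
    · exact Finsupp.notMem_support_iff.1 fun h1 =>
        hl (Subtype.prop (p := (· ∈ chainMod k w' u)) _ h1)
  -- The idempotent `e_w` fixes the generator, so its image has no components at other vertices.
  · rw [← vert_smul_markedVec hs.toIsMarkedAt, LinearMap.map_smul, LinearMap.map_smul,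
      Pi.smul_apply, vert_smul, chainSingle_of_ne hw]
    rfl

open Classical in
theorem nodeOp_marked {s : List ℕ} {f : ℕ → ℕ} (h : IsMarkedAt w v s) :
    nodeOp k f w (of k (marked v s)) = if (s.map f).Pairwise (fun x y => y < x) then
      of k ((marked v s).map f) else 0 := by
  have hsh := h.shape
  cases w with
  | A m hm =>
    cases v with
    | D _ _ => cases hsh
    | A m' hm' =>
      rw [nodeOp, marked, push_of]
      split_ifs with h1
      · exact strictPart_of h1
      · exact strictPart_of_not h1
  | D m hm =>
    cases v with
    | A _ _ => cases hsh
    | D m' hm' =>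
      rw [nodeOp, marked, ← pre_of, pushTail_pre, push_of]
      split_ifs with h1
      · rw [strictPart_of h1, pre_of]; rfl
      · rw [strictPart_of_not h1, map_zero]

namespace AdmMap

open Classical in
theorem coeff_confEnd_mk (hr : r = 1 ∨ r = 2) {f g : ℕ → ℕ} (hf : Adm v u f) (hg : Adm v u g) :
    (AdmMap.mk v u g hg).coeff k hr (confEnd k hf) =
      if (marked v (jumps v g)).map f = (marked v (jumps v g)).map g then 1 else 0 := by
  set q : AdmMap n r := ⟨v, u, g, hg⟩
  have hq := q.isGenerator hr
  have h1 : (confEnd k hf (q.vec k hr) u (q.node hr) : ListMod k) =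
      nodeOp k f (q.node hr) (of k q.word) := by
    rw [confEnd_apply, Pi.single_eq_same, pushHom_apply, vec]
    congr 1
    refine congrArg Subtype.val (a₂ := ⟨of k q.word, of_mem hq.mem_chains⟩) ?_
    refine (congrFun (Pi.single_eq_same (M := fun v : Node n r => ChainRep k v) v _) _).trans ?_
    exact chainSingle_same _ _
  rw [coeff_apply, h1, nodeOp_marked hq.toIsMarkedAt]
  by_cases h2 : (marked v (jumps v g)).map f = (marked v (jumps v g)).map g
  · have h3 : (jumps v g).map f = (jumps v g).map g := by
      rw [List.map_inj_left] at h2 ⊢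
      intro x hx
      refine h2 x ?_
      cases v with
      | A _ _ => exact hx
      | D _ _ => exact List.mem_cons_of_mem _ hx
    rw [if_pos h2, if_pos (by rw [show q.src = v from rfl, h3]; exact hg.pairwise_map_jumps)]
    exact (Finsupp.single_apply ..).trans (if_pos h2)
  · rw [if_neg h2]
    split_ifs with h3
    · exact (Finsupp.single_apply ..).trans (if_neg h2)
    · rfl

theorem coeff_confEnd_self (hr : r = 1 ∨ r = 2) (q : AdmMap n r) :
    q.coeff k hr (confEnd k q.adm) = 1 := by
  rw [coeff_confEnd_mk, if_pos rfl]

/-- The sum of the values. -/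
def weight (q : AdmMap n r) : ℕ := ∑ x ∈ Finset.range q.src.last, q.map x

/-- A nonzero coefficient of `f` at `g` means that `f` and `g` agree on the word of `g`, hence `f ≤
g` pointwise. If `f ≠ g`, the sum of the values is strictly smaller. -/
theorem weight_lt_of_coeff_ne_zero (hr : r = 1 ∨ r = 2) (q q' : AdmMap n r)
    (h : q'.coeff k hr (confEnd k q.adm) ≠ 0) (hne : q' ≠ q) : q.weight < q'.weight := by
  obtain ⟨v, u, f, hf⟩ := q
  obtain ⟨v', u', g, hg⟩ := q'
  have hu : u' = u := by
    by_contra hu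
    apply h
    rw [coeff_apply, confEnd_apply, Pi.single_eq_of_ne hu]
    rfl
  subst hu
  have hv : v = v' := by
    by_contra hv
    apply h
    rw [coeff_apply, confEnd_apply, vec]
    have h1 : LinearMap.single (LadderAlgebra k n r) (fun v : Node n r => ChainRep k v) v'
        (markedVec k ((AdmMap.mk v' u' g hg).isGenerator hr).toIsMarkedAt) v = 0 :=
      Pi.single_eq_of_ne hv _
    rw [h1, map_zero, Pi.single_zero]
    rfl
  subst hv
  rw [coeff_confEnd_mk] at h
  have h1 : (marked v (jumps v g)).map f = (marked v (jumps v g)).map g := by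
    by_contra hc
    exact h (if_neg hc)
  have h2 (x) (hx : x ∈ Finset.range v.last) : f x ≤ g x :=
    hg.le_of_map_marked_eq hf h1 (Finset.mem_range.1 hx)
  refine Finset.sum_lt_sum h2 ?_
  by_contra! hc
  refine hne ?_
  congr 1
  refine hg.ext hf fun x hx => ?_
  by_cases hx' : x < v.last
  · exact le_antisymm (hc x (Finset.mem_range.2 hx')) (h2 x (Finset.mem_range.2 hx'))
  · have h3 : v.last = v.size - 1 := rfl
    obtain rfl : x = v.last := by omega
    rw [hf.last_self, hg.last_self]

end AdmMap

/-! ### The algebra of the configuration as an endomorphism ring. -/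

variable (k) in
/-- All matrix coefficients. -/
def coeffs (hr : r = 1 ∨ r = 2) :
    Module.End (LadderAlgebra k n r) (ConfRep k n r) →ₗ[k] (AdmMap n r → k) :=
  LinearMap.pi fun q => q.coeff k hr

theorem coeffs_injective (hr : r = 1 ∨ r = 2) : Function.Injective (coeffs (n := n) k hr) :=
  (injective_iff_map_eq_zero _).2 fun Φ h => eq_zero_of_coeff_eq_zero hr Φ (congrFun h)

section
variable (F : Type*) [Field F]

variable (k) in
/-- The element of the algebra of the configuration given by an admissible map. -/
def ofAdm (hr : r = 1 ∨ r = 2) (q : AdmMap n r) : ConfAlgebra F n r k :=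
  RingQuot.mkAlgHom k _ (PathAlgebra.ofPath k (exists_path hr q.adm).choose)

theorem ofAdm_path (hr : r = 1 ∨ r = 2) (hr' : 1 ≤ r) {u v : Conf n r} (p : Quiver.Path u v) :
    ofAdm k F hr ⟨v, u, vmap p, Adm.path hr' p⟩ =
      RingQuot.mkAlgHom k (ConfRel F n r k) (PathAlgebra.ofPath k p) :=
  RingQuot.mkAlgHom_rel k (.mk _ _ (nonempty_evalPath_iso F _ _
    (exists_path hr (Adm.path hr' p)).choose_spec))

theorem confAction_ofAdm (hr : r = 1 ∨ r = 2) (hr' : 1 ≤ r) (q : AdmMap n r) :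
    confAction k n F hr' (ofAdm k F hr q) = MulOpposite.op (confEnd k q.adm) :=
  (confAction_ofPath F hr' _).trans
    (congrArg MulOpposite.op (confEnd_congr _ _ (exists_path hr q.adm).choose_spec))

theorem linearCombination_ofAdm_surjective (hr : r = 1 ∨ r = 2) :
    Function.Surjective (Finsupp.linearCombination k (ofAdm (n := n) k F hr)) := by
  rw [← LinearMap.range_eq_top, eq_top_iff]
  intro x _
  obtain ⟨x, rfl⟩ := RingQuot.mkAlgHom_surjective k _ x
  induction x using PathAlgebra.induction with
  | h0 => rw [map_zero]; exact zero_mem _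
  | hadd x y hx hy => rw [map_add]; exact add_mem (hx trivial) (hy trivial)
  | hsmul c u v p =>
    rw [map_smul, ← ofAdm_path F hr (by omega) p]
    exact Submodule.smul_mem _ _ ⟨Finsupp.single _ 1, by
      rw [Finsupp.linearCombination_single, one_smul]⟩

/-- The free module on the admissible maps surjects onto the algebra, which acts on `T`, and the
coefficients embed the endomorphisms in a free module of the same rank. The composite is
unitriangular, hence bijective, so the maps in between are bijective too. -/
theorem confAction_bijective (hr : r = 1 ∨ r = 2) (hr' : 1 ≤ r) :
    Function.Bijective (confAction k n F hr') := by
  let ev : (Module.End (LadderAlgebra k n r) (ConfRep k n r))ᵐᵒᵖ →ₗ[k] (AdmMap n r → k) :=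
    coeffs k hr ∘ₗ (MulOpposite.opLinearEquiv k).symm.toLinearMap
  let σ := Finsupp.linearCombination k (ofAdm (n := n) k F hr)
  let φ := ev ∘ₗ (confAction k n F hr').toLinearMap ∘ₗ σ
  have hev : Function.Injective ev :=
    (coeffs_injective hr).comp (MulOpposite.opLinearEquiv k).symm.injective
  have hσ : Function.Surjective σ := linearCombination_ofAdm_surjective F hr
  have hφ (q q') : φ (Finsupp.single q 1) q' = q'.coeff k hr (confEnd k q.adm) := by
    show ev (confAction k n F hr' (σ _)) q' = _
    rw [Finsupp.linearCombination_single, one_smul, confAction_ofAdm]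
    rfl
  have hsurj : Function.Surjective φ := surjective_of_unitriangular φ AdmMap.weight
    (fun q => by rw [hφ, AdmMap.coeff_confEnd_self])
    (fun q q' h hne => AdmMap.weight_lt_of_coeff_ne_zero hr q q' (by rwa [hφ] at h) hne)
  -- A surjection between free modules of the same finite rank over a commutative ring is injective.
  have hinj : Function.Injective φ :=
    OrzechProperty.injective_of_surjective_of_injective
      (Finsupp.linearEquivFunOnFinite k k (AdmMap n r)).toLinearMap φ
      (LinearEquiv.injective _) hsurj
  constructor
  · intro x y hxy
    obtain ⟨x, rfl⟩ := hσ x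
    obtain ⟨y, rfl⟩ := hσ y
    exact congrArg σ (hinj (congrArg ev hxy))
  · intro Φ
    obtain ⟨x, hx⟩ := hsurj (ev Φ)
    exact ⟨σ x, hev hx⟩

end

end

/-! ### The Morita equivalence -/

section
variable {k : Type*} [CommRing k] {n r : ℕ}

open Ladder ListMod

/-- All numbers from the first one that is not a source exchanged by `t` up to the last but one, in
decreasing order. -/
def fullChain (v : Node n r) : List ℕ :=
  (List.range' v.shape.base (v.last - v.shape.base)).reverse

theorem fullChain_mem_innerChains (v : Node n r) : fullChain v ∈ innerChains v := by
  refine ⟨List.pairwise_reverse.2 List.pairwise_lt_range', fun x hx => ?_⟩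
  have h := List.mem_range'_1.1 (List.mem_reverse.1 hx)
  omega

/-- The longest inner chain of `v` lies in the component at `v` itself. Its dual therefore takes the
value `e_v` on it, which makes `T` a generator. -/
theorem isGenerator_fullChain (v : Node n r) (hr : 1 ≤ r) : IsGenerator v v (fullChain v) := by
  have hb := base_le_last v
  refine ⟨⟨fullChain_mem_innerChains v, rfl, ?_⟩,
    hasTop_of_mem (fullChain_mem_innerChains v) fun h =>
      List.mem_reverse.2 (List.mem_range'_1.2 (by omega))⟩
  have h1 : v.last = v.size - 1 := rfl
  have h2 : 1 ≤ v.size := by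
    cases v with
    | A m h => exact hr.trans h.1
    | D m h => exact le_trans (by norm_num) h.1
  rw [fullChain, List.length_reverse, List.length_range']
  omega

/-- The dual basis identity is linear in `y`, so it can be checked on generators. There a single
term survives, namely `e_w` times the generator, which is the generator. -/
theorem sum_dual_smul {v : Node n r} (hr : r = 1 ∨ r = 2) [Fintype (GenIndex v)]
    (Ξ : GenIndex v → (ChainRep k v →ₗ[LadderAlgebra k n r] LadderAlgebra k n r))
    (hΞ : ∀ j w s (h : IsGenerator w v s),
      Ξ j (markedVec k h.toIsMarkedAt) = open Classical in
        if s = j.1.2 then ladderMk n r k (vert k j.1.1) else 0)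
    (y : ChainRep k v) : ∑ j, Ξ j y • markedVec k j.2.toIsMarkedAt = y := by
  classical
  let Ψ : ChainRep k v →ₗ[LadderAlgebra k n r] ChainRep k v :=
    ∑ j, (LinearMap.toSpanSingleton _ _ (markedVec k j.2.toIsMarkedAt)) ∘ₗ Ξ j
  have hΨ (y) : Ψ y = ∑ j, Ξ j y • markedVec k j.2.toIsMarkedAt := by
    simp only [Ψ, LinearMap.sum_apply]; rfl
  have htop : LinearMap.eqLocus Ψ LinearMap.id = ⊤ := by
    refine eq_top_of_generators_mem hr fun w s h => ?_
    rw [LinearMap.mem_eqLocus, hΨ, Finset.sum_eq_single ⟨(w, s), h⟩]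
    · rw [hΞ _ w s h, if_pos rfl, vert_smul_markedVec]; rfl
    · rintro ⟨⟨w', s'⟩, h'⟩ _ hne
      rw [hΞ _ w s h, if_neg, zero_smul]
      intro hs
      refine hne ?_
      change s = s' at hs
      subst hs
      obtain rfl : w' = w := node_ext (h'.shape.trans h.shape.symm) (h'.size.symm.trans h.size)
      rfl
    · simp
  rw [← hΨ]
  have hy : y ∈ LinearMap.eqLocus Ψ LinearMap.id := by rw [htop]; trivial
  exact hy

theorem isMoritaEquivalent_end (hr : r = 1 ∨ r = 2) : IsMoritaEquivalent k (LadderAlgebra k n r)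
    (Module.End (LadderAlgebra k n r) (ConfRep k n r))ᵐᵒᵖ := by
  classical
  have hr' : 1 ≤ r := by omega
  have hfin (v : Node n r) : Fintype (GenIndex v) := Fintype.ofFinite _
  choose Ξ hΞ using fun (v : Node n r) (j : GenIndex v) => exists_dual (k := k) hr' j.2
  let ι (v : Node n r) : ChainRep k v →ₗ[LadderAlgebra k n r] ConfRep k n r :=
    LinearMap.single (LadderAlgebra k n r) (fun v : Node n r => ChainRep k v) v
  let π (v : Node n r) : ConfRep k n r →ₗ[LadderAlgebra k n r] ChainRep k v :=
    LinearMap.proj (φ := fun v : Node n r => ChainRep k v) v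
  have hπι (v) (y : ChainRep k v) : π v (ι v y) = y :=
    Pi.single_eq_same (M := fun v : Node n r => ChainRep k v) v y
  refine Progenerator.isMoritaEquivalent k (I := Node n r) (J := Σ v : Node n r, GenIndex v)
    (fun v => ι v (markedVec k (isGenerator_fullChain v hr').toIsMarkedAt))
    (fun v => Ξ v ⟨(v, fullChain v), isGenerator_fullChain v hr'⟩ ∘ₗ π v)
    (fun j => ι j.1 (markedVec k j.2.2.toIsMarkedAt)) (fun j => Ξ j.1 j.2 ∘ₗ π j.1) ?_ fun y => ?_
  · refine Eq.trans (Finset.sum_congr rfl fun v _ => ?_)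
      ((map_sum (ladderMk n r k) (fun v => vert k v) Finset.univ).symm.trans
        (map_one (ladderMk n r k)))
    rw [LinearMap.comp_apply, hπι, hΞ _ _ _ _ (isGenerator_fullChain v hr'), if_pos rfl]
  · rw [Fintype.sum_sigma]
    refine Eq.trans (Finset.sum_congr rfl fun v _ => ?_) (Finset.univ_sum_single y)
    refine Eq.trans ?_ (congrArg (ι v) (sum_dual_smul hr (Ξ v) (fun j w s h => ?_) (y v)))
    · rw [map_sum]
      exact Finset.sum_congr rfl fun j _ => ((ι v).map_smul _ _).symm
    · rw [hΞ v j w s h]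

end

end QuiverConf

end

/-- `F` is the field over which quiver representations are taken, `k` the base ring of the algebras.
The bottom row of the configuration consists of `A_n, …, A_r`: it ends at `A_1` for `r = 1`, and at
`A_2` for `r = 2`. -/
theorem mainTheorem7 (F : Type*) [Field F] (k : Type*) [CommRing k] [IsDomain k]
    [IsPrincipalIdealRing k] (n : ℕ) (hn : 2 ≤ n) (r : ℕ) (hr : r = 1 ∨ r = 2) :
    IsMoritaEquivalent k (QuiverConf.ConfAlgebra F n r k) (QuiverConf.LadderAlgebra k n r) := by
  have hr' : 1 ≤ r := by omega
  exact .trans k (.of_algEquiv k (AlgEquiv.ofBijective (QuiverConf.confAction k n F hr')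
    (QuiverConf.confAction_bijective F hr hr'))) (.symm k (QuiverConf.isMoritaEquivalent_end hr))
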